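/- **Definitions.** Complex manifolds are connected (Hausdorff, second countable); a domain in $\mathbb C^n$ is a nonempty connected open subset. For an $n$-dimensional complex manifold $M$, the Bergman space $A^2_{(n,0)}(M)$ is the space of holomorphic $(n,0)$-forms $f$ on $M$ with $\|f\|^2=(\sqrt{-1})^{n^2}\int_M f\wedge\bar f<\infty$. Suppose that $A^2_{(n,0)}(M)\neq\{0\}$. A closed proper subset $E\subsetneq M$ is *Bergman negligible* if every $\psi\in A^2_{(n,0)}(M\setminus E)$ extends to some $\phi\in A^2_{(n,0)}(M)$ with the same norm. For complex manifolds $M_1,M_2$ with nontrivial Bergman spaces, write $M_1\preceq_B M_2$ if $M_1$ is biholomorphic to $M_2\setminus E$ for some Bergman negligible $E\subseteq M_2$. *Bergman equivalence* is the equivalence relation generated by $\preceq_B$ (through finite chains of complex manifolds), and *Bergman inequivalent* means not Bergman equivalent. For a domain $\Omega\subseteq\mathbb C^n$, $A^2(\Omega)$ is the space of holomorphic functions on $\Omega$ that are square integrable for Lebesgue measure, and the Bergman kernel of $\Omega$ is $K_\Omega(z,w)=\sum_k\phi_k(z)\overline{\phi_k(w)}$ for any orthonormal basis $\{\phi_k\}$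 of $A^2(\Omega)$. For $C>0$ let $\mathcal F(m,n;C)$ be the set of domains $\Omega\subseteq\mathbb C^n$ with $K_\Omega(z,z)=C(1+\|z\|^2)^m$ for all $z\in\Omega$, where $\|z\|^2=\sum_j|z_j|^2$. A domain is *Reinhardt* if it is invariant under $(z_1,\dots,z_n)\mapsto(\zeta_1z_1,\dots,\zeta_nz_n)$ for all $|\zeta_1|=\dots=|\zeta_n|=1$. **Theorem.** Let $m\ge 1$ and $n\ge 2$ be integers. (1) Let $C,C'>0$, $\Omega\in\mathcal F(m,n;C)$ and $\Omega'\in\mathcal F(m,n;C')$. If $C\ne C'$, then $\Omega$ and $\Omega'$ are Bergman inequivalent. (2) There is a constant $C_{m,n}>0$, depending only on $m$ and $n$, such that - for every $C>C_{m,n}$ there is an unbounded Reinhardt domain $\Omega_C\in\mathcal F(m,n;C)$ whose Bergman space $A^2(\Omega_C)$ is spanned by the monomials $z^\alpha$, $\alpha\in\mathbb N^n$, $|\alpha|\le m$; and - for every $C>C_{m,n}$, $\mathcal F(m,n;C)$ contains a family $\{\Omega_C(\mu):\mu\in(0,1)\}$ of unbounded Reinhardt domains, with $\Omega_C(\mu)$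 and $\Omega_C(\mu')$ Bergman inequivalent whenever $\mu\ne\mu'$, and these families can be chosen such that $\Omega_C(\mu)\cap\Omega_{C'}(\mu')\neq\emptyset$ for all (not necessarily distinct) $C,C'>C_{m,n}$ and $\mu,\mu'\in(0,1)$. -/

import Mathlib

open Set MeasureTheory TopologicalSpace
open scoped Manifold ContDiff ENNReal ComplexConjugate

noncomputable section

namespace Bergman

/-- The space `ℂⁿ`, with its product topology and Lebesgue measure. The Euclidean norm is always
written out as `∑ i, ‖z i‖ ^ 2`. -/
abbrev Cn (n : ℕ) : Type := Fin n → ℂ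

/-! ### Holomorphic `(n,0)`-forms on complex manifolds -/

section Forms

variable {n : ℕ} {M : Type} [TopologicalSpace M] [ChartedSpace (Cn n) M]

/-- A (not necessarily continuous) `(n,0)`-form on an `n`-dimensional complex manifold `M`: at each
point, an alternating complex `n`-linear form on the holomorphic tangent space. -/
abbrev TopForm (n : ℕ) (M : Type) [TopologicalSpace M] [ChartedSpace (Cn n) M] : Type :=
  (x : M) → (TangentSpace 𝓘(ℂ, Cn n) x) [⋀^Fin n]→L[ℂ] ℂ

/-- The coefficient `f_e` of the form `f` in the chart `e`, that is `f = f_e dz₁ ∧ ⋯ ∧ dzₙ`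
in the coordinates `z` given by `e`: the value of `f` on the coordinate vector fields. -/
def TopForm.coeff (f : TopForm n M) (e : OpenPartialHomeomorph M (Cn n)) (z : Cn n) : ℂ :=
  f (e.symm z) fun i =>
    mfderiv 𝓘(ℂ, Cn n) 𝓘(ℂ, Cn n) e.symm z (Pi.single i (1 : ℂ) : Cn n)

/-- The form `f` is holomorphic on the set `U` (which is open in all uses). -/
def TopForm.HolomorphicOn (f : TopForm n M) (U : Set M) : Prop :=
  ∀ e ∈ atlas (Cn n) M, DifferentiableOn ℂ (f.coeff e) (e.target ∩ e.symm ⁻¹' U)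

/-- The squared `L²` norm `(√-1)^{n²} ∫_U f ∧ f̄` of the form `f` over the set `U`.
In a chart `e` the integrand is `2ⁿ |f_e|² dV` with `dV` Lebesgue measure; the integral over `U` is
the supremum of the integrals over finite disjoint unions of Borel sets, each of which lies in
`U` and in the domain of a chart. -/
def TopForm.normSqOn (f : TopForm n M) (U : Set M) : ℝ≥0∞ :=
  ⨆ (k : ℕ) (e : Fin k → OpenPartialHomeomorph M (Cn n)) (B : Fin k → Set M)
    (_ : ∀ i, e i ∈ atlas (Cn n) M ∧ MeasurableSet[borel M] (B i) ∧ B i ⊆ (e i).source ∩ U)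
    (_ : Pairwise fun i j => Disjoint (B i) (B j)),
    ∑ i, ∫⁻ z in (e i) '' (B i), 2 ^ n * ‖f.coeff (e i) z‖ₑ ^ 2

/-- `f` belongs to the Bergman space `A²_{(n,0)}(U)` of the open subset `U` of `M`
(values of `f` outside `U` are irrelevant). -/
def TopForm.MemA2 (f : TopForm n M) (U : Set M) : Prop :=
  f.HolomorphicOn U ∧ f.normSqOn U < (⊤ : ℝ≥0∞)

end Forms

/-! ### Complex manifolds and Bergman equivalence -/

/-- Connected complex manifolds of dimension `n` (Hausdorff and second countable). -/
structure CManifold (n : ℕ) where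
  carrier : Type
  [top : TopologicalSpace carrier]
  [t2 : T2Space carrier]
  [sc : SecondCountableTopology carrier]
  [conn : ConnectedSpace carrier]
  [charted : ChartedSpace (Cn n) carrier]
  [mfd : IsManifold 𝓘(ℂ, Cn n) ω carrier]

attribute [instance] CManifold.top CManifold.t2 CManifold.sc CManifold.conn CManifold.charted
  CManifold.mfd

/-- The Bergman space `A²_{(n,0)}(M)` is nontrivial. -/
def CManifold.NontrivialA2 {n : ℕ} (M : CManifold n) : Prop :=
  ∃ f : TopForm n M.carrier, f.MemA2 univ ∧ ∃ x, f x ≠ 0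

/-- `E` is a Bergman negligible subset of `M`: it is a closed proper subset and every form in
`A²_{(n,0)}(M ∖ E)` extends to a form in `A²_{(n,0)}(M)` of the same `L²` norm. -/
def CManifold.Negligible {n : ℕ} (M : CManifold n) (E : Set M.carrier) : Prop :=
  IsClosed E ∧ E ≠ univ ∧
    ∀ ψ : TopForm n M.carrier, ψ.MemA2 Eᶜ →
      ∃ φ : TopForm n M.carrier, φ.MemA2 univ ∧ (∀ x ∈ Eᶜ, φ x = ψ x) ∧
        φ.normSqOn univ = ψ.normSqOn Eᶜ

/-- The relation `M₁ ⪯_B M₂` between complex manifolds with nontrivial Bergman spaces: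
`M₁` is biholomorphic to the complement of a Bergman negligible subset of `M₂`. -/
def BergmanLE {n : ℕ} (M₁ M₂ : CManifold n) : Prop :=
  M₁.NontrivialA2 ∧ M₂.NontrivialA2 ∧
    ∃ U : Opens M₂.carrier, M₂.Negligible (U : Set M₂.carrier)ᶜ ∧
      Nonempty (Diffeomorph 𝓘(ℂ, Cn n) 𝓘(ℂ, Cn n) M₁.carrier U ω)

/-- Bergman equivalence: the equivalence relation generated by `⪯_B`. -/
def BergmanEquiv {n : ℕ} : CManifold n → CManifold n → Prop :=
  Relation.EqvGen BergmanLE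

/-! ### Domains in `ℂⁿ` -/

/-- A domain in `ℂⁿ`: a nonempty connected open subset. -/
structure CDomain (n : ℕ) where
  carrier : Opens (Cn n)
  connected : IsConnected (carrier : Set (Cn n))

/-- The underlying set of a domain. -/
def CDomain.set {n : ℕ} (Ω : CDomain n) : Set (Cn n) := (Ω.carrier : Set (Cn n))

/-- A domain, regarded as a complex manifold (as an open submanifold of `ℂⁿ`). -/
def CDomain.toManifold {n : ℕ} (Ω : CDomain n) : CManifold n :=
  haveI : ConnectedSpace Ω.carrier := isConnected_iff_connectedSpace.mp Ω.connected
  { carrier := Ω.carrier }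

/-- Reinhardt domains: invariant under `(z₁, …, zₙ) ↦ (ζ₁ z₁, …, ζₙ zₙ)` with `|ζⱼ| = 1`. -/
def CDomain.IsReinhardt {n : ℕ} (Ω : CDomain n) : Prop :=
  ∀ z ∈ Ω.set, ∀ ζ : Fin n → ℂ, (∀ j, ‖ζ j‖ = 1) → (fun j => ζ j * z j) ∈ Ω.set

/-- `Ω` is unbounded. -/
def CDomain.IsUnbounded {n : ℕ} (Ω : CDomain n) : Prop := ¬ Bornology.IsBounded Ω.set

/-- `f` belongs to the Bergman space `A²(Ω)` of square integrable holomorphic functions on `Ω`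
(values of `f` outside `Ω` are irrelevant). -/
def CDomain.MemA2 {n : ℕ} (Ω : CDomain n) (f : Cn n → ℂ) : Prop :=
  DifferentiableOn ℂ f Ω.set ∧ MemLp f 2 (volume.restrict Ω.set)

/-- The inner product `∫_Ω f ḡ dV` of `A²(Ω)`. -/
def CDomain.inner {n : ℕ} (Ω : CDomain n) (f g : Cn n → ℂ) : ℂ :=
  ∫ z in Ω.set, f z * conj (g z)

/-- `φ` is an orthonormal basis (a complete orthonormal system) of the Bergman space `A²(Ω)`. -/
def CDomain.IsOrthonormalBasis {n : ℕ} (Ω : CDomain n) {ι : Type} (φ : ι → Cn n → ℂ) : Prop :=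
  (∀ k, Ω.MemA2 (φ k)) ∧
  (∀ k, Ω.inner (φ k) (φ k) = 1) ∧ (∀ k l, k ≠ l → Ω.inner (φ k) (φ l) = 0) ∧
  ∀ f, Ω.MemA2 f → (∀ k, Ω.inner f (φ k) = 0) → ∀ z ∈ Ω.set, f z = 0

/-- `K` is the Bergman kernel of `Ω`: `K(z,w) = ∑ₖ φₖ(z) conj φₖ(w)` for `z, w ∈ Ω`, where `φ` is an
orthonormal basis of `A²(Ω)` (the sum does not depend on the choice of the basis). -/
def CDomain.IsBergmanKernel {n : ℕ} (Ω : CDomain n) (K : Cn n → Cn n → ℂ) : Prop :=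
  ∃ (s : Set ℕ) (φ : s → Cn n → ℂ), Ω.IsOrthonormalBasis φ ∧
    ∀ z ∈ Ω.set, ∀ w ∈ Ω.set, HasSum (fun k => φ k z * conj (φ k w)) (K z w)

/-- The set `𝓕(m,n;C)` of domains in `ℂⁿ` with Bergman kernel `K(z,z) = C (1 + ‖z‖²)ᵐ`. -/
def FS (m n : ℕ) (C : ℝ) : Set (CDomain n) :=
  {Ω | ∃ K, Ω.IsBergmanKernel K ∧
    ∀ z ∈ Ω.set, K z z = ((C * (1 + ∑ i, ‖z i‖ ^ 2) ^ m : ℝ) : ℂ)}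

/-- The Bergman space of `Ω` is spanned by the monomials `z^α` with `α ∈ ℕⁿ`, `|α| ≤ m`. -/
def CDomain.A2SpannedByMonomials {n : ℕ} (Ω : CDomain n) (m : ℕ) : Prop :=
  ∀ f : Cn n → ℂ, Ω.MemA2 f ↔
    ∃ g ∈ Submodule.span ℂ
      {h : Cn n → ℂ | ∃ α : Fin n → ℕ, ∑ i, α i ≤ m ∧ h = fun z => ∏ i, z i ^ α i},
      EqOn f g Ω.set

end Bergman

end

noncomputable section

namespace Bergman

/-! ### Holomorphic functions of several variables -/

section SeveralVariables

open Filter Topology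

variable {E : Type*} [NormedAddCommGroup E] [NormedSpace ℂ E]

/-! Inequivalence. A Bergman negligible set has dense complement: extending `f` from the complement
returns `f` by the identity theorem, and equality of norms leaves no mass on the interior of the
set. So every generating step of the equivalence relation is a biholomorphic map onto a dense open
subset which identifies the Bergman spaces isometrically, and it preserves the diagonal kernel form
in its extremal description `sup |f|²`. Such maps between dense open subsets can be composed and
inverted (`BergmanCorrespondence`), hence equivalent domains are related by a single holomorphic `F`
with `K(z,z) = |J_F|² K'(F z, F z)` (`BergmanEquiv.exists_map`).

For kernels `C (1 + |z|²)ᵐ` and `C' (1 + |z|²)ᵐ` choose locally `g` with `gᵐ = κ J_F` and `|κ|² =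
C'/C`. The transformation law says that `G = (g, gF)` satisfies `|G|² = 1 + |z|²`. Circle averages
on complex lines force `G` to be affine, so `G(z) = A (1, z)` with `A` unitary on `ℂ ⊕ ℂⁿ`, and `F`
is projective. Its Jacobian satisfies `gⁿ⁺¹ J_F = det A`, so `gⁿ⁺¹⁺ᵐ` is constant, the first row of
`A` is `(g, 0)`, and `|g| = 1`. Therefore `|F z| = |z|`, `|J_F| = 1` and `C = C'` (`rigidity`).

Construction. On a Reinhardt domain the monomials are orthogonal, and if the domain meets every
coordinate hyperplane no Laurent monomials with negative exponents occur. It is then enough that the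
monomials of degree at most `m` have squared norms inverse to `C` times the coefficients of `(1 +
|z|²)ᵐ`, and that all others have infinite norm (`HasMonomialNorms`). In dimension `N` and with `t =
|z|²`, the radial density `c (1 + t)^{-(N+m+1)}`, with `c` a multiple of `1/C`, has these moments. A
domain, however, only has density `0` or `1`.

The density is realised by a set with the help of a label `lam` on `(0,1)`, built from Thue–Morse
words: `{lam < s}` is open and carries exactly the fraction `s` of the integral of every polynomial
of bounded degree (`exists_label`). The points with `lam (|z₀|²/|z|²) < θ(|z|²)` then have the same
low moments as the density `θ`. The profile `θ` comes from `exists_profile`: the density becomes `0`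
for `t ≤ a` and `1` for `a < t < b`, and a small polynomial bump on `(1,2)` restores the moments.
The full shell `a < t < b` makes the domain connected and lets it meet the coordinate hyperplanes;
the untouched tail makes high monomials diverge. The bound `c < 1/2`, which keeps `θ ≤ 1`, is the
condition on `C`.

Since `F` preserves the norm on a dense set, the size `a = a₀ μ` of the hole is an invariant, which
separates the members of a family. All domains share one label, so they overlap on the unit sphere.
-/

theorem eqOn_zero_ball_of_eventuallyEq_zero {f : E → ℂ} {c p : E} {r : ℝ}
    (hf : DifferentiableOn ℂ f (Metric.ball c r)) (hp : p ∈ Metric.ball c r)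
    (h0 : f =ᶠ[𝓝 p] 0) : EqOn f 0 (Metric.ball c r) := by
  intro w hw
  -- On the complex line through `p` and `w` the ball cuts out a convex, hence connected, set, and
  -- the one-variable identity theorem applies.
  let L : ℂ → E := fun t => p + t • (w - p)
  have hL : Continuous L := by fun_prop
  have hLd : Differentiable ℂ L := by fun_prop
  have hopen : IsOpen (L ⁻¹' Metric.ball c r) := Metric.isOpen_ball.preimage hL
  have hconv : Convex ℝ (L ⁻¹' Metric.ball c r) := by
    have : Convex ℝ (Metric.ball c r) := convex_ball c r
    intro x hx y hy a b ha hb hab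
    have h := this hx hy ha hb hab
    have e : L (a • x + b • y) = a • L x + b • L y := by
      simp only [L]
      have hab' : (a : ℂ) + b = 1 := by exact_mod_cast hab
      have hb' : (b : ℂ) = 1 - a := by rw [← hab']; ring
      simp only [← Complex.coe_smul, smul_eq_mul, hb']
      module
    exact mem_preimage.2 (e ▸ h)
  have hd : DifferentiableOn ℂ (f ∘ L) (L ⁻¹' Metric.ball c r) :=
    hf.comp hLd.differentiableOn (mapsTo_preimage _ _)
  have hz : (0 : ℂ) ∈ L ⁻¹' Metric.ball c r := by simpa [L] using hp
  have h1 : (1 : ℂ) ∈ L ⁻¹' Metric.ball c r := by simpa [L] using hw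
  have hev : (f ∘ L) =ᶠ[𝓝 0] 0 := by
    have : Tendsto L (𝓝 0) (𝓝 p) := by
      have := hL.tendsto 0
      simpa [L] using this
    exact this.eventually h0
  have := (hd.analyticOnNhd hopen).eqOn_zero_of_preconnected_of_eventuallyEq_zero
    hconv.isPreconnected hz hev h1
  simpa [L] using this

/-- The set of points near which `f` vanishes is open, and relatively closed by the version for
balls. -/
theorem eqOn_zero_of_isPreconnected {f : E → ℂ} {U W : Set E} (hU : IsOpen U)
    (hUc : IsPreconnected U) (hf : DifferentiableOn ℂ f U) (hW : IsOpen W) (hWU : W ⊆ U)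
    (hne : W.Nonempty) (h0 : EqOn f 0 W) : EqOn f 0 U := by
  obtain ⟨p, hp⟩ := hne
  have key : U ⊆ {z | f =ᶠ[𝓝 z] 0} := by
    refine hUc.subset_of_closure_inter_subset isOpen_setOfPred_eventually_nhds
      ⟨p, hWU hp, h0.eventuallyEq_of_mem (hW.mem_nhds hp)⟩ ?_
    rintro z ⟨hz, hzU⟩
    obtain ⟨r, hr, hball⟩ := Metric.isOpen_iff.1 hU z hzU
    obtain ⟨y, hy, hyz⟩ := Metric.mem_closure_iff.1 hz r hr
    have hyb : y ∈ Metric.ball z r := by rwa [Metric.mem_ball, dist_comm]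
    have := eqOn_zero_ball_of_eventuallyEq_zero (hf.mono hball) hyb hy
    exact this.eventuallyEq_of_mem (Metric.ball_mem_nhds z hr)
  intro z hz
  exact (key hz).self_of_nhds

/-- Schwarz lemma: `f` maps the ball into the closed ball of radius `2 * C` around `f c`, whence the
factor `2`. -/
theorem norm_fderiv_le_of_forall_mem_ball {f : E → ℂ} {c : E} {r C : ℝ} (hr : 0 < r)
    (hf : DifferentiableOn ℂ f (Metric.ball c r)) (hC : ∀ z ∈ Metric.ball c r, ‖f z‖ ≤ C) :
    ‖fderiv ℂ f c‖ ≤ 2 * C / r := by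
  refine Complex.norm_fderiv_le_div_of_mapsTo_ball hf (fun z hz => ?_) hr
  rw [mem_closedBall_iff_norm]
  have h1 := hC z hz
  have h2 := hC c (Metric.mem_ball_self hr)
  linarith [norm_sub_le (f z) (f c)]

/-- A sequence of holomorphic functions which is uniformly Cauchy near every point converges
pointwise to a holomorphic function. -/
theorem differentiableOn_of_locally_uniformCauchy {f : ℕ → E → ℂ} {U : Set E} (hU : IsOpen U)
    (hf : ∀ k, DifferentiableOn ℂ (f k) U)
    (hc : ∀ z ∈ U, ∃ r > 0, UniformCauchySeqOn f atTop (Metric.ball z r)) :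
    ∃ g : E → ℂ, DifferentiableOn ℂ g U ∧ ∀ z ∈ U, Tendsto (fun k => f k z) atTop (𝓝 (g z)) := by
  have hlim : ∀ z, ∃ w, z ∈ U → Tendsto (fun k => f k z) atTop (𝓝 w) := by
    intro z
    by_cases hz : z ∈ U
    · obtain ⟨r, hr, h⟩ := hc z hz
      obtain ⟨w, hw⟩ := cauchySeq_tendsto_of_complete (h.cauchySeq (Metric.mem_ball_self hr))
      exact ⟨w, fun _ => hw⟩
    · exact ⟨0, fun h => absurd h hz⟩
  choose g hg using hlim
  refine ⟨g, fun z hz => ?_, fun z hz => hg z hz⟩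
  obtain ⟨r, hr, h⟩ := hc z hz
  obtain ⟨r', hr', hball⟩ := Metric.isOpen_iff.1 hU z hz
  set s := min r r' with hs
  have hspos : 0 < s := lt_min hr hr'
  have hsub : Metric.ball z s ⊆ Metric.ball z r := Metric.ball_subset_ball (min_le_left _ _)
  have hsubU : Metric.ball z s ⊆ U := (Metric.ball_subset_ball (min_le_right _ _)).trans hball
  -- The derivative bound on balls of radius `s / 2` turns uniform Cauchy control of the functions
  -- into the same control of the derivatives on a smaller ball.
  have hder : UniformCauchySeqOn (fun k => fderiv ℂ (f k)) atTop (Metric.ball z (s / 2)) := by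
    rw [Metric.uniformCauchySeqOn_iff] at h ⊢
    intro ε hε
    obtain ⟨N, hN⟩ := h (ε * (s / 2) / 4) (by positivity)
    refine ⟨N, fun k hk l hl x hx => ?_⟩
    have hxb : Metric.ball x (s / 2) ⊆ Metric.ball z s := by
      intro y hy
      rw [Metric.mem_ball] at *
      linarith [dist_triangle y x z]
    have hxU : x ∈ U := hsubU (hxb (Metric.mem_ball_self (by positivity)))
    have dk := (hf k).differentiableAt (hU.mem_nhds hxU)
    have dl := (hf l).differentiableAt (hU.mem_nhds hxU)
    rw [dist_eq_norm, ← fderiv_sub dk dl]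
    have := norm_fderiv_le_of_forall_mem_ball (f := f k - f l) (c := x) (r := s / 2)
      (C := ε * (s / 2) / 4) (by positivity)
      (((hf k).sub (hf l)).mono (hxb.trans hsubU)) (fun y hy => by
        have := hN k hk l hl y (hsub (hxb hy))
        rw [dist_eq_norm] at this
        exact this.le)
    refine this.trans_lt ?_
    have : 2 * (ε * (s / 2) / 4) / (s / 2) = ε / 2 := by field_simp; norm_num
    linarith
  have hlim' : ∀ x ∈ Metric.ball z (s / 2),
      ∃ A, Tendsto (fun k => fderiv ℂ (f k) x) atTop (𝓝 A) :=
    fun x hx => cauchySeq_tendsto_of_complete (hder.cauchySeq hx)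
  choose! g' hg' using hlim'
  have hunif := hder.tendstoUniformlyOn_of_tendsto hg'
  have hsub2 : Metric.ball z (s / 2) ⊆ U :=
    (Metric.ball_subset_ball (by linarith)).trans hsubU
  refine (hasFDerivAt_of_tendstoUniformlyOn Metric.isOpen_ball hunif (fun k x hx => ?_)
    (fun x hx => hg x (hsub2 hx))
    (Metric.mem_ball_self (by positivity))).differentiableAt.differentiableWithinAt
  exact ((hf k).differentiableAt (hU.mem_nhds (hsub2 hx))).hasFDerivAt

end SeveralVariables

/-! ### The mean value inequality -/

section MeanValue

variable {n : ℕ}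

theorem measurePreserving_mul_left_of_norm_eq_one {a : ℂ} (ha : ‖a‖ = 1) :
    MeasurePreserving (fun z : ℂ => a * z) := by
  have := (rotation ⟨a, by simpa [Submonoid.unitSphere] using ha⟩).measurePreserving
  exact this

/-- Lebesgue measure is invariant under the rotations of the coordinates. -/
theorem measurePreserving_torus {ζ : Fin n → ℂ} (hζ : ∀ j, ‖ζ j‖ = 1) :
    MeasurePreserving (fun (z : Cn n) j => ζ j * z j) :=
  volume_preserving_pi fun j => measurePreserving_mul_left_of_norm_eq_one (hζ j)

theorem measurableEmbedding_torus {ζ : Fin n → ℂ} (hζ : ∀ j, ‖ζ j‖ = 1) :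
    MeasurableEmbedding (fun (z : Cn n) j => ζ j * z j) := by
  have h0 : ∀ j, ζ j ≠ 0 := fun j h => by simpa [h] using hζ j
  have e : Topology.IsOpenEmbedding (fun (z : Cn n) j => ζ j * z j) := by
    let e : Cn n ≃ₜ Cn n :=
      { toFun := fun z j => ζ j * z j
        invFun := fun z j => (ζ j)⁻¹ * z j
        left_inv := fun z => by ext j; simp [h0 j]
        right_inv := fun z => by ext j; simp [h0 j]
        continuous_toFun := by fun_prop
        continuous_invFun := by fun_prop }
    exact e.isOpenEmbedding
  exact e.measurableEmbedding

theorem measurable_indicator_of_continuousOn {f : Cn n → ℂ} {U : Set (Cn n)} (hU : IsOpen U)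
    (hf : ContinuousOn f U) : Measurable (U.indicator f) := by
  classical
  rw [← piecewise_eq_indicator]
  exact hf.measurable_piecewise (g := 0) continuousOn_const hU.measurableSet

/-- Holomorphic functions satisfy the mean value inequality on polydiscs. -/
theorem enorm_mul_volume_ball_le {f : Cn n → ℂ} {c : Cn n} {r : ℝ}
    (hf : DifferentiableOn ℂ f (Metric.ball c r)) :
    ‖f c‖ₑ * volume (Metric.ball c r) ≤ ∫⁻ z in Metric.ball c r, ‖f z‖ₑ := by
  set F : Cn n → ℂ := (Metric.ball c r).indicator f with hF
  have hFm : Measurable F := measurable_indicator_of_continuousOn Metric.isOpen_ball hf.continuousOn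
  set I : Set ℝ := Ioc 0 (2 * Real.pi) with hI
  have hvol : (volume.restrict I) univ = ENNReal.ofReal (2 * Real.pi) := by simp [hI]
  -- the circle average on each disc through the centre
  have hcirc : ∀ v ∈ Metric.ball (0 : Cn n) r,
      ‖f c‖ₑ * ENNReal.ofReal (2 * Real.pi) ≤
        ∫⁻ θ in I, ‖F (c + Complex.exp (θ * Complex.I) • v)‖ₑ := by
    intro v hv
    have hmem : ∀ t : ℂ, ‖t‖ ≤ 1 → c + t • v ∈ Metric.ball c r := by
      intro t ht
      rw [mem_ball_iff_norm, add_sub_cancel_left, norm_smul]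
      have : ‖v‖ < r := by simpa using hv
      nlinarith [norm_nonneg v, norm_nonneg t]
    have hd : DifferentiableOn ℂ (fun t : ℂ => f (c + t • v)) (Metric.closedBall 0 1) := by
      refine hf.comp (by fun_prop) fun t ht => hmem t (by simpa using ht)
    have hdc : DiffContOnCl ℂ (fun t : ℂ => f (c + t • v)) (Metric.ball 0 |1|) := by
      refine DifferentiableOn.diffContOnCl ?_
      rw [closure_ball _ (by norm_num)]
      simpa using hd
    have := hdc.circleAverage
    simp only [zero_smul, add_zero] at this
    rw [Real.circleAverage_def, intervalIntegral.integral_of_le (by positivity)] at this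
    have h2 : ((2 * Real.pi : ℝ) : ℂ) * f c =
        ∫ θ in I, F (c + Complex.exp (θ * Complex.I) • v) := by
      rw [← this, Complex.real_smul, ← mul_assoc, ← Complex.ofReal_mul,
        mul_inv_cancel₀ (by positivity), Complex.ofReal_one, one_mul]
      refine setIntegral_congr_fun measurableSet_Ioc fun θ _ => ?_
      have : c + Complex.exp (θ * Complex.I) • v ∈ Metric.ball c r :=
        hmem _ (by rw [Complex.norm_exp_ofReal_mul_I])
      simp [hF, circleMap, this]
    calc ‖f c‖ₑ * ENNReal.ofReal (2 * Real.pi) = ‖((2 * Real.pi : ℝ) : ℂ) * f c‖ₑ := by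
          rw [enorm_mul, mul_comm]
          congr 1
          rw [← ofReal_norm, Complex.norm_real, Real.norm_of_nonneg (by positivity)]
      _ ≤ _ := by rw [h2]; exact enorm_integral_le_lintegral_enorm _
  -- A common rotation of all coordinates preserves Lebesgue measure, so averaging over the angle
  -- does not change the integral over the polydisc.
  have hrot : ∀ θ : ℝ, ∫⁻ v in Metric.ball (0 : Cn n) r,
      ‖F (c + Complex.exp (θ * Complex.I) • v)‖ₑ ≤ ∫⁻ z in Metric.ball c r, ‖f z‖ₑ := by
    intro θ
    have h1 : ∫⁻ v : Cn n, ‖F (c + Complex.exp (θ * Complex.I) • v)‖ₑ = ∫⁻ v : Cn n, ‖F v‖ₑ := by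
      have hmp := measurePreserving_torus (n := n) (ζ := fun _ => Complex.exp (θ * Complex.I))
        (fun _ => Complex.norm_exp_ofReal_mul_I θ)
      have := hmp.lintegral_comp (f := fun v => ‖F (c + v)‖ₑ) (by fun_prop)
      rw [lintegral_add_left_eq_self (fun v => ‖F v‖ₑ) c] at this
      exact this
    calc _ ≤ ∫⁻ v : Cn n, ‖F (c + Complex.exp (θ * Complex.I) • v)‖ₑ := setLIntegral_le_lintegral _ _
      _ = ∫⁻ v : Cn n, ‖F v‖ₑ := h1
      _ = _ := by
        rw [← lintegral_indicator Metric.isOpen_ball.measurableSet]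
        simp only [hF, enorm_indicator_eq_indicator_enorm]
  have hpi : ENNReal.ofReal (2 * Real.pi) ≠ 0 := by
    simp [Real.pi_pos]
  have hball : volume (Metric.ball c r) = volume (Metric.ball (0 : Cn n) r) := by
    rw [Measure.addHaar_ball_center]
  have main : ENNReal.ofReal (2 * Real.pi) * (‖f c‖ₑ * volume (Metric.ball c r)) ≤
      ENNReal.ofReal (2 * Real.pi) * ∫⁻ z in Metric.ball c r, ‖f z‖ₑ := by
    calc ENNReal.ofReal (2 * Real.pi) * (‖f c‖ₑ * volume (Metric.ball c r))
        = ∫⁻ v in Metric.ball (0 : Cn n) r, ‖f c‖ₑ * ENNReal.ofReal (2 * Real.pi) := by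
          rw [lintegral_const, hball]; simp only [Measure.restrict_apply_univ]; ring
      _ ≤ ∫⁻ v in Metric.ball (0 : Cn n) r,
            ∫⁻ θ in I, ‖F (c + Complex.exp (θ * Complex.I) • v)‖ₑ :=
          setLIntegral_mono' Metric.isOpen_ball.measurableSet hcirc
      _ = ∫⁻ θ in I, ∫⁻ v in Metric.ball (0 : Cn n) r,
            ‖F (c + Complex.exp (θ * Complex.I) • v)‖ₑ := by
          refine lintegral_lintegral_swap ?_
          refine Measurable.aemeasurable ?_
          have : Continuous (fun p : Cn n × ℝ => c + Complex.exp (p.2 * Complex.I) • p.1) := by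
            fun_prop
          exact (hFm.comp this.measurable).enorm
      _ ≤ ∫⁻ θ in I, ∫⁻ z in Metric.ball c r, ‖f z‖ₑ := lintegral_mono hrot
      _ = _ := by rw [lintegral_const, hvol, mul_comm]
  exact (ENNReal.mul_le_mul_iff_right hpi ENNReal.ofReal_ne_top).1 main

/-- The mean value inequality for the holomorphic function `f ^ 2`. -/
theorem enorm_sq_mul_volume_ball_le {f : Cn n → ℂ} {c : Cn n} {r : ℝ}
    (hf : DifferentiableOn ℂ f (Metric.ball c r)) :
    ‖f c‖ₑ ^ 2 * volume (Metric.ball c r) ≤ ∫⁻ z in Metric.ball c r, ‖f z‖ₑ ^ 2 := by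
  have := enorm_mul_volume_ball_le (hf.pow 2)
  simpa [enorm_pow] using this

end MeanValue

/-! ### The Bergman space of a domain as a Hilbert space -/

section BergmanSpace

open Filter Topology

variable {n : ℕ}

theorem CDomain.isOpen_set (Ω : CDomain n) : IsOpen Ω.set := Ω.carrier.isOpen

theorem CDomain.nonempty_set (Ω : CDomain n) : Ω.set.Nonempty := Ω.connected.nonempty

theorem eLpNorm_two_sq {α : Type*} [MeasurableSpace α] (μ : Measure α) (f : α → ℂ) :
    eLpNorm f 2 μ ^ 2 = ∫⁻ z, ‖f z‖ₑ ^ 2 ∂μ := by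
  rw [eLpNorm_eq_lintegral_rpow_enorm_toReal (by norm_num) (by norm_num)]
  simp only [ENNReal.toReal_ofNat, ENNReal.rpow_ofNat, one_div]
  rw [← ENNReal.rpow_natCast, ← ENNReal.rpow_mul]
  simp

theorem CDomain.memA2_iff {Ω : CDomain n} {f : Cn n → ℂ} :
    Ω.MemA2 f ↔ DifferentiableOn ℂ f Ω.set ∧ ∫⁻ z in Ω.set, ‖f z‖ₑ ^ 2 < (⊤ : ℝ≥0∞) := by
  refine and_congr_right fun h => ?_
  rw [← eLpNorm_two_sq]
  constructor
  · intro hf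
    exact ENNReal.pow_lt_top hf.2
  · intro hf
    refine ⟨h.continuousOn.aestronglyMeasurable Ω.isOpen_set.measurableSet, ?_⟩
    by_contra hc
    rw [not_lt, top_le_iff] at hc
    simp [hc] at hf

theorem CDomain.MemA2.add {Ω : CDomain n} {f g : Cn n → ℂ} (hf : Ω.MemA2 f) (hg : Ω.MemA2 g) :
    Ω.MemA2 (f + g) := ⟨hf.1.add hg.1, hf.2.add hg.2⟩

theorem CDomain.MemA2.sub {Ω : CDomain n} {f g : Cn n → ℂ} (hf : Ω.MemA2 f) (hg : Ω.MemA2 g) :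
    Ω.MemA2 (f - g) := ⟨hf.1.sub hg.1, hf.2.sub hg.2⟩

theorem CDomain.MemA2.const_smul {Ω : CDomain n} {f : Cn n → ℂ} (hf : Ω.MemA2 f) (c : ℂ) :
    Ω.MemA2 (c • f) := ⟨hf.1.const_smul c, hf.2.const_smul c⟩

theorem CDomain.memA2_zero (Ω : CDomain n) : Ω.MemA2 0 :=
  ⟨differentiableOn_const 0, MemLp.zero⟩

theorem CDomain.MemA2.enorm_sq_mul_le {Ω : CDomain n} {f : Cn n → ℂ} (hf : Ω.MemA2 f) {z : Cn n}
    {r : ℝ} (h : Metric.ball z r ⊆ Ω.set) :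
    ‖f z‖ₑ ^ 2 * volume (Metric.ball (0 : Cn n) r) ≤
      eLpNorm f 2 (volume.restrict Ω.set) ^ 2 := by
  rw [eLpNorm_two_sq, ← Measure.addHaar_ball_center volume z]
  exact (enorm_sq_mul_volume_ball_le (hf.1.mono h)).trans (lintegral_mono_set h)

/-- Point evaluations are bounded on the Bergman space, locally uniformly. -/
theorem exists_forall_norm_le_mul_eLpNorm {r : ℝ} (hr : 0 < r) :
    ∃ M : ℝ, 0 < M ∧ ∀ (Ω : CDomain n) (f : Cn n → ℂ) (z : Cn n), Ω.MemA2 f →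
      Metric.ball z r ⊆ Ω.set →
      ‖f z‖ ≤ M * (eLpNorm f 2 (volume.restrict Ω.set)).toReal := by
  set V : ℝ := (volume (Metric.ball (0 : Cn n) r)).toReal with hV
  have hVpos : 0 < V := ENNReal.toReal_pos (Metric.measure_ball_pos volume _ hr).ne'
    measure_ball_lt_top.ne
  refine ⟨(Real.sqrt V)⁻¹, by positivity, fun Ω f z hf hz => ?_⟩
  have h := hf.enorm_sq_mul_le hz
  have h2 := ENNReal.toReal_mono (ENNReal.pow_ne_top hf.2.2.ne) h
  rw [ENNReal.toReal_mul, ENNReal.toReal_pow, ENNReal.toReal_pow, toReal_enorm, ← hV] at h2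
  have h3 := Real.sqrt_le_sqrt h2
  rw [Real.sqrt_mul (by positivity), Real.sqrt_sq (norm_nonneg _),
    Real.sqrt_sq ENNReal.toReal_nonneg] at h3
  rw [inv_mul_eq_div, le_div_iff₀ (Real.sqrt_pos.2 hVpos)]
  exact h3

/-- The Bergman space of a domain as a subspace of `L²`. -/
def CDomain.bergmanSpace (Ω : CDomain n) : Submodule ℂ (Lp ℂ 2 (volume.restrict Ω.set)) where
  carrier := {u | ∃ f, Ω.MemA2 f ∧ u =ᵐ[volume.restrict Ω.set] f}
  add_mem' := by
    rintro u v ⟨f, hf, hu⟩ ⟨g, hg, hv⟩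
    exact ⟨f + g, hf.add hg, (Lp.coeFn_add u v).trans (hu.add hv)⟩
  zero_mem' := ⟨0, Ω.memA2_zero, Lp.coeFn_zero _ _ _⟩
  smul_mem' := by
    rintro c u ⟨f, hf, hu⟩
    exact ⟨c • f, hf.const_smul c, (Lp.coeFn_smul c u).trans (hu.const_smul c)⟩

theorem CDomain.MemA2.eqOn_of_ae {Ω : CDomain n} {f g : Cn n → ℂ} (hf : Ω.MemA2 f)
    (hg : Ω.MemA2 g) (h : f =ᵐ[volume.restrict Ω.set] g) : EqOn f g Ω.set :=
  Measure.eqOn_open_of_ae_eq h Ω.isOpen_set hf.1.continuousOn hg.1.continuousOn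

/-- Bounded point evaluations make an `L²`-convergent sequence of holomorphic functions locally
uniformly Cauchy. Its holomorphic pointwise limit agrees with the `L²` limit because a subsequence
converges almost everywhere. -/
theorem CDomain.isClosed_bergmanSpace (Ω : CDomain n) :
    IsClosed (Ω.bergmanSpace : Set (Lp ℂ 2 (volume.restrict Ω.set))) := by
  refine IsSeqClosed.isClosed fun u v hu huv => ?_
  choose f hf huf using hu
  have hnorm : ∀ k l, (eLpNorm (f k - f l) 2 (volume.restrict Ω.set)).toReal = ‖u k - u l‖ := by
    intro k l
    rw [Lp.norm_def]
    congr 1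
    refine eLpNorm_congr_ae ?_
    exact (((huf k).sub (huf l)).symm).trans (Lp.coeFn_sub _ _).symm
  have hcau : CauchySeq u := huv.cauchySeq
  obtain ⟨g, hg, hlim⟩ := differentiableOn_of_locally_uniformCauchy Ω.isOpen_set
    (fun k => (hf k).1) (fun z hz => by
      obtain ⟨r, hr, hball⟩ := Metric.isOpen_iff.1 Ω.isOpen_set z hz
      obtain ⟨M, hM, hMb⟩ := exists_forall_norm_le_mul_eLpNorm (n := n) (half_pos hr)
      refine ⟨r / 2, half_pos hr, ?_⟩
      rw [Metric.uniformCauchySeqOn_iff]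
      intro ε hε
      obtain ⟨N, hN⟩ := Metric.cauchySeq_iff.1 hcau (ε / M) (by positivity)
      refine ⟨N, fun k hk l hl x hx => ?_⟩
      have hxb : Metric.ball x (r / 2) ⊆ Ω.set := by
        refine Subset.trans (fun y hy => ?_) hball
        rw [Metric.mem_ball] at *
        linarith [dist_triangle y x z]
      have h1 := hMb Ω (f k - f l) x ((hf k).sub (hf l)) hxb
      rw [hnorm] at h1
      have h2 := hN k hk l hl
      rw [dist_eq_norm] at h2 ⊢
      refine (h1.trans_lt (mul_lt_mul_of_pos_left h2 hM)).trans_eq ?_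
      field_simp)
  obtain ⟨ns, hns, hae⟩ := (tendstoInMeasure_of_tendsto_Lp huv).exists_seq_tendsto_ae
  have hvg : v =ᵐ[volume.restrict Ω.set] g := by
    have hall : ∀ᵐ x ∂(volume.restrict Ω.set), ∀ k, u k x = f k x := ae_all_iff.2 huf
    filter_upwards [hae, hall, ae_restrict_mem Ω.isOpen_set.measurableSet] with x hx hx2 hx3
    refine tendsto_nhds_unique hx ?_
    simp only [hx2]
    exact (hlim x hx3).comp hns.tendsto_atTop
  exact ⟨g, ⟨hg, (memLp_congr_ae hvg).1 (Lp.memLp v)⟩, hvg⟩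

instance (Ω : CDomain n) : CompleteSpace Ω.bergmanSpace :=
  Ω.isClosed_bergmanSpace.completeSpace_coe

theorem inner_toLp_eq {Ω : CDomain n} {f g : Cn n → ℂ} {u v : Lp ℂ 2 (volume.restrict Ω.set)}
    (hu : u =ᵐ[volume.restrict Ω.set] f) (hv : v =ᵐ[volume.restrict Ω.set] g) :
    Inner.inner ℂ u v = Ω.inner g f := by
  rw [L2.inner_def, CDomain.inner]
  refine integral_congr_ae ?_
  filter_upwards [hu, hv] with x hx hy
  simp [hx, hy]

/-- The holomorphic representative of an element of the Bergman space. -/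
def CDomain.rep (Ω : CDomain n) (u : Ω.bergmanSpace) : Cn n → ℂ := u.2.choose

theorem CDomain.memA2_rep (Ω : CDomain n) (u : Ω.bergmanSpace) : Ω.MemA2 (Ω.rep u) :=
  u.2.choose_spec.1

theorem CDomain.rep_ae (Ω : CDomain n) (u : Ω.bergmanSpace) :
    (u : Lp ℂ 2 (volume.restrict Ω.set)) =ᵐ[volume.restrict Ω.set] Ω.rep u :=
  u.2.choose_spec.2

/-- A square integrable holomorphic function as an element of the Bergman space. -/
def CDomain.MemA2.toBergmanSpace {Ω : CDomain n} {f : Cn n → ℂ} (hf : Ω.MemA2 f) :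
    Ω.bergmanSpace :=
  ⟨hf.2.toLp f, f, hf, hf.2.coeFn_toLp⟩

theorem CDomain.MemA2.toBergmanSpace_ae {Ω : CDomain n} {f : Cn n → ℂ} (hf : Ω.MemA2 f) :
    (hf.toBergmanSpace : Lp ℂ 2 (volume.restrict Ω.set)) =ᵐ[volume.restrict Ω.set] f :=
  hf.2.coeFn_toLp

theorem CDomain.MemA2.rep_toBergmanSpace {Ω : CDomain n} {f : Cn n → ℂ} (hf : Ω.MemA2 f) :
    EqOn (Ω.rep hf.toBergmanSpace) f Ω.set :=
  (Ω.memA2_rep _).eqOn_of_ae hf ((Ω.rep_ae _).symm.trans hf.toBergmanSpace_ae)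

theorem CDomain.norm_eq_eLpNorm_rep (Ω : CDomain n) (u : Ω.bergmanSpace) :
    ‖u‖ = (eLpNorm (Ω.rep u) 2 (volume.restrict Ω.set)).toReal := by
  rw [Submodule.coe_norm, Lp.norm_def, eLpNorm_congr_ae (Ω.rep_ae u)]

/-- Point evaluations are represented by elements of the Bergman space. -/
theorem CDomain.exists_reproducing (Ω : CDomain n) {z : Cn n} (hz : z ∈ Ω.set) :
    ∃ k : Ω.bergmanSpace, ∀ u : Ω.bergmanSpace, Inner.inner ℂ k u = Ω.rep u z := by
  obtain ⟨r, hr, hball⟩ := Metric.isOpen_iff.1 Ω.isOpen_set z hz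
  obtain ⟨M, hM, hMb⟩ := exists_forall_norm_le_mul_eLpNorm (n := n) hr
  let ev : Ω.bergmanSpace →ₗ[ℂ] ℂ :=
    { toFun := fun u => Ω.rep u z
      map_add' := fun u v => by
        refine (Ω.memA2_rep (u + v)).eqOn_of_ae ((Ω.memA2_rep u).add (Ω.memA2_rep v)) ?_ hz
        refine (Ω.rep_ae _).symm.trans ?_
        exact (Lp.coeFn_add _ _).trans ((Ω.rep_ae u).add (Ω.rep_ae v))
      map_smul' := fun c u => by
        refine (Ω.memA2_rep (c • u)).eqOn_of_ae ((Ω.memA2_rep u).const_smul c) ?_ hz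
        refine (Ω.rep_ae _).symm.trans ?_
        exact (Lp.coeFn_smul _ _).trans ((Ω.rep_ae u).const_smul c) }
  let evc : StrongDual ℂ Ω.bergmanSpace := ev.mkContinuous M fun u => by
    rw [Ω.norm_eq_eLpNorm_rep]
    exact hMb Ω _ z (Ω.memA2_rep u) hball
  refine ⟨(InnerProductSpace.toDual ℂ Ω.bergmanSpace).symm evc, fun u => ?_⟩
  rw [InnerProductSpace.toDual_symm_apply]
  rfl

/-- The Bergman kernel on the diagonal solves the extremal problem for point evaluations. -/
theorem CDomain.IsBergmanKernel.iSup_enorm_sq {Ω : CDomain n} {K : Cn n → Cn n → ℂ}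
    (hK : Ω.IsBergmanKernel K) {z : Cn n} (hz : z ∈ Ω.set) :
    ⨆ (f : Cn n → ℂ) (_ : Ω.MemA2 f) (_ : ∫⁻ w in Ω.set, ‖f w‖ₑ ^ 2 ≤ 1), ‖f z‖ₑ ^ 2 =
      ENNReal.ofReal (K z z).re := by
  obtain ⟨s, φ, ⟨hφ, hone, hzero, hcomp⟩, hsum⟩ := hK
  obtain ⟨k, hk⟩ := Ω.exists_reproducing hz
  let v : s → Ω.bergmanSpace := fun i => (hφ i).toBergmanSpace
  have hv : ∀ i j, Inner.inner ℂ (v i) (v j) = Ω.inner (φ j) (φ i) := fun i j =>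
    inner_toLp_eq (hφ i).toBergmanSpace_ae (hφ j).toBergmanSpace_ae
  have hon : Orthonormal ℂ v := by
    rw [orthonormal_iff_ite]
    intro i j
    rw [hv]
    split_ifs with h
    · rw [h, hone]
    · exact hzero _ _ (Ne.symm h)
  -- Completeness of `φ` in terms of functions becomes triviality of the orthogonal complement, so
  -- `v` is a Hilbert basis.
  have hbot : (Submodule.span ℂ (range v))ᗮ = ⊥ := by
    rw [eq_bot_iff]
    intro u hu
    have h0 : ∀ i, Ω.inner (Ω.rep u) (φ i) = 0 := fun i => by
      rw [← inner_toLp_eq (hφ i).toBergmanSpace_ae (Ω.rep_ae u)]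
      exact (Submodule.mem_orthogonal _ _).1 hu _ (Submodule.subset_span ⟨i, rfl⟩)
    have h1 := hcomp _ (Ω.memA2_rep u) h0
    rw [Submodule.mem_bot, ← norm_eq_zero, Ω.norm_eq_eLpNorm_rep]
    have : Ω.rep u =ᵐ[volume.restrict Ω.set] 0 := by
      filter_upwards [ae_restrict_mem Ω.isOpen_set.measurableSet] with x hx using h1 x hx
    rw [eLpNorm_congr_ae this]
    simp
  let b := HilbertBasis.mkOfOrthogonalEqBot hon hbot
  have hb : ∀ i, b i = v i := fun i => by simp [b]
  have hki : ∀ i, Inner.inner ℂ k (v i) = φ i z := fun i => by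
    rw [hk]; exact (hφ i).rep_toBergmanSpace hz
  -- Parseval's identity for the reproducing element `k`, whose coefficients are the values of the
  -- basis functions at `z`.
  have hKk : K z z = Inner.inner ℂ k k := by
    refine (hsum z hz z hz).unique ?_
    have h := b.hasSum_inner_mul_inner k k
    have h2 : ∀ i, Inner.inner ℂ k (b i) * Inner.inner ℂ (b i) k = φ i z * conj (φ i z) := by
      intro i
      rw [hb, ← hki, inner_conj_symm (v i) k]
    simp only [h2] at h
    exact h
  have hre : (K z z).re = ‖k‖ ^ 2 := by
    rw [hKk]
    exact inner_self_eq_norm_sq (𝕜 := ℂ) k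
  rw [hre]
  apply le_antisymm
  · refine iSup_le fun f => iSup_le fun hf => iSup_le fun h1 => ?_
    have h2 : ‖hf.toBergmanSpace‖ ≤ 1 := by
      rw [Ω.norm_eq_eLpNorm_rep, eLpNorm_congr_ae ((Ω.rep_ae _).symm.trans hf.toBergmanSpace_ae)]
      rw [← eLpNorm_two_sq] at h1
      have : eLpNorm f 2 (volume.restrict Ω.set) ≤ 1 := by
        by_contra hc
        rw [not_le] at hc
        exact absurd h1 (not_le.2 (one_lt_pow₀ hc two_ne_zero))
      exact ENNReal.toReal_mono ENNReal.one_ne_top this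
    have h3 : f z = Inner.inner ℂ k hf.toBergmanSpace := by
      rw [hk]; exact (hf.rep_toBergmanSpace hz).symm
    rw [h3, ← ofReal_norm, ← ENNReal.ofReal_pow (norm_nonneg _)]
    refine ENNReal.ofReal_le_ofReal (pow_le_pow_left₀ (norm_nonneg _) ?_ 2)
    calc _ ≤ ‖k‖ * ‖hf.toBergmanSpace‖ := norm_inner_le_norm _ _
      _ ≤ ‖k‖ := mul_le_of_le_one_right (norm_nonneg _) h2
  · rcases eq_or_ne k 0 with h0 | h0
    · simp [h0]
    have hkpos : 0 < ‖k‖ := norm_pos_iff.2 h0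
    -- The normalised reproducing element attains the supremum.
    set u : Ω.bergmanSpace := ((‖k‖⁻¹ : ℝ) : ℂ) • k with hu
    have hun : ‖u‖ = 1 := by
      rw [hu, norm_smul, Complex.norm_real, norm_inv, norm_norm, inv_mul_cancel₀ hkpos.ne']
    have h1 : ∫⁻ w in Ω.set, ‖Ω.rep u w‖ₑ ^ 2 ≤ 1 := by
      rw [← eLpNorm_two_sq]
      have h2 := Ω.norm_eq_eLpNorm_rep u
      rw [hun] at h2
      rw [← ENNReal.ofReal_toReal (Ω.memA2_rep u).2.2.ne, ← h2]
      simp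
    refine le_iSup_of_le (Ω.rep u) (le_iSup_of_le (Ω.memA2_rep u) (le_iSup_of_le h1 ?_))
    have h3 : Inner.inner ℂ k u = ((‖k‖ : ℝ) : ℂ) := by
      have h4 : Inner.inner ℂ k k = ((‖k‖ : ℝ) : ℂ) ^ 2 := inner_self_eq_norm_sq_to_K (𝕜 := ℂ) k
      have h5 : Inner.inner ℂ k u = ((‖k‖⁻¹ : ℝ) : ℂ) * Inner.inner ℂ k k :=
        inner_smul_right (𝕜 := ℂ) k k _
      rw [h5, h4, ← Complex.ofReal_pow, ← Complex.ofReal_mul]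
      congr 1
      field_simp
    rw [← hk, h3, ← ofReal_norm, Complex.norm_real, norm_norm, ENNReal.ofReal_pow (norm_nonneg _)]

end BergmanSpace

/-! ### Pullback of forms under biholomorphic maps -/

section Pullback

open Filter Topology OpenPartialHomeomorph

variable {n : ℕ} {M M' M'' : Type} [TopologicalSpace M] [ChartedSpace (Cn n) M]
  [TopologicalSpace M'] [ChartedSpace (Cn n) M'] [TopologicalSpace M''] [ChartedSpace (Cn n) M'']

/-- Alternating forms of top degree are multiples of the determinant. -/
theorem alternating_apply_map_single (g : (Cn n) [⋀^Fin n]→L[ℂ] ℂ) (v : Fin n → Cn n) :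
    g v = (Pi.basisFun ℂ (Fin n)).det v * g fun i => (Pi.single i (1 : ℂ) : Cn n) := by
  have h := g.toAlternatingMap.eq_smul_basis_det (Pi.basisFun ℂ (Fin n))
  have h2 := congrArg (fun a => a v) h
  simp only [AlternatingMap.smul_apply, smul_eq_mul] at h2
  rw [mul_comm]
  have h3 : (fun i => (Pi.single i (1 : ℂ) : Cn n)) = Pi.basisFun ℂ (Fin n) :=
    funext fun i => (Pi.basisFun_apply ℂ (Fin n) i).symm
  rw [h3]
  exact h2

theorem alternating_apply_comp_single (g : (Cn n) [⋀^Fin n]→L[ℂ] ℂ) (A : Cn n →L[ℂ] Cn n) :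
    (g fun i => A (Pi.single i (1 : ℂ))) = A.det * g fun i => (Pi.single i (1 : ℂ) : Cn n) := by
  rw [alternating_apply_map_single]
  congr 1
  have := (Pi.basisFun ℂ (Fin n)).det_comp (A : Cn n →ₗ[ℂ] Cn n) (Pi.basisFun ℂ (Fin n))
  rw [Module.Basis.det_self, mul_one] at this
  rw [ContinuousLinearMap.det, ← this]
  congr 1
  ext i
  simp

/-- An open partial homeomorphism between complex manifolds which is holomorphic together with its
inverse. -/
structure IsBiholomorphic (Φ : OpenPartialHomeomorph M M') : Prop where
  contMDiffOn : ContMDiffOn 𝓘(ℂ, Cn n) 𝓘(ℂ, Cn n) ω Φ Φ.source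
  contMDiffOn_symm : ContMDiffOn 𝓘(ℂ, Cn n) 𝓘(ℂ, Cn n) ω Φ.symm Φ.target

theorem IsBiholomorphic.symm {Φ : OpenPartialHomeomorph M M'} (h : IsBiholomorphic (n := n) Φ) :
    IsBiholomorphic (n := n) Φ.symm := ⟨h.2, h.1⟩

theorem IsBiholomorphic.trans {Φ : OpenPartialHomeomorph M M'} {Ψ : OpenPartialHomeomorph M' M''}
    (hΦ : IsBiholomorphic (n := n) Φ) (hΨ : IsBiholomorphic (n := n) Ψ) :
    IsBiholomorphic (n := n) (Φ.trans Ψ) := by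
  constructor
  · rw [coe_trans, trans_source]
    exact hΨ.1.comp (hΦ.1.mono inter_subset_left) fun x hx => hx.2
  · rw [coe_trans_symm, trans_target]
    exact hΦ.2.comp (hΨ.2.mono inter_subset_left) fun x hx => hx.2

theorem IsBiholomorphic.of_mem_atlas [IsManifold 𝓘(ℂ, Cn n) ω M]
    {e : OpenPartialHomeomorph M (Cn n)} (he : e ∈ atlas (Cn n) M) :
    IsBiholomorphic (n := n) e := by
  have := IsManifold.subset_maximalAtlas (I := 𝓘(ℂ, Cn n)) (n := ω) he
  exact ⟨contMDiffOn_of_mem_maximalAtlas this, contMDiffOn_symm_of_mem_maximalAtlas this⟩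

theorem IsBiholomorphic.mdifferentiableAt {Φ : OpenPartialHomeomorph M M'}
    (h : IsBiholomorphic (n := n) Φ) {x : M} (hx : x ∈ Φ.source) :
    MDifferentiableAt 𝓘(ℂ, Cn n) 𝓘(ℂ, Cn n) Φ x :=
  (h.1.contMDiffAt (Φ.open_source.mem_nhds hx)).mdifferentiableAt (by simp)

theorem IsBiholomorphic.mdifferentiableAt_symm {Φ : OpenPartialHomeomorph M M'}
    (h : IsBiholomorphic (n := n) Φ) {x : M'} (hx : x ∈ Φ.target) :
    MDifferentiableAt 𝓘(ℂ, Cn n) 𝓘(ℂ, Cn n) Φ.symm x :=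
  h.symm.mdifferentiableAt hx

theorem IsBiholomorphic.mfderiv_symm_comp {Φ : OpenPartialHomeomorph M M'}
    (h : IsBiholomorphic (n := n) Φ) {x : M} (hx : x ∈ Φ.source) (v : Cn n) :
    (mfderiv 𝓘(ℂ, Cn n) 𝓘(ℂ, Cn n) Φ.symm (Φ x) : Cn n →L[ℂ] Cn n)
      ((mfderiv 𝓘(ℂ, Cn n) 𝓘(ℂ, Cn n) Φ x : Cn n →L[ℂ] Cn n) v) = v := by
  have hd : Φ.MDifferentiable 𝓘(ℂ, Cn n) 𝓘(ℂ, Cn n) :=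
    ⟨fun y hy => (h.mdifferentiableAt hy).mdifferentiableWithinAt,
      fun y hy => (h.mdifferentiableAt_symm hy).mdifferentiableWithinAt⟩
  exact DFunLike.congr_fun (hd.symm_comp_deriv hx) v

/-- The pullback of a form. -/
def TopForm.pullback (Φ : M → M') (f : TopForm n M') : TopForm n M := fun x =>
  (f (Φ x)).compContinuousLinearMap (mfderiv 𝓘(ℂ, Cn n) 𝓘(ℂ, Cn n) Φ x)

/-- The expression of a map in two charts. -/
abbrev inCharts (e : OpenPartialHomeomorph M (Cn n)) (Φ : OpenPartialHomeomorph M M')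
    (e' : OpenPartialHomeomorph M' (Cn n)) : OpenPartialHomeomorph (Cn n) (Cn n) :=
  (e.symm.trans Φ).trans e'

theorem IsBiholomorphic.contDiffOn {φ : OpenPartialHomeomorph (Cn n) (Cn n)}
    (h : IsBiholomorphic (n := n) φ) : ContDiffOn ℂ ω φ φ.source :=
  contMDiffOn_iff_contDiffOn.1 h.1

theorem TopForm.pullback_symm_pullback {Φ : OpenPartialHomeomorph M M'}
    (h : IsBiholomorphic (n := n) Φ) (f : TopForm n M') {y : M'} (hy : y ∈ Φ.target) :
    (f.pullback Φ).pullback Φ.symm y = f y := by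
  -- All tangent spaces unfold to the model space. As a non-dependent function, `f` allows the base
  -- point to be rewritten; the same device recurs below.
  let f₀ : M' → (Cn n) [⋀^Fin n]→L[ℂ] ℂ := f
  have hpt : f₀ (Φ (Φ.symm y)) = f₀ y := congrArg f₀ (Φ.right_inv hy)
  refine ContinuousAlternatingMap.ext fun v => ?_
  change (f₀ (Φ (Φ.symm y)) fun i => _) = f₀ y v
  rw [hpt]
  congr 1
  funext i
  exact h.symm.mfderiv_symm_comp hy (v i)

theorem TopForm.coeff_congr {f g : TopForm n M} {e : OpenPartialHomeomorph M (Cn n)} {z : Cn n}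
    (h : f (e.symm z) = g (e.symm z)) : f.coeff e z = g.coeff e z := by
  simp only [TopForm.coeff, h]

theorem TopForm.HolomorphicOn.mono {f : TopForm n M} {U V : Set M} (hf : f.HolomorphicOn V)
    (h : U ⊆ V) : f.HolomorphicOn U := fun e he =>
  (hf e he).mono (inter_subset_inter_right _ (preimage_mono h))

variable [IsManifold 𝓘(ℂ, Cn n) ω M] [IsManifold 𝓘(ℂ, Cn n) ω M']

theorem IsBiholomorphic.inCharts {Φ : OpenPartialHomeomorph M M'} (h : IsBiholomorphic (n := n) Φ)
    {e : OpenPartialHomeomorph M (Cn n)} (he : e ∈ atlas (Cn n) M)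
    {e' : OpenPartialHomeomorph M' (Cn n)} (he' : e' ∈ atlas (Cn n) M') :
    IsBiholomorphic (n := n) (Bergman.inCharts e Φ e') :=
  ((IsBiholomorphic.of_mem_atlas he).symm.trans h).trans (.of_mem_atlas he')

/-- Near `z` the maps `Φ ∘ e⁻¹` and `e'⁻¹ ∘ φ` agree, where `φ` expresses `Φ` in the charts. By the
chain rule the coordinate frame of `e` is carried to that of `e'` composed with the derivative of
`φ`, and a top form picks up its determinant. -/
theorem TopForm.coeff_pullback {Φ : OpenPartialHomeomorph M M'} (h : IsBiholomorphic (n := n) Φ)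
    (f : TopForm n M')
    {e : OpenPartialHomeomorph M (Cn n)} (he : e ∈ atlas (Cn n) M)
    {e' : OpenPartialHomeomorph M' (Cn n)} (he' : e' ∈ atlas (Cn n) M') {z : Cn n}
    (hz : z ∈ (inCharts e Φ e').source) :
    (f.pullback Φ).coeff e z =
      (fderiv ℂ (inCharts e Φ e') z).det * f.coeff e' (inCharts e Φ e' z) := by
  set φ := inCharts e Φ e' with hφ
  have hφb : IsBiholomorphic (n := n) φ := h.inCharts he he'
  have hz' := hz
  rw [hφ, inCharts, trans_source, trans_source] at hz'
  obtain ⟨⟨hz1, hz2⟩, hz3⟩ := hz'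
  have hz2' : e.symm z ∈ Φ.source := hz2
  have hz3' : Φ (e.symm z) ∈ e'.source := hz3
  have d1 := ((IsBiholomorphic.of_mem_atlas he).mdifferentiableAt_symm hz1).hasMFDerivAt
  have d2 := (h.mdifferentiableAt hz2').hasMFDerivAt
  have hφz : φ z ∈ e'.target := e'.map_source hz3'
  have d3 := ((IsBiholomorphic.of_mem_atlas he').mdifferentiableAt_symm hφz).hasMFDerivAt
  have d4 := ((hφb.contDiffOn.differentiableOn (by simp)).differentiableAt
    (φ.open_source.mem_nhds hz)).hasFDerivAt.hasMFDerivAt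
  have c1 := d2.comp z d1
  have c2 := d3.comp z d4
  have hev : (e'.symm ∘ φ) =ᶠ[𝓝 z] (Φ ∘ e.symm) := by
    filter_upwards [φ.open_source.mem_nhds hz] with w hw
    rw [hφ, inCharts, trans_source, trans_source] at hw
    have : Φ (e.symm w) ∈ e'.source := hw.2
    simp [hφ, inCharts, e'.left_inv this]
  have huniq := hasMFDerivAt_unique c1 (c2.congr_of_eventuallyEq hev.symm)
  let f₀ : M' → (Cn n) [⋀^Fin n]→L[ℂ] ℂ := f
  have hpt : f₀ (Φ (e.symm z)) = f₀ (e'.symm (φ z)) := congrArg f₀ hev.self_of_nhds.symm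
  let D : Cn n →L[ℂ] Cn n := mfderiv 𝓘(ℂ, Cn n) 𝓘(ℂ, Cn n) e'.symm (φ z)
  have key := alternating_apply_comp_single ((f₀ (e'.symm (φ z))).compContinuousLinearMap D)
    (fderiv ℂ φ z)
  have hL : (f.pullback Φ).coeff e z = f₀ (Φ (e.symm z)) fun i =>
      D (fderiv ℂ φ z (Pi.single i (1 : ℂ))) := by
    change (f₀ (Φ (e.symm z)) fun i => _) = _
    congr 1
    funext i
    exact DFunLike.congr_fun huniq (Pi.single i (1 : ℂ))
  rw [hL, hpt]
  exact key

theorem differentiableOn_finset_prod {E ι : Type*} [NormedAddCommGroup E] [NormedSpace ℂ E]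
    {s : Finset ι} {U : Set E} {f : ι → E → ℂ} (h : ∀ i ∈ s, DifferentiableOn ℂ (f i) U) :
    DifferentiableOn ℂ (fun z => ∏ i ∈ s, f i z) U := by
  classical
  induction s using Finset.induction_on with
  | empty => simp
  | insert a s ha ih =>
    simp only [Finset.prod_insert ha]
    exact (h a (Finset.mem_insert_self a s)).mul
      (ih fun i hi => h i (Finset.mem_insert_of_mem hi))

theorem differentiableOn_det_fderiv {φ : Cn n → Cn n} {U : Set (Cn n)} (hU : IsOpen U)
    (h : ContDiffOn ℂ ω φ U) : DifferentiableOn ℂ (fun z => (fderiv ℂ φ z).det) U := by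
  have h1 : DifferentiableOn ℂ (fderiv ℂ φ) U :=
    (h.fderiv_of_isOpen hU (m := 1) (by simp)).differentiableOn (by simp)
  have h2 : ∀ A : Cn n →L[ℂ] Cn n, A.det =
      Matrix.det (Matrix.of fun i j => A (Pi.single j (1 : ℂ)) i) := by
    intro A
    rw [ContinuousLinearMap.det, ← LinearMap.det_toMatrix (Pi.basisFun ℂ (Fin n))]
    congr 1
  simp only [h2, Matrix.det_apply, Matrix.of_apply]
  refine DifferentiableOn.fun_sum fun σ _ => ?_
  refine DifferentiableOn.const_smul ?_ _
  refine differentiableOn_finset_prod fun i _ => ?_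
  have h3 : DifferentiableOn ℂ (fun z => fderiv ℂ φ z (Pi.single i (1 : ℂ))) U :=
    h1.clm_apply (differentiableOn_const _)
  exact fun z hz => differentiableWithinAt_pi.1 (h3 z hz) (σ i)

theorem TopForm.HolomorphicOn.pullback {Φ : OpenPartialHomeomorph M M'}
    (h : IsBiholomorphic (n := n) Φ) {f : TopForm n M'} (hf : f.HolomorphicOn Φ.target) :
    (f.pullback Φ).HolomorphicOn Φ.source := by
  intro e he z hz
  have hz2 : e.symm z ∈ Φ.source := hz.2
  let e' := chartAt (Cn n) (Φ (e.symm z))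
  have he' : e' ∈ atlas (Cn n) M' := chart_mem_atlas _ _
  set φ := inCharts e Φ e' with hφ
  have hzφ : z ∈ φ.source := by
    rw [hφ, inCharts, trans_source, trans_source]
    exact ⟨⟨hz.1, hz2⟩, mem_chart_source _ _⟩
  have hd := differentiableOn_det_fderiv φ.open_source (h.inCharts he he').contDiffOn
  have hmaps : MapsTo φ φ.source (e'.target ∩ e'.symm ⁻¹' Φ.target) := by
    intro w hw
    rw [hφ, inCharts, trans_source, trans_source] at hw
    have h3 : Φ (e.symm w) ∈ e'.source := hw.2
    refine ⟨e'.map_source h3, ?_⟩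
    have : e'.symm (φ w) = Φ (e.symm w) := e'.left_inv h3
    rw [mem_preimage, this]
    exact Φ.map_source hw.1.2
  have hcomp : DifferentiableOn ℂ (fun w => (fderiv ℂ φ w).det * f.coeff e' (φ w)) φ.source :=
    hd.mul ((hf e' he').comp ((h.inCharts he he').contDiffOn.differentiableOn (by simp)) hmaps)
  have := (hcomp.congr fun w hw => f.coeff_pullback h he he' hw).differentiableAt
    (φ.open_source.mem_nhds hzφ)
  exact this.differentiableWithinAt

end Pullback

/-! ### Biholomorphic invariance of the norm -/

section NormInvariance

open Filter Topology OpenPartialHomeomorph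

theorem measurableSet_inter_preimage_of_continuousOn {X Y : Type*} [TopologicalSpace X]
    [MeasurableSpace X] [BorelSpace X] [TopologicalSpace Y] [MeasurableSpace Y] [BorelSpace Y]
    {f : X → Y} {s : Set X} {t : Set Y} (hs : MeasurableSet s) (hf : ContinuousOn f s)
    (ht : MeasurableSet t) : MeasurableSet (s ∩ f ⁻¹' t) := by
  have h1 : MeasurableSet (s.domRestrict f ⁻¹' t) :=
    (continuousOn_iff_continuous_domRestrict.1 hf).measurable ht
  have h2 := hs.subtype_image h1
  convert h2 using 1
  ext x
  simp [and_comm]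

variable {n : ℕ} {M M' : Type} [TopologicalSpace M] [ChartedSpace (Cn n) M]
  [TopologicalSpace M'] [ChartedSpace (Cn n) M']

theorem measurableSet_image_openPartialHomeomorph {X Y : Type*} [TopologicalSpace X]
    [MeasurableSpace X] [BorelSpace X] [TopologicalSpace Y] [MeasurableSpace Y] [BorelSpace Y]
    (e : OpenPartialHomeomorph X Y) {B : Set X} (hB : MeasurableSet B) (h : B ⊆ e.source) :
    MeasurableSet (e '' B) := by
  rw [e.image_eq_target_inter_inv_preimage h]
  exact measurableSet_inter_preimage_of_continuousOn e.open_target.measurableSet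
    e.continuousOn_symm hB

theorem abs_det_restrictScalars (A : Cn n →L[ℂ] Cn n) :
    ENNReal.ofReal |(A.restrictScalars ℝ).det| = ‖A.det‖ₑ ^ 2 := by
  have h : (A.restrictScalars ℝ).det = Algebra.norm ℝ A.det := by
    rw [ContinuousLinearMap.det, ContinuousLinearMap.det]
    exact LinearMap.det_restrictScalars (f := (A : Cn n →ₗ[ℂ] Cn n))
  rw [h, Algebra.norm_complex_apply, abs_of_nonneg (Complex.normSq_nonneg _),
    Complex.normSq_eq_norm_sq, ENNReal.ofReal_pow (norm_nonneg _), ofReal_norm]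

/-- The squared norm of the form `f` over a Borel set `B` in the domain of the chart `e`. -/
def TopForm.chartNormSq (f : TopForm n M) (e : OpenPartialHomeomorph M (Cn n)) (B : Set M) :
    ℝ≥0∞ :=
  ∫⁻ z in e '' B, 2 ^ n * ‖f.coeff e z‖ₑ ^ 2

theorem TopForm.sum_chartNormSq_le {ι : Type*} [Fintype ι] (f : TopForm n M) {U : Set M}
    (e : ι → OpenPartialHomeomorph M (Cn n)) (B : ι → Set M)
    (h : ∀ i, e i ∈ atlas (Cn n) M ∧ MeasurableSet[borel M] (B i) ∧ B i ⊆ (e i).source ∩ U)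
    (hd : Pairwise fun i j => Disjoint (B i) (B j)) :
    ∑ i, f.chartNormSq (e i) (B i) ≤ f.normSqOn U := by
  let σ := (Fintype.equivFin ι).symm
  rw [← σ.sum_comp]
  refine le_iSup_of_le (Fintype.card ι) (le_iSup_of_le (e ∘ σ) (le_iSup_of_le (B ∘ σ)
    (le_iSup_of_le (fun i => h (σ i)) (le_iSup_of_le (fun i j hij => ?_) le_rfl))))
  exact hd (σ.injective.ne hij)

theorem TopForm.normSqOn_mono (f : TopForm n M) {U V : Set M} (h : U ⊆ V) :
    f.normSqOn U ≤ f.normSqOn V := by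
  refine iSup_le fun k => iSup_le fun e => iSup_le fun B => iSup_le fun hB => iSup_le fun hd => ?_
  exact f.sum_chartNormSq_le e B
    (fun i => ⟨(hB i).1, (hB i).2.1, (hB i).2.2.trans (inter_subset_inter_right _ h)⟩) hd

theorem TopForm.chartNormSq_congr {f g : TopForm n M} {e : OpenPartialHomeomorph M (Cn n)}
    {B : Set M} (hB : MeasurableSet[borel M] B) (hs : B ⊆ e.source) (h : ∀ x ∈ B, f x = g x) :
    f.chartNormSq e B = g.chartNormSq e B := by
  let _ : MeasurableSpace M := borel M
  have _ : BorelSpace M := ⟨rfl⟩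
  refine setLIntegral_congr_fun (measurableSet_image_openPartialHomeomorph e hB hs) ?_
  rintro _ ⟨x, hx, rfl⟩
  have : e.symm (e x) = x := e.left_inv (hs hx)
  simp only
  rw [TopForm.coeff_congr (f := f) (g := g) (h _ (by rwa [this]))]

theorem TopForm.normSqOn_congr {f g : TopForm n M} {U : Set M} (h : ∀ x ∈ U, f x = g x) :
    f.normSqOn U = g.normSqOn U := by
  refine iSup_congr fun k => iSup_congr fun e => iSup_congr fun B => iSup_congr fun hB =>
    iSup_congr fun hd => Finset.sum_congr rfl fun i _ => ?_
  exact TopForm.chartNormSq_congr (hB i).2.1 ((hB i).2.2.trans inter_subset_left)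
    fun x hx => h x ((hB i).2.2 hx).2

variable [IsManifold 𝓘(ℂ, Cn n) ω M] [IsManifold 𝓘(ℂ, Cn n) ω M']

/-- The real Jacobian in the change of variables is the squared modulus of the complex determinant,
which is exactly the factor gained by the squared coefficient under pullback. -/
theorem TopForm.chartNormSq_pullback {Φ : OpenPartialHomeomorph M M'}
    (h : IsBiholomorphic (n := n) Φ) (f : TopForm n M')
    {e : OpenPartialHomeomorph M (Cn n)} (he : e ∈ atlas (Cn n) M)
    {e' : OpenPartialHomeomorph M' (Cn n)} (he' : e' ∈ atlas (Cn n) M') {B : Set M}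
    (hB : MeasurableSet[borel M] B) (hBe : B ⊆ e.source) (hBΦ : B ⊆ Φ.source)
    (hBe' : MapsTo Φ B e'.source) :
    (f.pullback Φ).chartNormSq e B = f.chartNormSq e' (Φ '' B) := by
  let _ : MeasurableSpace M := borel M
  have _ : BorelSpace M := ⟨rfl⟩
  set φ := Bergman.inCharts e Φ e' with hφ
  have hφb := h.inCharts he he'
  have hsub : e '' B ⊆ φ.source := by
    rintro _ ⟨x, hx, rfl⟩
    rw [hφ, Bergman.inCharts, trans_source, trans_source]
    have : e.symm (e x) = x := e.left_inv (hBe hx)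
    refine ⟨⟨e.map_source (hBe hx), ?_⟩, ?_⟩
    · rw [mem_preimage, this]; exact hBΦ hx
    · simp only [coe_trans, mem_preimage, Function.comp_apply, this]
      exact hBe' hx
  have hm : MeasurableSet (e '' B) := measurableSet_image_openPartialHomeomorph e hB hBe
  have himg : e' '' (Φ '' B) = φ '' (e '' B) := by
    rw [image_image, image_image]
    refine image_congr fun x hx => ?_
    simp [hφ, Bergman.inCharts, e.left_inv (hBe hx)]
  rw [TopForm.chartNormSq, TopForm.chartNormSq, himg,
    lintegral_image_eq_lintegral_abs_det_fderiv_mul volume hm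
      (f' := fun z => (fderiv ℂ φ z).restrictScalars ℝ) (fun z hz => ?_) (φ.injOn.mono hsub)]
  · refine setLIntegral_congr_fun hm fun z hz => ?_
    rw [f.coeff_pullback h he he' (hsub hz), abs_det_restrictScalars, enorm_mul, mul_pow]
    ring
  · exact (((hφb.contDiffOn.differentiableOn (by simp)).differentiableAt
      (φ.open_source.mem_nhds (hsub hz))).hasFDerivAt.restrictScalars ℝ).hasFDerivWithinAt

theorem exists_seq_chartAt_source_cover (n : ℕ) (M' : Type) [TopologicalSpace M']
    [ChartedSpace (Cn n) M'] [SecondCountableTopology M'] [Nonempty M'] :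
    ∃ c : ℕ → M', ⋃ j, (chartAt (Cn n) (c j)).source = univ := by
  obtain ⟨s, hs, hcov⟩ := TopologicalSpace.countable_cover_nhds
    (f := fun x : M' => (chartAt (Cn n) x).source) (fun x => chart_source_mem_nhds _ x)
  have hne : s.Nonempty := by
    by_contra h
    rw [not_nonempty_iff_eq_empty] at h
    rw [h, biUnion_empty] at hcov
    exact empty_ne_univ hcov
  obtain ⟨c, hc⟩ := hs.exists_eq_range hne
  refine ⟨c, ?_⟩
  rw [hc, biUnion_range] at hcov
  exact hcov

/-- The image of a piece need not lie in one chart of `M'`. Each piece is therefore cut along a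
countable disjoint Borel partition of `M'` subordinate to charts, and every finite partial sum of
the resulting series is admissible on the other side. -/
theorem TopForm.normSqOn_pullback_le [SecondCountableTopology M'] [Nonempty M']
    {Φ : OpenPartialHomeomorph M M'} (h : IsBiholomorphic (n := n) Φ) (f : TopForm n M') :
    (f.pullback Φ).normSqOn Φ.source ≤ f.normSqOn Φ.target := by
  let _ : MeasurableSpace M := borel M
  have _ : BorelSpace M := ⟨rfl⟩
  let _ : MeasurableSpace M' := borel M'
  have _ : BorelSpace M' := ⟨rfl⟩
  obtain ⟨c, hc⟩ := exists_seq_chartAt_source_cover n M'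
  let V : ℕ → Set M' := disjointed fun j => (chartAt (Cn n) (c j)).source
  have hVm : ∀ j, MeasurableSet (V j) :=
    fun j => MeasurableSet.disjointed (fun j => (chartAt (Cn n) (c j)).open_source.measurableSet) j
  have hVd : Pairwise fun i j => Disjoint (V i) (V j) := disjoint_disjointed _
  have hVs : ∀ j, V j ⊆ (chartAt (Cn n) (c j)).source := fun j => disjointed_subset _ j
  have hVu : ⋃ j, V j = univ := (iUnion_disjointed).trans hc
  refine iSup_le fun k => iSup_le fun e => iSup_le fun B => iSup_le fun hB => iSup_le fun hd => ?_
  have hBs : ∀ i, B i ⊆ (e i).source := fun i => (hB i).2.2.trans inter_subset_left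
  have hBΦ : ∀ i, B i ⊆ Φ.source := fun i => (hB i).2.2.trans inter_subset_right
  let C : Fin k → ℕ → Set M := fun i j => B i ∩ Φ ⁻¹' V j
  have hCm : ∀ i j, MeasurableSet (C i j) := fun i j =>
    measurableSet_inter_preimage_of_continuousOn (hB i).2.1 (Φ.continuousOn.mono (hBΦ i)) (hVm j)
  have hCd : ∀ i, Pairwise fun j l => Disjoint (C i j) (C i l) := fun i j l hjl =>
    ((hVd hjl).preimage Φ).mono inter_subset_right inter_subset_right
  have hsplit : ∀ i, (f.pullback Φ).chartNormSq (e i) (B i) =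
      ∑' j, (f.pullback Φ).chartNormSq (e i) (C i j) := by
    intro i
    have hBC : B i = ⋃ j, C i j := by
      rw [← inter_iUnion, ← preimage_iUnion, hVu, preimage_univ, inter_univ]
    have him : (e i) '' (B i) = ⋃ j, (e i) '' (C i j) := by rw [← image_iUnion, ← hBC]
    rw [TopForm.chartNormSq, him, lintegral_iUnion]
    · rfl
    · exact fun j => measurableSet_image_openPartialHomeomorph _ (hCm i j)
        (inter_subset_left.trans (hBs i))
    · intro j l hjl
      rw [Function.onFun, Set.disjoint_left]
      rintro _ ⟨x, hx, rfl⟩ ⟨y, hy, hxy⟩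
      have hyx : y = x := (e i).injOn (hBs i hy.1) (hBs i hx.1) hxy
      subst hyx
      exact Set.disjoint_left.1 (hCd i hjl) hx hy
  calc ∑ i, (f.pullback Φ).chartNormSq (e i) (B i)
      = ∑ i, ∑' j, (f.pullback Φ).chartNormSq (e i) (C i j) :=
        Finset.sum_congr rfl fun i _ => hsplit i
    _ = ∑' j, ∑ i, (f.pullback Φ).chartNormSq (e i) (C i j) :=
        (Summable.tsum_finsetSum fun i _ => ENNReal.summable).symm
    _ ≤ f.normSqOn Φ.target := by
      refine ENNReal.tsum_le_of_sum_range_le fun N => ?_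
      rw [Finset.sum_range, ← Fintype.sum_prod_type' (f := fun (j : Fin N) (i : Fin k) =>
        (f.pullback Φ).chartNormSq (e i) (C i j))]
      have heq : ∀ p : Fin N × Fin k, (f.pullback Φ).chartNormSq (e p.2) (C p.2 p.1) =
          f.chartNormSq (chartAt (Cn n) (c p.1)) (Φ '' C p.2 p.1) := fun p =>
        TopForm.chartNormSq_pullback h f (hB p.2).1 (chart_mem_atlas _ _) (hCm _ _)
          (inter_subset_left.trans (hBs _)) (inter_subset_left.trans (hBΦ _))
          (fun x hx => hVs _ hx.2)
      simp only [heq]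
      refine f.sum_chartNormSq_le (ι := Fin N × Fin k) _ _ (fun p => ⟨chart_mem_atlas _ _, ?_, ?_⟩)
        fun p q hpq => ?_
      · exact measurableSet_image_openPartialHomeomorph Φ (hCm _ _)
          (inter_subset_left.trans (hBΦ _))
      · rintro _ ⟨x, hx, rfl⟩
        exact ⟨hVs _ hx.2, Φ.map_source (hBΦ _ hx.1)⟩
      · refine Set.disjoint_left.2 ?_
        rintro _ ⟨x, hx, rfl⟩ ⟨y, hy, hxy⟩
        have hyx : y = x := Φ.injOn (hBΦ _ hy.1) (hBΦ _ hx.1) hxy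
        subst hyx
        by_cases h1 : p.1 = q.1
        · have h2 : p.2 ≠ q.2 := fun h2 => hpq (Prod.ext h1 h2)
          exact Set.disjoint_left.1 (hd h2) hx.1 hy.1
        · have h3 : (p.1 : ℕ) ≠ q.1 := fun h => h1 (Fin.ext h)
          exact Set.disjoint_left.1 (hVd h3) hx.2 hy.2

theorem TopForm.normSqOn_pullback [SecondCountableTopology M] [SecondCountableTopology M']
    [Nonempty M] [Nonempty M']
    {Φ : OpenPartialHomeomorph M M'} (h : IsBiholomorphic (n := n) Φ) (f : TopForm n M') :
    (f.pullback Φ).normSqOn Φ.source = f.normSqOn Φ.target := by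
  refine le_antisymm (f.normSqOn_pullback_le h) ?_
  have h1 := (f.pullback Φ).normSqOn_pullback_le h.symm
  rw [OpenPartialHomeomorph.symm_source, OpenPartialHomeomorph.symm_target] at h1
  rwa [TopForm.normSqOn_congr (f := (f.pullback Φ).pullback Φ.symm) (g := f) fun y hy =>
    f.pullback_symm_pullback h hy] at h1

end NormInvariance

/-! ### Negligible sets and the invariance of the Bergman kernel form -/

section Correspondence

open Filter Topology OpenPartialHomeomorph

variable {n : ℕ} {M M' : Type} [TopologicalSpace M] [ChartedSpace (Cn n) M]
  [TopologicalSpace M'] [ChartedSpace (Cn n) M']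

/-- A family of pieces in `U` can be enlarged by the disjoint piece `B`. The statement serves to
detect mass on the interior of a negligible set. -/
theorem TopForm.normSqOn_add_chartNormSq_le (f : TopForm n M) {e : OpenPartialHomeomorph M (Cn n)}
    (he : e ∈ atlas (Cn n) M) {U B : Set M} (hB : MeasurableSet[borel M] B) (hBe : B ⊆ e.source)
    (hBU : Disjoint U B) : f.normSqOn U + f.chartNormSq e B ≤ f.normSqOn univ := by
  by_cases htop : f.normSqOn univ = (⊤ : ℝ≥0∞)
  · rw [htop]; exact le_top
  have hle : f.chartNormSq e B ≤ f.normSqOn univ := by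
    have := f.sum_chartNormSq_le (ι := Unit) (U := univ) (fun _ => e) (fun _ => B)
      (fun _ => ⟨he, hB, fun x hx => ⟨hBe hx, trivial⟩⟩) (fun i j hij => absurd rfl hij)
    simpa using this
  have key : f.normSqOn U ≤ f.normSqOn univ - f.chartNormSq e B := by
    refine iSup_le fun k => iSup_le fun e' => iSup_le fun B' => iSup_le fun hB' =>
      iSup_le fun hd => ?_
    refine ENNReal.le_sub_of_add_le_right (ne_top_of_le_ne_top htop hle) ?_
    have := f.sum_chartNormSq_le (ι := Option (Fin k)) (U := univ)
      (fun o => o.elim e e') (fun o => o.elim B B') (fun o => ?_) (fun o o' hoo => ?_)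
    · rw [Fintype.sum_option, add_comm] at this
      exact this
    · cases o with
      | none => exact ⟨he, hB, fun x hx => ⟨hBe hx, trivial⟩⟩
      | some i => exact ⟨(hB' i).1, (hB' i).2.1, fun x hx => ⟨((hB' i).2.2 hx).1, trivial⟩⟩
    · cases o with
      | none =>
        cases o' with
        | none => exact absurd rfl hoo
        | some j => exact (hBU.mono_left fun x hx => ((hB' j).2.2 hx).2).symm
      | some i =>
        cases o' with
        | none => exact hBU.mono_left fun x hx => ((hB' i).2.2 hx).2
        | some j => exact hd fun h => hoo (congrArg some h)
  calc f.normSqOn U + f.chartNormSq e B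
      ≤ f.normSqOn univ - f.chartNormSq e B + f.chartNormSq e B := add_le_add_left key _
    _ = f.normSqOn univ := tsub_add_cancel_of_le hle

variable [IsManifold 𝓘(ℂ, Cn n) ω M] [IsManifold 𝓘(ℂ, Cn n) ω M']

theorem TopForm.eq_zero_of_coeff_eq_zero {f : TopForm n M} {e : OpenPartialHomeomorph M (Cn n)}
    (he : e ∈ atlas (Cn n) M) {x : M} (hx : x ∈ e.source) (h : f.coeff e (e x) = 0) :
    f x = 0 := by
  let f₀ : M → (Cn n) [⋀^Fin n]→L[ℂ] ℂ := f
  have hpt : f₀ (e.symm (e x)) = f₀ x := congrArg f₀ (e.left_inv hx)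
  let D : Cn n →L[ℂ] Cn n := mfderiv 𝓘(ℂ, Cn n) 𝓘(ℂ, Cn n) e.symm (e x)
  let A : Cn n →L[ℂ] Cn n := mfderiv 𝓘(ℂ, Cn n) 𝓘(ℂ, Cn n) e x
  have hDA : ∀ v, D (A v) = v := (IsBiholomorphic.of_mem_atlas he).mfderiv_symm_comp hx
  have h0 : ((f₀ x).compContinuousLinearMap D) (fun i => (Pi.single i (1 : ℂ) : Cn n)) = 0 := by
    rw [← hpt]; exact h
  refine ContinuousAlternatingMap.ext fun v => ?_
  have h1 := alternating_apply_map_single ((f₀ x).compContinuousLinearMap D) (fun i => A (v i))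
  rw [h0, mul_zero, ContinuousAlternatingMap.compContinuousLinearMap_apply] at h1
  change f₀ x v = 0
  rw [← h1]
  congr 1
  funext i
  exact (hDA (v i)).symm

/-- The identity theorem for holomorphic forms on a connected manifold. -/
theorem TopForm.eq_zero_of_eq_zero_on_open [PreconnectedSpace M] {f : TopForm n M}
    (hf : f.HolomorphicOn univ) {W : Set M} (hW : IsOpen W) (hne : W.Nonempty)
    (h0 : ∀ x ∈ W, f x = 0) (x : M) : f x = 0 := by
  obtain ⟨p, hp⟩ := hne
  have key : (univ : Set M) ⊆ {x | ∀ᶠ y in 𝓝 x, f y = 0} := by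
    refine isPreconnected_univ.subset_of_closure_inter_subset isOpen_setOfPred_eventually_nhds
      ⟨p, trivial, eventually_of_mem (hW.mem_nhds hp) h0⟩ ?_
    rintro x ⟨hx, -⟩
    let e := chartAt (Cn n) x
    have he : e ∈ atlas (Cn n) M := chart_mem_atlas _ _
    have hxe : x ∈ e.source := mem_chart_source _ _
    obtain ⟨r, hr, hball⟩ := Metric.isOpen_iff.1 e.open_target (e x) (e.map_source hxe)
    have hN : e.source ∩ e ⁻¹' Metric.ball (e x) r ∈ 𝓝 x :=
      (e.isOpen_inter_preimage Metric.isOpen_ball).mem_nhds ⟨hxe, Metric.mem_ball_self hr⟩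
    obtain ⟨y, hyN, hy⟩ := mem_closure_iff_nhds.1 hx _ hN
    have hd : DifferentiableOn ℂ (f.coeff e) (Metric.ball (e x) r) :=
      (hf e he).mono fun z hz => ⟨hball hz, trivial⟩
    have hev : f.coeff e =ᶠ[𝓝 (e y)] 0 := by
      have : Tendsto e.symm (𝓝 (e y)) (𝓝 y) := by
        have := e.continuousAt_symm (e.map_source hyN.1)
        rwa [ContinuousAt, e.left_inv hyN.1] at this
      filter_upwards [this.eventually hy] with z hz
      simp only [TopForm.coeff, Pi.zero_apply]
      rw [hz]
      rfl
    have h2 := eqOn_zero_ball_of_eventuallyEq_zero hd hyN.2 hev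
    exact eventually_of_mem hN fun w hw => TopForm.eq_zero_of_coeff_eq_zero he hw.1 (h2 hw.2)
  exact (key (mem_univ x)).self_of_nhds

theorem TopForm.chartNormSq_pos {f : TopForm n M} (hf : f.HolomorphicOn univ)
    {e : OpenPartialHomeomorph M (Cn n)} (he : e ∈ atlas (Cn n) M) {B : Set M} (hB : IsOpen B)
    (hBe : B ⊆ e.source) {x : M} (hx : x ∈ B) (h : f x ≠ 0) : 0 < f.chartNormSq e B := by
  have hc : ContinuousOn (f.coeff e) e.target := by
    have := (hf e he).continuousOn
    simpa using this
  have hcx : f.coeff e (e x) ≠ 0 := fun h0 =>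
    h (TopForm.eq_zero_of_coeff_eq_zero he (hBe hx) h0)
  have himg : IsOpen (e '' B) := e.isOpen_image_of_subset_source hB hBe
  have hsub : e '' B ⊆ e.target := by
    rintro _ ⟨y, hy, rfl⟩
    exact e.map_source (hBe hy)
  set W := (e '' B) ∩ (f.coeff e) ⁻¹' {0}ᶜ with hWdef
  have hW : IsOpen W := (hc.mono hsub).isOpen_inter_preimage himg isOpen_compl_singleton
  have hWne : W.Nonempty := ⟨e x, ⟨x, hx, rfl⟩, hcx⟩
  have hWpos : 0 < volume W := hW.measure_pos volume hWne
  rw [pos_iff_ne_zero, TopForm.chartNormSq]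
  intro h0
  have h1 : ∫⁻ z in W, 2 ^ n * ‖f.coeff e z‖ₑ ^ 2 = 0 :=
    le_antisymm ((lintegral_mono_set inter_subset_left).trans h0.le) (zero_le)
  have hm : AEMeasurable (fun z => (2 : ℝ≥0∞) ^ n * ‖f.coeff e z‖ₑ ^ 2) (volume.restrict W) := by
    have := (hc.mono (inter_subset_left.trans hsub)).aemeasurable (μ := volume) hW.measurableSet
      (s := W)
    exact (this.enorm.pow_const 2).const_mul _
  rw [lintegral_eq_zero_iff' hm] at h1
  have h2 : ∀ᵐ z ∂(volume.restrict W), False := by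
    filter_upwards [h1, ae_restrict_mem hW.measurableSet] with z hz hzW
    exact hzW.2 (by simpa using hz)
  rw [Filter.eventually_false_iff_eq_bot, ae_eq_bot, Measure.restrict_eq_zero] at h2
  exact hWpos.ne' h2

/-- The complement of a Bergman negligible set is dense. -/
theorem CManifold.Negligible.dense_compl {M : CManifold n} {E : Set M.carrier}
    (hE : M.Negligible E) (hM : M.NontrivialA2) : Dense Eᶜ := by
  rw [← interior_eq_empty_iff_dense_compl]
  by_contra hne
  rw [← Ne, ← nonempty_iff_ne_empty] at hne
  obtain ⟨hcl, hprop, hext⟩ := hE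
  obtain ⟨f, ⟨hfh, hff⟩, x, hx⟩ := hM
  obtain ⟨φ, ⟨hφh, -⟩, hφeq, hφn⟩ := hext f
    ⟨hfh.mono (subset_univ _), (f.normSqOn_mono (subset_univ _)).trans_lt hff⟩
  have hEo : IsOpen Eᶜ := hcl.isOpen_compl
  have hEne : Eᶜ.Nonempty := nonempty_compl.2 hprop
  -- The extension of the restriction of `f` is `f` itself, since the difference vanishes on a
  -- nonempty open set.
  let g : TopForm n M.carrier := fun x => φ x - f x
  have hdiff : g.HolomorphicOn univ := fun e he => (hφh e he).sub (hfh e he)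
  have hφf : ∀ x, φ x = f x := fun x => sub_eq_zero.1
    (TopForm.eq_zero_of_eq_zero_on_open hdiff hEo hEne (fun x hx => sub_eq_zero.2 (hφeq x hx)) x)
  have hnorm : f.normSqOn univ = f.normSqOn Eᶜ := by
    rw [← hφn]; exact TopForm.normSqOn_congr fun x _ => (hφf x).symm
  -- The full norm is already attained on the complement of `E`, so no mass remains on a chart
  -- neighbourhood inside `E`.
  have hzero : ∀ x ∈ interior E, f x = 0 := by
    intro y hy
    by_contra hy0
    let e := chartAt (Cn n) y
    have he : e ∈ atlas (Cn n) M.carrier := chart_mem_atlas _ _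
    have hBo : IsOpen (e.source ∩ interior E) := e.open_source.inter isOpen_interior
    have hpos := TopForm.chartNormSq_pos hfh he hBo inter_subset_left
      ⟨mem_chart_source _ _, hy⟩ hy0
    have hle := f.normSqOn_add_chartNormSq_le (U := Eᶜ) he
      (MeasurableSpace.measurableSet_generateFrom hBo) inter_subset_left
      (disjoint_compl_left.mono_right (inter_subset_right.trans interior_subset))
    rw [← hnorm] at hle
    exact absurd hle (not_le.2 (ENNReal.lt_add_right hff.ne hpos.ne'))
  exact hx (TopForm.eq_zero_of_eq_zero_on_open hfh isOpen_interior hne hzero x)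

/-- The Bergman kernel form on the diagonal, by its extremal property. -/
def CManifold.kernelForm (M : CManifold n) (x : M.carrier) (v : Fin n → Cn n) : ℝ≥0∞ :=
  ⨆ (f : TopForm n M.carrier) (_ : f.MemA2 univ) (_ : f.normSqOn univ ≤ 1),
    ‖(f x : (Cn n) [⋀^Fin n]→L[ℂ] ℂ) v‖ₑ ^ 2

/-- Two manifolds correspond to each other if dense open subsets of them are biholomorphic by a map
preserving the Bergman kernel forms. -/
def BergmanCorrespondence (M M' : CManifold n) : Prop :=
  ∃ Φ : OpenPartialHomeomorph M.carrier M'.carrier, IsBiholomorphic (n := n) Φ ∧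
    Dense Φ.source ∧ Dense Φ.target ∧ ∀ x ∈ Φ.source, ∀ v, M.kernelForm x v =
      M'.kernelForm (Φ x)
        fun i => (mfderiv 𝓘(ℂ, Cn n) 𝓘(ℂ, Cn n) Φ x : Cn n →L[ℂ] Cn n) (v i)

theorem BergmanCorrespondence.refl (M : CManifold n) : BergmanCorrespondence M M := by
  refine ⟨OpenPartialHomeomorph.refl M.carrier, ⟨contMDiff_id.contMDiffOn, contMDiff_id.contMDiffOn⟩,
    dense_univ, dense_univ, fun x _ v => ?_⟩
  have : (mfderiv 𝓘(ℂ, Cn n) 𝓘(ℂ, Cn n) (OpenPartialHomeomorph.refl M.carrier) x) =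
      ContinuousLinearMap.id ℂ _ := mfderiv_id
  rw [this]
  rfl

theorem BergmanCorrespondence.symm {M M' : CManifold n} (h : BergmanCorrespondence M M') :
    BergmanCorrespondence M' M := by
  obtain ⟨Φ, hΦ, hs, ht, hk⟩ := h
  refine ⟨Φ.symm, hΦ.symm, ht, hs, fun y hy v => ?_⟩
  refine Eq.symm ((hk (Φ.symm y) (Φ.map_target hy) _).trans ?_)
  rw [Φ.right_inv hy]
  congr 1
  funext i
  exact hΦ.symm.mfderiv_symm_comp hy (v i)

theorem BergmanCorrespondence.trans {M M' M'' : CManifold n} (h : BergmanCorrespondence M M')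
    (h' : BergmanCorrespondence M' M'') : BergmanCorrespondence M M'' := by
  obtain ⟨Φ, hΦ, hs, ht, hk⟩ := h
  obtain ⟨Ψ, hΨ, hs', ht', hk'⟩ := h'
  -- The composite lives only on the preimage of the second source. This set is dense because an
  -- open subset of the first source has open image, which meets the dense set `S`.
  have hdense : ∀ {X Y : Type} [TopologicalSpace X] [TopologicalSpace Y]
      (F : OpenPartialHomeomorph X Y) (S : Set Y), Dense F.source → Dense S → IsOpen S →
      Dense (F.source ∩ F ⁻¹' S) := by
    intro X Y _ _ F S hF hS hSo
    rw [dense_iff_inter_open] at *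
    intro U hU hne
    obtain ⟨x, hxU, hxF⟩ := hF U hU hne
    obtain ⟨y, hy, hyS⟩ := hS (F '' (F.source ∩ U))
      (F.isOpen_image_of_subset_source (F.open_source.inter hU) inter_subset_left)
      ⟨F x, x, ⟨hxF, hxU⟩, rfl⟩
    obtain ⟨w, hw, rfl⟩ := hy
    exact ⟨w, hw.2, hw.1, hyS⟩
  refine ⟨Φ.trans Ψ, hΦ.trans hΨ, ?_, ?_, fun x hx v => ?_⟩
  · rw [trans_source]
    exact hdense Φ _ hs hs' Ψ.open_source
  · rw [trans_target]
    exact hdense Ψ.symm _ ht' ht Φ.open_target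
  · rw [trans_source] at hx
    have hx2 : Φ x ∈ Ψ.source := hx.2
    refine ((hk x hx.1 v).trans (hk' _ hx2 _)).trans ?_
    have := mfderiv_comp x (hΨ.mdifferentiableAt hx2) (hΦ.mdifferentiableAt hx.1)
    change _ = M''.kernelForm (Ψ (Φ x)) fun i =>
      (mfderiv 𝓘(ℂ, Cn n) 𝓘(ℂ, Cn n) (Ψ ∘ Φ) x : Cn n →L[ℂ] Cn n) (v i)
    rw [this]
    rfl

/-- Pullback preserves norms and negligible sets allow norm-preserving extension. Hence the unit
balls of the two Bergman spaces yield the same values at corresponding points. -/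
theorem BergmanLE.correspondence {M₁ M₂ : CManifold n} (h : BergmanLE M₁ M₂) :
    BergmanCorrespondence M₁ M₂ := by
  obtain ⟨-, h2, U, hU, ⟨F⟩⟩ := h
  have hne : Nonempty U := by
    obtain ⟨x⟩ := (inferInstance : Nonempty M₁.carrier)
    exact ⟨F x⟩
  have hdense : Dense (U : Set M₂.carrier) := by simpa using hU.dense_compl h2
  let Φ : OpenPartialHomeomorph M₁.carrier M₂.carrier :=
    F.toHomeomorph.toOpenPartialHomeomorph.trans (U.openPartialHomeomorphSubtypeCoe hne)
  have hsrc : Φ.source = univ := by simp [Φ]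
  have htgt : Φ.target = U := by simp [Φ]
  have hΦ : IsBiholomorphic (n := n) Φ := by
    constructor
    · have : ContMDiff 𝓘(ℂ, Cn n) 𝓘(ℂ, Cn n) ω (Subtype.val ∘ F) :=
        (contMDiff_subtype_val (I := 𝓘(ℂ, Cn n))).comp F.contMDiff_toFun
      exact this.contMDiffOn
    · intro y hy
      rw [htgt] at hy
      have h1 : ContMDiffAt 𝓘(ℂ, Cn n) 𝓘(ℂ, Cn n) ω (fun u : U => Φ.symm u) ⟨y, hy⟩ := by
        have : (fun u : U => Φ.symm u) = F.symm := by
          funext u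
          have h2 := (U.openPartialHomeomorphSubtypeCoe hne).left_inv (x := u) trivial
          exact congrArg F.symm h2
        rw [this]
        exact F.contMDiff_invFun _
      exact (contMDiffAt_subtype_iff.1 h1).contMDiffWithinAt
  refine ⟨Φ, hΦ, by rw [hsrc]; exact dense_univ, by rwa [htgt], fun x hx v => ?_⟩
  have hpull : ∀ f : TopForm n M₂.carrier,
      (f.pullback Φ).normSqOn univ = f.normSqOn U := by
    intro f
    have := f.normSqOn_pullback hΦ
    rwa [hsrc, htgt] at this
  apply le_antisymm
  -- A competitor on `M₁` is transported to `U` and extended to `M₂`; this is the only use of the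
  -- extension property apart from density.
  · refine iSup_le fun f => iSup_le fun hf => iSup_le fun h1 => ?_
    let ψ : TopForm n M₂.carrier := f.pullback Φ.symm
    have hψf : ∀ y, ψ.pullback Φ y = f y := by
      intro y
      have := f.pullback_symm_pullback hΦ.symm (y := y) (by simp [hsrc])
      simpa using this
    have hψn : ψ.normSqOn U = f.normSqOn univ := by
      rw [← hpull]; exact TopForm.normSqOn_congr fun y _ => hψf y
    have hψ : ψ.MemA2 ((U : Set M₂.carrier)ᶜ)ᶜ := by
      rw [compl_compl]
      refine ⟨?_, by rw [hψn]; exact hf.2⟩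
      have := TopForm.HolomorphicOn.pullback hΦ.symm (f := f)
        (by simpa [hsrc] using hf.1)
      simpa [htgt] using this
    obtain ⟨φ, hφ, hφψ, hφn⟩ := hU.2.2 ψ hψ
    rw [compl_compl] at hφn
    refine le_iSup_of_le φ (le_iSup_of_le hφ (le_iSup_of_le (by rw [hφn, hψn]; exact h1) ?_))
    have hxU : Φ x ∈ ((U : Set M₂.carrier)ᶜ)ᶜ := by
      rw [compl_compl, ← htgt]; exact Φ.map_source hx
    rw [hφψ _ hxU]
    have := hψf x
    rw [← this]
    rfl
  -- A competitor on `M₂` is restricted to `U`, which does not increase its norm.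
  · refine iSup_le fun f => iSup_le fun hf => iSup_le fun h1 => ?_
    refine le_iSup_of_le (f.pullback Φ) (le_iSup_of_le ⟨?_, ?_⟩ (le_iSup_of_le ?_ le_rfl))
    · have := TopForm.HolomorphicOn.pullback hΦ (f := f) (hf.1.mono (subset_univ _))
      rwa [hsrc] at this
    · rw [hpull]; exact (f.normSqOn_mono (subset_univ _)).trans_lt hf.2
    · rw [hpull]; exact (f.normSqOn_mono (subset_univ _)).trans h1

theorem BergmanEquiv.correspondence {M M' : CManifold n} (h : BergmanEquiv M M') :
    BergmanCorrespondence M M' := by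
  induction h with
  | rel _ _ h => exact h.correspondence
  | refl M => exact .refl M
  | symm _ _ _ ih => exact ih.symm
  | trans _ _ _ _ _ ih1 ih2 => exact ih1.trans ih2

end Correspondence

/-! ### Domains as manifolds -/

section Domains

open Filter Topology OpenPartialHomeomorph

variable {n : ℕ}

instance (Ω : CDomain n) : Nonempty Ω.carrier := Ω.connected.nonempty.to_subtype

/-- The inclusion of a domain in `ℂⁿ`, as a chart. -/
def CDomain.chart (Ω : CDomain n) : OpenPartialHomeomorph Ω.carrier (Cn n) :=
  (OpenPartialHomeomorph.refl (Cn n)).subtypeRestr (s := Ω.carrier) inferInstance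

theorem CDomain.chartAt_eq (Ω : CDomain n) (x : Ω.carrier) : chartAt (Cn n) x = Ω.chart := rfl

theorem CDomain.mem_atlas_iff (Ω : CDomain n)
    {e : OpenPartialHomeomorph Ω.carrier (Cn n)} : e ∈ atlas (Cn n) Ω.carrier ↔ e = Ω.chart := by
  constructor
  · intro h
    obtain ⟨x, hx⟩ := mem_iUnion.1 h
    exact hx
  · rintro rfl
    obtain ⟨x⟩ := (inferInstance : Nonempty Ω.carrier)
    rw [← Ω.chartAt_eq x]
    exact chart_mem_atlas _ _

@[simp] theorem CDomain.chart_apply (Ω : CDomain n) (x : Ω.carrier) : Ω.chart x = x := rfl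

@[simp] theorem CDomain.chart_source (Ω : CDomain n) : Ω.chart.source = univ := by
  simp [CDomain.chart]

@[simp] theorem CDomain.chart_target (Ω : CDomain n) : Ω.chart.target = Ω.set := by
  simp [CDomain.chart, OpenPartialHomeomorph.subtypeRestr, CDomain.set]

theorem CDomain.chart_symm_apply (Ω : CDomain n) {z : Cn n} (hz : z ∈ Ω.set) :
    (Ω.chart.symm z : Cn n) = z := Ω.chart.right_inv (by simpa using hz)

theorem CDomain.chart_symm_eq (Ω : CDomain n) {z : Cn n} (hz : z ∈ Ω.set) :
    Ω.chart.symm z = ⟨z, hz⟩ := Subtype.ext (Ω.chart_symm_apply hz)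

theorem CDomain.chart_symm_coe (Ω : CDomain n) (x : Ω.carrier) : Ω.chart.symm (x : Cn n) = x :=
  Ω.chart.left_inv (by simp)

theorem CDomain.mfderiv_chart_symm (Ω : CDomain n) {z : Cn n} (hz : z ∈ Ω.set) :
    mfderiv 𝓘(ℂ, Cn n) 𝓘(ℂ, Cn n) Ω.chart.symm z = ContinuousLinearMap.id ℂ (Cn n) := by
  have hd : MDifferentiableAt 𝓘(ℂ, Cn n) 𝓘(ℂ, Cn n) Ω.chart.symm z :=
    (IsBiholomorphic.of_mem_atlas (Ω.mem_atlas_iff.2 rfl)).mdifferentiableAt_symm (by simpa)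
  rw [hd.mfderiv, modelWithCornersSelf_coe, range_id, fderivWithin_univ]
  have : writtenInExtChartAt 𝓘(ℂ, Cn n) 𝓘(ℂ, Cn n) z Ω.chart.symm =ᶠ[𝓝 z] id := by
    filter_upwards [Ω.isOpen_set.mem_nhds hz] with w hw
    exact Ω.chart_symm_apply hw
  exact this.fderiv_eq.trans fderiv_id

theorem CDomain.coeff_chart (Ω : CDomain n) (f : TopForm n Ω.carrier) {z : Cn n}
    (hz : z ∈ Ω.set) :
    f.coeff Ω.chart z = (f ⟨z, hz⟩ : (Cn n) [⋀^Fin n]→L[ℂ] ℂ)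
      fun i => (Pi.single i (1 : ℂ) : Cn n) := by
  let f₀ : Ω.carrier → (Cn n) [⋀^Fin n]→L[ℂ] ℂ := f
  have h1 : f₀ (Ω.chart.symm z) = f₀ ⟨z, hz⟩ := congrArg f₀ (Ω.chart_symm_eq hz)
  have h2 := Ω.mfderiv_chart_symm hz
  change (f₀ (Ω.chart.symm z) fun i => (mfderiv 𝓘(ℂ, Cn n) 𝓘(ℂ, Cn n) Ω.chart.symm z :
    Cn n →L[ℂ] Cn n) (Pi.single i (1 : ℂ))) = _
  rw [h1]
  congr 1
  funext i
  exact DFunLike.congr_fun h2 (Pi.single i (1 : ℂ))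

theorem CDomain.holomorphicOn_iff (Ω : CDomain n) (f : TopForm n Ω.carrier) :
    f.HolomorphicOn univ ↔ DifferentiableOn ℂ (f.coeff Ω.chart) Ω.set := by
  constructor
  · intro h
    simpa using h Ω.chart (Ω.mem_atlas_iff.2 rfl)
  · intro h e he
    rw [Ω.mem_atlas_iff.1 he]
    simpa using h

/-- The atlas consists of one chart, so the supremum over disjoint pieces is attained by the single
piece `Ω`. -/
theorem CDomain.normSqOn_univ (Ω : CDomain n) (f : TopForm n Ω.carrier) :
    f.normSqOn univ = 2 ^ n * ∫⁻ z in Ω.set, ‖f.coeff Ω.chart z‖ₑ ^ 2 := by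
  let _ : MeasurableSpace Ω.carrier := borel Ω.carrier
  have _ : BorelSpace Ω.carrier := ⟨rfl⟩
  rw [← lintegral_const_mul' _ _ (by simp)]
  apply le_antisymm
  · refine iSup_le fun k => iSup_le fun e => iSup_le fun B => iSup_le fun hB => iSup_le fun hd => ?_
    have he : ∀ i, e i = Ω.chart := fun i => Ω.mem_atlas_iff.1 (hB i).1
    simp only [he]
    have hm : ∀ i, MeasurableSet (Ω.chart '' B i) := fun i =>
      measurableSet_image_openPartialHomeomorph _ (hB i).2.1 (by simp)
    have hd' : Pairwise (Function.onFun Disjoint fun i => Ω.chart '' B i) := by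
      intro i j hij
      exact (disjoint_image_iff Subtype.val_injective).2 (hd hij)
    rw [← tsum_fintype (L := .unconditional _), ← lintegral_iUnion hm hd']
    refine lintegral_mono_set (iUnion_subset fun i => ?_)
    rintro _ ⟨x, -, rfl⟩
    exact x.2
  · have := f.sum_chartNormSq_le (ι := Unit) (U := univ) (fun _ => Ω.chart) (fun _ => univ)
      (fun _ => ⟨Ω.mem_atlas_iff.2 rfl, MeasurableSet.univ, by simp⟩)
      (fun i j hij => absurd rfl hij)
    refine le_trans (le_of_eq ?_) this
    have him : Ω.chart '' univ = Ω.set := by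
      ext z
      simp only [image_univ, mem_range, CDomain.chart_apply]
      exact ⟨fun ⟨x, hx⟩ => hx ▸ x.2, fun hz => ⟨⟨z, hz⟩, rfl⟩⟩
    simp [TopForm.chartNormSq, him]

/-- The standard volume form on `ℂⁿ`. -/
def stdVolumeForm (n : ℕ) : (Cn n) [⋀^Fin n]→L[ℂ] ℂ :=
  { (Pi.basisFun ℂ (Fin n)).det with
    cont := by
      change Continuous fun v => (Pi.basisFun ℂ (Fin n)).det v
      simp only [Module.Basis.det_apply]
      refine Continuous.matrix_det (continuous_matrix fun i j => ?_)
      simp only [Module.Basis.toMatrix_apply, Pi.basisFun_repr]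
      fun_prop }

theorem stdVolumeForm_apply (v : Fin n → Cn n) :
    stdVolumeForm n v = (Pi.basisFun ℂ (Fin n)).det v := rfl

theorem stdVolumeForm_single : stdVolumeForm n (fun i => (Pi.single i (1 : ℂ) : Cn n)) = 1 := by
  rw [stdVolumeForm_apply]
  have h3 : (fun i => (Pi.single i (1 : ℂ) : Cn n)) = Pi.basisFun ℂ (Fin n) :=
    funext fun i => (Pi.basisFun_apply ℂ (Fin n) i).symm
  rw [h3, Module.Basis.det_self]

/-- The form `h dz₁ ∧ ⋯ ∧ dzₙ` on a domain. -/
def CDomain.form (Ω : CDomain n) (h : Cn n → ℂ) : TopForm n Ω.carrier := fun x =>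
  (h x • stdVolumeForm n : (Cn n) [⋀^Fin n]→L[ℂ] ℂ)

theorem CDomain.coeff_form (Ω : CDomain n) (h : Cn n → ℂ) {z : Cn n} (hz : z ∈ Ω.set) :
    (Ω.form h).coeff Ω.chart z = h z := by
  rw [Ω.coeff_chart _ hz]
  change h z * stdVolumeForm n _ = _
  rw [stdVolumeForm_single, mul_one]

theorem CDomain.form_apply_eq (Ω : CDomain n) (f : TopForm n Ω.carrier) (x : Ω.carrier)
    (v : Fin n → Cn n) : (f x : (Cn n) [⋀^Fin n]→L[ℂ] ℂ) v =
      stdVolumeForm n v * f.coeff Ω.chart x := by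
  rw [Ω.coeff_chart f x.2]
  exact alternating_apply_map_single _ v

/-- The kernel form of a domain in terms of its Bergman kernel. -/
theorem CDomain.kernelForm_eq (Ω : CDomain n) {K : Cn n → Cn n → ℂ} (hK : Ω.IsBergmanKernel K)
    (x : Ω.carrier) (v : Fin n → Cn n) {c : ℂ} (hc : ‖c‖ₑ ^ 2 * 2 ^ n = 1) :
    Ω.toManifold.kernelForm x v =
      ‖stdVolumeForm n v‖ₑ ^ 2 * (‖c‖ₑ ^ 2 * ENNReal.ofReal (K x x).re) := by
  have hc0 : c ≠ 0 := by
    rintro rfl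
    simp at hc
  have hlint : ∀ f : TopForm n Ω.carrier, 2 ^ n * ∫⁻ z in Ω.set, ‖f.coeff Ω.chart z‖ₑ ^ 2 =
      f.normSqOn univ := fun f => (Ω.normSqOn_univ f).symm
  have hsmul : ∀ g : Cn n → ℂ, ‖c‖ₑ ^ 2 * ∫⁻ z in Ω.set, ‖g z‖ₑ ^ 2 =
      ∫⁻ z in Ω.set, ‖c * g z‖ₑ ^ 2 := by
    intro g
    rw [← lintegral_const_mul' _ _ (by simp)]
    simp only [enorm_mul, mul_pow]
  rw [← hK.iSup_enorm_sq x.2]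
  change (⨆ (f : TopForm n Ω.carrier) (_ : f.MemA2 univ) (_ : f.normSqOn univ ≤ 1),
    ‖(f x : (Cn n) [⋀^Fin n]→L[ℂ] ℂ) v‖ₑ ^ 2) = _
  apply le_antisymm
  · refine iSup_le fun f => iSup_le fun hf => iSup_le fun h1 => ?_
    rw [Ω.form_apply_eq, enorm_mul, mul_pow]
    gcongr
    -- Division by `c` absorbs the factor `2 ^ n` in the norm of forms, so that the unit ball of
    -- forms becomes the unit ball of `A²(Ω)`.
    set g : Cn n → ℂ := fun z => c⁻¹ * f.coeff Ω.chart z with hg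
    have hcg : ∀ z, f.coeff Ω.chart z = c * g z := fun z => by simp [hg, hc0]
    have hint : ∫⁻ z in Ω.set, ‖g z‖ₑ ^ 2 = f.normSqOn univ := by
      rw [← hlint]
      simp only [hcg]
      rw [← hsmul, ← mul_assoc, mul_comm (2 ^ n), hc, one_mul]
    have hgm : Ω.MemA2 g := CDomain.memA2_iff.2
      ⟨((Ω.holomorphicOn_iff f).1 hf.1).const_mul _, by rw [hint]; exact hf.2⟩
    rw [hcg, enorm_mul, mul_pow]
    gcongr
    exact le_iSup_of_le g (le_iSup_of_le hgm (le_iSup_of_le (by rw [hint]; exact h1) le_rfl))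
  · rw [ENNReal.mul_iSup, ENNReal.mul_iSup]
    refine iSup_le fun g => ?_
    rw [ENNReal.mul_iSup, ENNReal.mul_iSup]
    refine iSup_le fun hg => ?_
    rw [ENNReal.mul_iSup, ENNReal.mul_iSup]
    refine iSup_le fun h1 => ?_
    let f := Ω.form (fun z => c * g z)
    have hcoeff : ∀ z ∈ Ω.set, f.coeff Ω.chart z = c * g z := fun z hz => Ω.coeff_form _ hz
    have hnorm : f.normSqOn univ = ∫⁻ z in Ω.set, ‖g z‖ₑ ^ 2 := by
      rw [← hlint, setLIntegral_congr_fun (g := fun z => ‖c * g z‖ₑ ^ 2)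
        Ω.isOpen_set.measurableSet (fun z hz => by simp only [hcoeff z hz]), ← hsmul, ← mul_assoc,
        mul_comm (2 ^ n), hc, one_mul]
    refine le_iSup_of_le f (le_iSup_of_le ⟨?_, ?_⟩ (le_iSup_of_le (by rw [hnorm]; exact h1) ?_))
    · exact (Ω.holomorphicOn_iff f).2 ((hg.1.const_mul c).congr hcoeff)
    · rw [hnorm]; exact (CDomain.memA2_iff.1 hg).2
    · rw [Ω.form_apply_eq, hcoeff _ x.2, enorm_mul, mul_pow, enorm_mul, mul_pow]

theorem exists_enorm_sq_mul_two_pow (n : ℕ) : ∃ c : ℂ, ‖c‖ₑ ^ 2 * 2 ^ n = 1 := by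
  refine ⟨((Real.sqrt 2 ^ n)⁻¹ : ℝ), ?_⟩
  rw [← ofReal_norm, Complex.norm_real, Real.norm_of_nonneg (by positivity),
    ← ENNReal.ofReal_pow (by positivity)]
  have : ((2 : ℝ≥0∞)) ^ n = ENNReal.ofReal (2 ^ n) := by
    rw [ENNReal.ofReal_pow (by norm_num)]; simp
  rw [this, ← ENNReal.ofReal_mul (by positivity), inv_pow, ← pow_mul, mul_comm n, pow_mul,
    Real.sq_sqrt (by norm_num), inv_mul_cancel₀ (by positivity), ENNReal.ofReal_one]

/-- Bergman equivalent domains correspond to each other by a holomorphic map between dense open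
subsets which transforms the Bergman kernels on the diagonal into each other. -/
theorem BergmanEquiv.exists_map {Ω Ω' : CDomain n} (h : BergmanEquiv Ω.toManifold Ω'.toManifold)
    {K K' : Cn n → Cn n → ℂ} (hK : Ω.IsBergmanKernel K) (hK' : Ω'.IsBergmanKernel K') :
    ∃ (W : Set (Cn n)) (F : Cn n → Cn n), IsOpen W ∧ W ⊆ Ω.set ∧ Ω.set ⊆ closure W ∧
      MapsTo F W Ω'.set ∧ ContDiffOn ℂ ω F W ∧ ∀ z ∈ W,
        ENNReal.ofReal (K z z).re =
          ‖(fderiv ℂ F z).det‖ₑ ^ 2 * ENNReal.ofReal (K' (F z) (F z)).re := by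
  obtain ⟨Φ', hΦ', hs', -, hk'⟩ := h.correspondence
  let Φ : OpenPartialHomeomorph Ω.carrier Ω'.carrier := Φ'
  have hΦ : IsBiholomorphic (n := n) Φ := hΦ'
  have hs : Dense Φ.source := hs'
  have hk : ∀ x ∈ Φ.source, ∀ v : Fin n → Cn n, Ω.toManifold.kernelForm x v =
      Ω'.toManifold.kernelForm (Φ x) fun i =>
        (mfderiv 𝓘(ℂ, Cn n) 𝓘(ℂ, Cn n) Φ x : Cn n →L[ℂ] Cn n) (v i) := hk'
  have hF : IsBiholomorphic (n := n) (Bergman.inCharts Ω.chart Φ Ω'.chart) :=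
    hΦ.inCharts (Ω.mem_atlas_iff.2 rfl) (Ω'.mem_atlas_iff.2 rfl)
  set F := Bergman.inCharts Ω.chart Φ Ω'.chart with hFdef
  have hsrc : F.source = Ω.set ∩ Ω.chart.symm ⁻¹' Φ.source := by
    rw [hFdef, Bergman.inCharts, trans_source, trans_source]
    simp
  have hderiv : ∀ x ∈ Φ.source, (mfderiv 𝓘(ℂ, Cn n) 𝓘(ℂ, Cn n) Φ x : Cn n →L[ℂ] Cn n) =
      fderiv ℂ F x := by
    intro x hx
    rw [(hΦ.mdifferentiableAt hx).mfderiv, modelWithCornersSelf_coe, range_id, fderivWithin_univ]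
    rfl
  obtain ⟨c, hc⟩ := exists_enorm_sq_mul_two_pow n
  have hc0 : ‖c‖ₑ ^ 2 ≠ 0 := by
    intro h0
    simp [h0] at hc
  refine ⟨F.source, F, F.open_source, ?_, ?_, ?_, hF.contDiffOn, fun z hz => ?_⟩
  · rw [hsrc]; exact inter_subset_left
  · intro z hz
    rw [mem_closure_iff]
    intro V hV hzV
    obtain ⟨y, hyV, hyΦ⟩ := hs.inter_open_nonempty (Subtype.val ⁻¹' V)
      (hV.preimage continuous_subtype_val) ⟨⟨z, hz⟩, hzV⟩
    refine ⟨y, hyV, ?_⟩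
    rw [hsrc]
    refine ⟨y.2, ?_⟩
    rw [mem_preimage, Ω.chart_symm_coe]
    exact hyΦ
  · intro z _
    exact (Φ (Ω.chart.symm z)).2
  · have hzs := hz
    rw [hsrc] at hzs
    obtain ⟨hzΩ, hzΦ⟩ := hzs
    set x := Ω.chart.symm z with hx
    have hxz : (x : Cn n) = z := Ω.chart_symm_apply hzΩ
    have hFz : F z = (Φ x : Cn n) := rfl
    have hd : (mfderiv 𝓘(ℂ, Cn n) 𝓘(ℂ, Cn n) Φ x : Cn n →L[ℂ] Cn n) = fderiv ℂ F z := by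
      rw [hderiv x hzΦ, hxz]
    -- The kernel forms are compared on the standard frame; its image under the derivative has
    -- volume equal to the Jacobian determinant.
    have key := (Ω.kernelForm_eq hK x (fun i => (Pi.single i (1 : ℂ) : Cn n)) hc).symm.trans
      ((hk x hzΦ _).trans (Ω'.kernelForm_eq hK' (Φ x) _ hc))
    have hv : stdVolumeForm n (fun i => (mfderiv 𝓘(ℂ, Cn n) 𝓘(ℂ, Cn n) Φ x : Cn n →L[ℂ] Cn n)
        (Pi.single i (1 : ℂ))) = (fderiv ℂ F z).det := by
      have h1 := alternating_apply_comp_single (stdVolumeForm n) (fderiv ℂ F z)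
      rw [stdVolumeForm_single, mul_one] at h1
      refine Eq.trans ?_ h1
      congr 1
      funext i
      exact DFunLike.congr_fun hd _
    have key : ‖stdVolumeForm n fun i => (Pi.single i (1 : ℂ) : Cn n)‖ₑ ^ 2 *
        (‖c‖ₑ ^ 2 * ENNReal.ofReal (K x x).re) = ‖(fderiv ℂ F z).det‖ₑ ^ 2 *
        (‖c‖ₑ ^ 2 * ENNReal.ofReal (K' (F z) (F z)).re) := by
      rw [← hv]
      exact key
    rw [stdVolumeForm_single, hxz] at key
    simp only [enorm_one, one_pow, one_mul] at key
    rw [mul_left_comm] at key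
    exact (ENNReal.mul_right_inj hc0 (by simp)).1 key

end Domains

/-! ### Holomorphic maps with quadratic norm -/

section QuadraticNorm

open Filter Topology

variable {H : Type*} [NormedAddCommGroup H] [InnerProductSpace ℂ H]

/-- In the expansion of `‖q 0 + t • p t‖ ^ 2` the cross term is twice the real part of a holomorphic
function vanishing at `0`, so its circle average is zero. -/
theorem circleAverage_norm_sq_eq {q p : ℂ → H} {R r : ℝ} (hr : 0 < r) (hrR : r < R)
    (hp : DifferentiableOn ℂ p (Metric.ball 0 R))
    (hqp : ∀ t ∈ Metric.ball (0 : ℂ) R, q t = q 0 + t • p t) :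
    Real.circleAverage (fun t => ‖q t‖ ^ 2) 0 r =
      ‖q 0‖ ^ 2 + r ^ 2 * Real.circleAverage (fun t => ‖p t‖ ^ 2) 0 r := by
  have hsub : Metric.closedBall (0 : ℂ) r ⊆ Metric.ball 0 R := Metric.closedBall_subset_ball hrR
  have hsph : Metric.sphere (0 : ℂ) |r| ⊆ Metric.ball 0 R := by
    rw [abs_of_pos hr]; exact Metric.sphere_subset_closedBall.trans hsub
  have hpc : ContinuousOn p (Metric.sphere 0 |r|) := hp.continuousOn.mono hsph
  set f : ℂ → ℂ := fun t => t * inner ℂ (q 0) (p t) with hf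
  have hfd : DifferentiableOn ℂ f (Metric.ball 0 R) :=
    differentiableOn_id.mul ((innerSL ℂ (q 0)).differentiable.comp_differentiableOn hp)
  have hfmean : Real.circleAverage f 0 r = 0 := by
    have : DiffContOnCl ℂ f (Metric.ball 0 |r|) := by
      refine DifferentiableOn.diffContOnCl ?_
      rw [abs_of_pos hr, closure_ball _ hr.ne']
      exact hfd.mono hsub
    rw [this.circleAverage]
    simp [hf]
  have hfc : ContinuousOn f (Metric.sphere 0 |r|) := hfd.continuousOn.mono hsph
  have hfi : CircleIntegrable f 0 r := hfc.circleIntegrable'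
  have hre : Real.circleAverage (fun t => 2 * (f t).re) 0 r = 0 := by
    have h1 := (2 • Complex.reCLM).circleAverage_comp_comm hfi
    rw [hfmean, map_zero] at h1
    rw [← h1]
    congr 1
    funext t
    simp
  have hint1 : CircleIntegrable (fun t => 2 * (f t).re) 0 r :=
    ContinuousOn.circleIntegrable' (continuousOn_const.mul
      (Complex.continuous_re.comp_continuousOn hfc))
  have hint2 : CircleIntegrable (fun t => r ^ 2 * ‖p t‖ ^ 2) 0 r :=
    ContinuousOn.circleIntegrable' (continuousOn_const.mul (hpc.norm.pow 2))
  have hexp : EqOn (fun t => ‖q t‖ ^ 2)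
      (fun t => ‖q 0‖ ^ 2 + (2 * (f t).re + r ^ 2 * ‖p t‖ ^ 2)) (Metric.sphere 0 |r|) := by
    intro t ht
    have ht' : ‖t‖ = r := by rw [mem_sphere_zero_iff_norm] at ht; rw [ht, abs_of_pos hr]
    simp only
    rw [hqp t (hsph ht), @norm_add_sq ℂ, inner_smul_right, norm_smul, ht', hf]
    simp only [RCLike.re_to_complex]
    ring
  rw [Real.circleAverage_congr_sphere hexp,
    Real.circleAverage_fun_add (f₁ := fun _ => ‖q 0‖ ^ 2)
      (f₂ := fun t => 2 * (f t).re + r ^ 2 * ‖p t‖ ^ 2) (circleIntegrable_const _ _ _)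
      (hint1.add hint2),
    Real.circleAverage_fun_add hint1 hint2, hre, Real.circleAverage_const, zero_add]
  congr 1
  exact Real.circleAverage_fun_smul (a := r ^ 2) (f := fun t => ‖p t‖ ^ 2)

theorem dslope_zero_spec (q : ℂ → H) (t : ℂ) : q t = q 0 + t • dslope q 0 t := by
  have := sub_smul_dslope q 0 t
  rw [sub_zero] at this
  rw [this]
  abel

variable [CompleteSpace H]

/-- Write `q t = q 0 + t • p t`. The average of `‖q‖²` is `‖q 0‖²` plus `r²` times that of `‖p‖²`;
letting `r → 0` gives `K ≤ ‖q 0‖²`. Hence the nonnegative average of `‖p‖²` vanishes on every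
circle, and `p` vanishes there by continuity. -/
theorem eq_const_of_circleAverage_norm_sq {q : ℂ → H} {R K : ℝ} (hR : 0 < R)
    (hq : DifferentiableOn ℂ q (Metric.ball 0 R))
    (hK : ∀ r, 0 < r → r < R → Real.circleAverage (fun t => ‖q t‖ ^ 2) 0 r = K) {t : ℂ}
    (ht : t ∈ Metric.ball (0 : ℂ) R) : q t = q 0 := by
  set p := dslope q 0 with hp
  have hpd : DifferentiableOn ℂ p (Metric.ball 0 R) :=
    (Complex.differentiableOn_dslope (Metric.ball_mem_nhds 0 hR)).2 hq
  have hqp : ∀ t, q t = q 0 + t • p t := dslope_zero_spec q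
  have hav : ∀ r, 0 < r → r < R →
      ‖q 0‖ ^ 2 + r ^ 2 * Real.circleAverage (fun t => ‖p t‖ ^ 2) 0 r = K := fun r h1 h2 => by
    rw [← circleAverage_norm_sq_eq h1 h2 hpd fun t _ => hqp t, hK r h1 h2]
  have hnn : ∀ r, 0 ≤ Real.circleAverage (fun t => ‖p t‖ ^ 2) 0 r := fun r =>
    Real.circleAverage_nonneg_of_nonneg fun x _ => by positivity
  obtain ⟨B, hB⟩ := (isCompact_closedBall (0 : ℂ) (R / 2)).exists_bound_of_continuousOn
    (hpd.continuousOn.mono (Metric.closedBall_subset_ball (by linarith)))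
  have hle : ∀ r, 0 < r → r < R / 2 → K - ‖q 0‖ ^ 2 ≤ r ^ 2 * B ^ 2 := fun r h1 h2 => by
    rw [← hav r h1 (by linarith), add_sub_cancel_left]
    gcongr
    refine Real.circleAverage_mono_on_of_le_circle ?_ fun x hx => ?_
    · refine ContinuousOn.circleIntegrable' ((hpd.continuousOn.mono ?_).norm.pow 2)
      rw [abs_of_pos h1]
      exact Metric.sphere_subset_closedBall.trans (Metric.closedBall_subset_ball (by linarith))
    · rw [abs_of_pos h1] at hx
      refine pow_le_pow_left₀ (norm_nonneg _) (hB x ?_) 2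
      exact Metric.closedBall_subset_closedBall h2.le (Metric.sphere_subset_closedBall hx)
  have hK0 : K - ‖q 0‖ ^ 2 ≤ 0 := by
    have hlim : Tendsto (fun r : ℝ => r ^ 2 * B ^ 2) (𝓝[>] 0) (𝓝 0) := by
      have : Continuous fun r : ℝ => r ^ 2 * B ^ 2 := by fun_prop
      simpa using (this.tendsto 0).mono_left nhdsWithin_le_nhds
    refine ge_of_tendsto hlim ?_
    filter_upwards [Ioo_mem_nhdsGT (half_pos hR)] with r hr using hle r hr.1 hr.2
  rcases eq_or_ne t 0 with rfl | ht0
  · rfl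
  have hr : 0 < ‖t‖ := norm_pos_iff.2 ht0
  have hrR : ‖t‖ < R := by simpa using ht
  have hav0 : Real.circleAverage (fun t => ‖p t‖ ^ 2) 0 ‖t‖ = 0 := by
    have h1 := hav _ hr hrR
    have h2 := hnn ‖t‖
    have h3 : ‖t‖ ^ 2 * Real.circleAverage (fun t => ‖p t‖ ^ 2) 0 ‖t‖ ≤ 0 := by linarith
    nlinarith [pow_pos hr 2]
  have hsph : Metric.sphere (0 : ℂ) ‖t‖ ⊆ Metric.ball 0 R :=
    Metric.sphere_subset_closedBall.trans (Metric.closedBall_subset_ball hrR)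
  have hpt : p t = 0 := by
    by_contra hne
    have hmem : t ∈ circleMap 0 ‖t‖ '' Ioc 0 (2 * Real.pi) := by
      rw [image_circleMap_Ioc]; simp
    obtain ⟨θ, hθ, hθt⟩ := hmem
    have hcont : Continuous fun θ => ‖p (circleMap 0 ‖t‖ θ)‖ ^ 2 :=
      ((hpd.continuousOn.mono hsph).comp_continuous (continuous_circleMap 0 ‖t‖)
        fun θ => circleMap_mem_sphere 0 hr.le θ).norm.pow 2
    have hpos : 0 < ∫ θ in (0)..2 * Real.pi, ‖p (circleMap 0 ‖t‖ θ)‖ ^ 2 := by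
      refine intervalIntegral.integral_pos Real.two_pi_pos hcont.continuousOn
        (fun _ _ => by positivity) ⟨θ, Ioc_subset_Icc_self hθ, ?_⟩
      rw [hθt]
      positivity
    rw [Real.circleAverage_def, smul_eq_zero] at hav0
    rcases hav0 with h | h
    · exact absurd h (by positivity)
    · exact hpos.ne' h
  rw [hqp t, hpt, smul_zero, add_zero]

/-- A holomorphic map from a disc to a Hilbert space whose squared norm is a real quadratic
polynomial is affine. -/
theorem eq_affine_of_norm_sq_quadratic {φ : ℂ → H} {R A D : ℝ} {B : ℂ} (hR : 0 < R)
    (hφ : DifferentiableOn ℂ φ (Metric.ball 0 R))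
    (h : ∀ t ∈ Metric.ball (0 : ℂ) R, ‖φ t‖ ^ 2 = A + 2 * (B * t).re + D * ‖t‖ ^ 2) {t : ℂ}
    (ht : t ∈ Metric.ball (0 : ℂ) R) : φ t = φ 0 + t • deriv φ 0 := by
  have hpd : DifferentiableOn ℂ (dslope φ 0) (Metric.ball 0 R) :=
    (Complex.differentiableOn_dslope (Metric.ball_mem_nhds 0 hR)).2 hφ
  have hA : ‖φ 0‖ ^ 2 = A := by simpa using h 0 (Metric.mem_ball_self hR)
  -- The linear term averages to zero, so the difference quotient has the constant quadratic mean
  -- `D`. By the preceding lemma it is constant.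
  have key : ∀ r, 0 < r → r < R → Real.circleAverage (fun t => ‖dslope φ 0 t‖ ^ 2) 0 r = D := by
    intro r hr hrR
    have h1 := circleAverage_norm_sq_eq hr hrR hpd fun t _ => dslope_zero_spec φ t
    have hsph : Metric.sphere (0 : ℂ) |r| ⊆ Metric.ball 0 R := by
      rw [abs_of_pos hr]
      exact Metric.sphere_subset_closedBall.trans (Metric.closedBall_subset_ball hrR)
    have h2 : Real.circleAverage (fun t => ‖φ t‖ ^ 2) 0 r = A + D * r ^ 2 := by
      have hlin : Real.circleAverage (fun t : ℂ => 2 * (B * t).re) 0 r = 0 := by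
        have hd : DiffContOnCl ℂ (fun t : ℂ => B * t) (Metric.ball 0 |r|) :=
          (differentiable_id.const_mul B).diffContOnCl
        have hi : CircleIntegrable (fun t : ℂ => B * t) 0 r :=
          ContinuousOn.circleIntegrable' (by fun_prop)
        have h1 := (2 • Complex.reCLM).circleAverage_comp_comm hi
        rw [hd.circleAverage, mul_zero, map_zero] at h1
        rw [← h1]
        congr 1
        funext t
        simp
      have hexp : EqOn (fun t => ‖φ t‖ ^ 2) (fun t => (A + D * r ^ 2) + 2 * (B * t).re)
          (Metric.sphere 0 |r|) := by
        intro t ht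
        have ht' : ‖t‖ = r := by rw [mem_sphere_zero_iff_norm] at ht; rw [ht, abs_of_pos hr]
        simp only
        rw [h t (hsph ht), ht']
        ring
      rw [Real.circleAverage_congr_sphere hexp,
        Real.circleAverage_fun_add (f₁ := fun _ => A + D * r ^ 2) (f₂ := fun t => 2 * (B * t).re)
          (circleIntegrable_const _ _ _) (ContinuousOn.circleIntegrable' (by fun_prop)),
        Real.circleAverage_const, hlin, add_zero]
    rw [h2, hA] at h1
    have h3 : r ^ 2 ≠ 0 := by positivity
    have h4 : r ^ 2 * (Real.circleAverage (fun t => ‖dslope φ 0 t‖ ^ 2) 0 r - D) = 0 := by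
      linarith
    rcases mul_eq_zero.1 h4 with h5 | h5
    · exact absurd h5 h3
    · linarith
  have := eq_const_of_circleAverage_norm_sq hR hpd key ht
  rw [dslope_zero_spec φ t, this, dslope_same]

/-- The squared Euclidean norm on `ℂⁿ`. -/
def normSq {n : ℕ} (z : Cn n) : ℝ := ∑ i, ‖z i‖ ^ 2

theorem normSq_nonneg {n : ℕ} (z : Cn n) : 0 ≤ normSq z := by
  unfold normSq; positivity

theorem continuous_normSq {n : ℕ} : Continuous (normSq (n := n)) := by
  unfold normSq; fun_prop

theorem normSq_add_smul {n : ℕ} (z v : Cn n) (t : ℂ) :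
    normSq (z + t • v) = normSq z + 2 * ((∑ i, conj (z i) * v i) * t).re + normSq v * ‖t‖ ^ 2 := by
  simp only [normSq, Finset.sum_mul, Complex.re_sum, Finset.mul_sum, ← Finset.sum_add_distrib]
  refine Finset.sum_congr rfl fun i _ => ?_
  simp only [Pi.add_apply, Pi.smul_apply, smul_eq_mul, ← Complex.normSq_eq_norm_sq]
  rw [Complex.normSq_add, Complex.normSq_mul, map_mul]
  have : (z i * (conj t * conj (v i))).re = (conj (z i) * v i * t).re := by
    simp [Complex.mul_re, Complex.mul_im]; ring
  rw [this]
  ring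

/-- A holomorphic map to a Hilbert space with `‖G z‖² = 1 + ‖z‖²` is affine. -/
theorem eq_affine_of_norm_sq {n : ℕ} {G : Cn n → H} {z₀ : Cn n} {ρ : ℝ}
    (hG : DifferentiableOn ℂ G (Metric.ball z₀ ρ))
    (h : ∀ z ∈ Metric.ball z₀ ρ, ‖G z‖ ^ 2 = 1 + normSq z) {z : Cn n}
    (hz : z ∈ Metric.ball z₀ ρ) : G z = G z₀ + fderiv ℂ G z₀ (z - z₀) := by
  rcases eq_or_ne z z₀ with rfl | hne
  · simp
  set v := z - z₀ with hv
  have hv0 : 0 < ‖v‖ := norm_pos_iff.2 (sub_ne_zero.2 hne)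
  have hvρ : ‖v‖ < ρ := by rwa [mem_ball_iff_norm] at hz
  have hρ : 0 < ρ := hv0.trans hvρ
  have hmem : ∀ t ∈ Metric.ball (0 : ℂ) (ρ / ‖v‖), z₀ + t • v ∈ Metric.ball z₀ ρ := by
    intro t ht
    rw [mem_ball_zero_iff, lt_div_iff₀ hv0] at ht
    rwa [mem_ball_iff_norm, add_sub_cancel_left, norm_smul]
  have hd : DifferentiableOn ℂ (fun t : ℂ => G (z₀ + t • v)) (Metric.ball 0 (ρ / ‖v‖)) :=
    hG.comp (by fun_prop) hmem
  have h1 := eq_affine_of_norm_sq_quadratic (by positivity) hd (A := 1 + normSq z₀)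
    (B := ∑ i, conj (z₀ i) * v i) (D := normSq v) (fun t ht => by
      rw [h _ (hmem t ht), normSq_add_smul]; ring) (t := 1) (by
      rw [mem_ball_zero_iff, norm_one, one_lt_div hv0]; exact hvρ)
  have h2 : deriv (fun t : ℂ => G (z₀ + t • v)) 0 = fderiv ℂ G z₀ v := by
    have hGd : HasFDerivAt G (fderiv ℂ G z₀) (z₀ + (0 : ℂ) • v) := by
      rw [zero_smul, add_zero]
      exact (hG.differentiableAt (Metric.ball_mem_nhds z₀ hρ)).hasFDerivAt
    have hl : HasDerivAt (fun t : ℂ => z₀ + t • v) v 0 := by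
      simpa using ((hasDerivAt_id (0 : ℂ)).smul_const v).const_add z₀
    exact (hGd.comp_hasDerivAt (0 : ℂ) hl).deriv
  rw [h2] at h1
  simpa [hv] using h1

end QuadraticNorm

/-! ### Rigidity of maps between domains with Fubini–Study type kernels -/

section Rigidity

open Filter Topology

variable {n : ℕ}

theorem clm_det_eq (A : Cn n →L[ℂ] Cn n) :
    A.det = Matrix.det (Matrix.of fun i j => A (Pi.single j (1 : ℂ)) i) := by
  rw [ContinuousLinearMap.det, ← LinearMap.det_toMatrix (Pi.basisFun ℂ (Fin n))]
  congr 1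

theorem linear_eq_sum_single {E : Type*} [AddCommGroup E] [Module ℂ E]
    (L : Cn n →ₗ[ℂ] E) (v : Cn n) :
    L v = ∑ j, v j • L (Pi.single j (1 : ℂ)) := by
  conv_lhs => rw [pi_eq_sum_univ' v]
  simp [map_sum]

/-- A linear map which preserves the norm on a neighbourhood of a point preserves the norm. -/
theorem norm_map_eq_of_eventually {H : Type*} [NormedAddCommGroup H] [InnerProductSpace ℂ H]
    (T : H →ₗ[ℂ] H) {ζ : H} (h : ∀ᶠ x in 𝓝 ζ, ‖T x‖ = ‖x‖) (η : H) : ‖T η‖ = ‖η‖ := by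
  have h1 : ∀ᶠ s : ℝ in 𝓝 0, ‖T (ζ + (s : ℂ) • η)‖ = ‖ζ + (s : ℂ) • η‖ := by
    have : Tendsto (fun s : ℝ => ζ + (s : ℂ) • η) (𝓝 0) (𝓝 ζ) := by
      have hc : Continuous (fun s : ℝ => ζ + (s : ℂ) • η) := by fun_prop
      simpa using hc.tendsto 0
    exact this.eventually h
  have h2 : ∀ᶠ s : ℝ in 𝓝 0, ‖T (ζ - (s : ℂ) • η)‖ = ‖ζ - (s : ℂ) • η‖ := by
    have : Tendsto (fun s : ℝ => ζ - (s : ℂ) • η) (𝓝 0) (𝓝 ζ) := by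
      have hc : Continuous (fun s : ℝ => ζ - (s : ℂ) • η) := by fun_prop
      simpa using hc.tendsto 0
    exact this.eventually h
  have h0 := h.self_of_nhds
  obtain ⟨s, ⟨hs1, hs2⟩, hs0⟩ := ((((h1.and h2).filter_mono nhdsWithin_le_nhds).and
    (self_mem_nhdsWithin (s := Ioi (0 : ℝ)))).exists)
  have hs0' : (0 : ℝ) < s := hs0
  -- For small `s` the vectors `ζ ± s η` and `ζ` keep their norms under `T`, so comparing the two
  -- parallelogram laws leaves `s² ‖T η‖² = s² ‖η‖²`.
  have p1 := parallelogram_law_with_norm ℂ ζ ((s : ℂ) • η)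
  have p2 := parallelogram_law_with_norm ℂ (T ζ) ((s : ℂ) • T η)
  rw [← map_smul, ← map_add, ← map_sub, hs1, hs2, h0, map_smul, norm_smul] at p2
  rw [norm_smul] at p1
  have hsn : ‖(s : ℂ)‖ = s := by rw [Complex.norm_real, Real.norm_of_nonneg hs0'.le]
  rw [hsn] at p1 p2
  have h3 : s ^ 2 * (‖T η‖ ^ 2 - ‖η‖ ^ 2) = 0 := by nlinarith
  have h4 : ‖T η‖ ^ 2 = ‖η‖ ^ 2 := by
    rcases mul_eq_zero.1 h3 with h | h
    · exact absurd h (by positivity)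
    · linarith
  exact (pow_left_inj₀ (norm_nonneg _) (norm_nonneg _) two_ne_zero).1 h4

/-- The phase of `κ` makes `κ J` positive at `z₀`, so the principal branch of the root is
holomorphic near `z₀`; the modulus of `κ` remains free and is set by `a`. -/
theorem exists_local_root {J : Cn n → ℂ} {W : Set (Cn n)} (hW : IsOpen W)
    (hJ : DifferentiableOn ℂ J W) {z₀ : Cn n} (hz₀ : z₀ ∈ W) (hJ0 : J z₀ ≠ 0) {m : ℕ}
    (hm : m ≠ 0) {a : ℝ} (ha : 0 < a) :
    ∃ ρ > 0, Metric.ball z₀ ρ ⊆ W ∧ ∃ (g : Cn n → ℂ) (κ : ℂ),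
      DifferentiableOn ℂ g (Metric.ball z₀ ρ) ∧ (∀ z ∈ Metric.ball z₀ ρ, g z ^ m = κ * J z) ∧
      ‖κ‖ ^ 2 = a := by
  have hcont : ContinuousOn (fun z => J z / J z₀) W := hJ.continuousOn.div_const _
  have hopen : IsOpen (W ∩ (fun z => J z / J z₀) ⁻¹' Complex.slitPlane) :=
    hcont.isOpen_inter_preimage hW Complex.isOpen_slitPlane
  obtain ⟨ρ, hρ, hball⟩ := Metric.isOpen_iff.1 hopen z₀ ⟨hz₀, by simp [hJ0]⟩
  have hsub : Metric.ball z₀ ρ ⊆ W := hball.trans inter_subset_left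
  set b : ℝ := Real.sqrt a * ‖J z₀‖ with hb
  have hbpos : 0 < b := by positivity
  refine ⟨ρ, hρ, hsub, fun z => ((b ^ ((m : ℝ)⁻¹) : ℝ) : ℂ) * (J z / J z₀) ^ ((m : ℂ)⁻¹),
    (b : ℂ) / J z₀, ?_, fun z _ => ?_, ?_⟩
  · intro z hz
    refine DifferentiableWithinAt.const_mul ?_ _
    have hs : J z / J z₀ ∈ Complex.slitPlane := (hball hz).2
    have hd : DifferentiableWithinAt ℂ (fun z => J z / J z₀) (Metric.ball z₀ ρ) z := by
      simpa only [div_eq_mul_inv] using ((hJ.mono hsub) z hz).mul_const (J z₀)⁻¹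
    exact hd.cpow_const hs
  · rw [mul_pow, Complex.cpow_nat_inv_pow _ hm, ← Complex.ofReal_pow,
      Real.rpow_inv_natCast_pow hbpos.le hm]
    ring
  · rw [norm_div, Complex.norm_real, Real.norm_of_nonneg hbpos.le, hb,
      mul_div_cancel_right₀ _ (norm_ne_zero_iff.2 hJ0), Real.sq_sqrt ha.le]

/-- The Hermitian space `ℂ ⊕ ℂⁿ`. -/
abbrev ExtSpace (n : ℕ) : Type := EuclideanSpace ℂ (Unit ⊕ Fin n)

/-- The kernel identity makes `(g, gF)` an affine isometric lift of `F`, where `gᵐ = κ J`, and hence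
makes `F` a projective unitary map. The Jacobian of such a map is a multiple of `g^{-(n+1)}` but
also of `gᵐ`, and both can hold only if `g` is constant. -/
theorem rigidity {F : Cn n → Cn n} {W : Set (Cn n)} {C C' : ℝ} {m : ℕ} (hm : m ≠ 0) (hC : 0 < C)
    (hC' : 0 < C') (hW : IsOpen W) (hF : ContDiffOn ℂ ω F W)
    (heq : ∀ z ∈ W, C * (1 + normSq z) ^ m =
      ‖(fderiv ℂ F z).det‖ ^ 2 * (C' * (1 + normSq (F z)) ^ m)) {z₀ : Cn n} (hz₀ : z₀ ∈ W) :
    C = C' ∧ normSq (F z₀) = normSq z₀ := by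
  set J : Cn n → ℂ := fun z => (fderiv ℂ F z).det with hJ
  have hJd : DifferentiableOn ℂ J W := differentiableOn_det_fderiv hW hF
  have hN : ∀ z : Cn n, 0 < 1 + normSq z := fun z => by linarith [normSq_nonneg z]
  have hJ0 : J z₀ ≠ 0 := by
    intro h0
    have h1 := heq z₀ hz₀
    have h2 : ‖(fderiv ℂ F z₀).det‖ = 0 := by simpa [hJ] using h0
    rw [h2] at h1
    have := hN z₀
    have : 0 < C * (1 + normSq z₀) ^ m := by positivity
    simp at h1
    rcases h1 with h1 | h1 <;> simp_all
  obtain ⟨ρ, hρ, hball, g, κ, hgd, hgm, hκ⟩ := exists_local_root hW hJd hz₀ hJ0 hm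
    (a := C' / C) (by positivity)
  have hJne : ∀ z ∈ W, J z ≠ 0 := by
    intro z hz h0
    have h1 := heq z hz
    have h2 : ‖(fderiv ℂ F z).det‖ = 0 := by simpa [hJ] using h0
    rw [h2] at h1
    have := hN z
    have : 0 < C * (1 + normSq z) ^ m := by positivity
    simp at h1
    rcases h1 with h1 | h1 <;> simp_all
  have hκ0 : κ ≠ 0 := by
    rintro rfl
    have : 0 < C' / C := by positivity
    rw [norm_zero, zero_pow two_ne_zero] at hκ
    exact this.ne hκ
  have hg0 : ∀ z ∈ Metric.ball z₀ ρ, g z ≠ 0 := by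
    intro z hz h0
    have := hgm z hz
    rw [h0, zero_pow hm] at this
    exact (mul_ne_zero hκ0 (hJne z (hball hz))) this.symm
  -- The `m`-th root of the kernel identity; the choice `‖κ‖ ^ 2 = C' / C` removes the constants.
  have hnorm : ∀ z ∈ Metric.ball z₀ ρ, ‖g z‖ ^ 2 * (1 + normSq (F z)) = 1 + normSq z := by
    intro z hz
    refine (pow_left_inj₀ (by have := hN (F z); positivity) (hN z).le hm).1 ?_
    have h1 : (‖g z‖ ^ 2) ^ m = C' / C * ‖J z‖ ^ 2 := by
      rw [← pow_mul, mul_comm, pow_mul, ← norm_pow, hgm z hz, norm_mul, mul_pow, hκ]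
    have h2 := heq z (hball hz)
    rw [mul_pow, h1]
    field_simp
    simp only [hJ]
    linarith
  -- the holomorphic map `(g, gF)`
  let G : Cn n → ExtSpace n := fun z => WithLp.toLp 2 (Sum.elim (fun _ => g z) fun i => g z * F z i)
  have hFd : DifferentiableOn ℂ F (Metric.ball z₀ ρ) := (hF.differentiableOn (by simp)).mono hball
  have hGd : DifferentiableOn ℂ G (Metric.ball z₀ ρ) := by
    rw [differentiableOn_euclidean]
    rintro (i | i)
    · exact hgd
    · exact hgd.mul fun z hz => differentiableWithinAt_pi.1 (hFd z hz) i
  have hGn : ∀ z ∈ Metric.ball z₀ ρ, ‖G z‖ ^ 2 = 1 + normSq z := by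
    intro z hz
    rw [EuclideanSpace.norm_sq_eq, Fintype.sum_sum_type, ← hnorm z hz]
    simp only [G, Sum.elim_inl, Sum.elim_inr, norm_mul, mul_pow, Finset.univ_unique,
      Finset.sum_const, Finset.card_singleton, one_smul, normSq, mul_add, mul_one, Finset.mul_sum]
  set L : Cn n →L[ℂ] ExtSpace n := fderiv ℂ G z₀ with hL
  have hGaff : ∀ z ∈ Metric.ball z₀ ρ, G z = G z₀ + L (z - z₀) := fun z hz =>
    eq_affine_of_norm_sq hGd hGn hz
  have hGder : ∀ z ∈ Metric.ball z₀ ρ, HasFDerivAt G L z := by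
    intro z hz
    have h1 : HasFDerivAt (fun w => G z₀ + L (w - z₀)) L z := by
      have : HasFDerivAt (fun w => G z₀ + L (w - z₀)) (L.comp (ContinuousLinearMap.id ℂ (Cn n))) z :=
        (L.hasFDerivAt.comp z ((hasFDerivAt_id z).sub_const z₀)).const_add (G z₀)
      simpa using this
    refine h1.congr_of_eventuallyEq ?_
    filter_upwards [Metric.isOpen_ball.mem_nhds hz] with w hw using hGaff w hw
  -- the linear isometry extending it
  let T : ExtSpace n →ₗ[ℂ] ExtSpace n :=
    { toFun := fun x => x (Sum.inl ()) • (G z₀ - L z₀) + L (fun i => x (Sum.inr i))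
      map_add' := fun x y => by
        have : (fun i => (x + y) (Sum.inr i)) =
            (fun i => x (Sum.inr i)) + fun i => y (Sum.inr i) := rfl
        rw [this, map_add, PiLp.add_apply, add_smul]
        abel
      map_smul' := fun c x => by
        have : (fun i => (c • x) (Sum.inr i)) = c • (fun i => x (Sum.inr i)) := rfl
        rw [this, map_smul, PiLp.smul_apply, smul_eq_mul, mul_smul, RingHom.id_apply, smul_add] }
  have hTapp : ∀ x : ExtSpace n, T x = x (Sum.inl ()) • (G z₀ - L z₀) + L (fun i => x (Sum.inr i)) :=
    fun x => rfl
  have hTG : ∀ z ∈ Metric.ball z₀ ρ, ∀ x : ExtSpace n, x (Sum.inl ()) = 1 → (∀ i, x (Sum.inr i) = z i) →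
      T x = G z := by
    intro z hz x h1 h2
    rw [hTapp, h1, one_smul, hGaff z hz, map_sub]
    have : (fun i => x (Sum.inr i)) = z := funext h2
    rw [this]
    abel
  let ζ : ExtSpace n := WithLp.toLp 2 (Sum.elim (fun _ => 1) z₀)
  -- Vectors near `ζ = (1, z₀)` are multiples of some `(1, z)` with `z` in the ball, and `T (1, z) =
  -- G z` has squared norm `1 + |z|²`.
  have hev : ∀ᶠ x in 𝓝 ζ, ‖T x‖ = ‖x‖ := by
    have hc1 : ContinuousAt (fun x : ExtSpace n => (fun i => x (Sum.inr i) / x (Sum.inl ()) : Cn n)) ζ := by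
      refine continuousAt_pi.2 fun i => ?_
      refine ContinuousAt.div (by fun_prop) (by fun_prop) ?_
      simp [ζ]
    have hc2 : ContinuousAt (fun x : ExtSpace n => x (Sum.inl ())) ζ := by fun_prop
    have e1 : ∀ᶠ x in 𝓝 ζ, (fun i => x (Sum.inr i) / x (Sum.inl ()) : Cn n) ∈
        Metric.ball z₀ ρ := by
      refine hc1.eventually (Metric.isOpen_ball.mem_nhds ?_)
      have : (fun i => ζ (Sum.inr i) / ζ (Sum.inl ()) : Cn n) = z₀ := by
        funext i; simp [ζ]
      simpa only [this] using Metric.mem_ball_self hρ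
    have e2 : ∀ᶠ x in 𝓝 ζ, x (Sum.inl ()) ≠ 0 := hc2.eventually_ne (by simp [ζ])
    filter_upwards [e1, e2] with x hx1 hx2
    set s := x (Sum.inl ()) with hs
    set y : ExtSpace n := s⁻¹ • x with hy
    have hxy : x = s • y := by rw [hy, smul_inv_smul₀ hx2]
    have hy1 : y (Sum.inl ()) = 1 := by
      rw [hy, PiLp.smul_apply, ← hs, smul_eq_mul, inv_mul_cancel₀ hx2]
    have hTy := hTG _ hx1 y hy1 fun i => by
      rw [hy, PiLp.smul_apply, smul_eq_mul, div_eq_inv_mul]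
    have hyn : ‖T y‖ = ‖y‖ := by
      refine (pow_left_inj₀ (norm_nonneg _) (norm_nonneg _) two_ne_zero).1 ?_
      rw [hTy, hGn _ hx1, EuclideanSpace.norm_sq_eq, Fintype.sum_sum_type]
      simp only [Finset.univ_unique, Finset.sum_singleton, normSq]
      have hd : y (Sum.inl default) = 1 := hy1
      rw [hd, norm_one, one_pow]
      congr 1
      refine Finset.sum_congr rfl fun i _ => ?_
      rw [hy, PiLp.smul_apply, smul_eq_mul, div_eq_inv_mul]
    rw [hxy, map_smul, norm_smul, norm_smul, hyn]
  have hTn : ∀ x, ‖T x‖ = ‖x‖ := norm_map_eq_of_eventually T hev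
  let TI : ExtSpace n →ₗᵢ[ℂ] ExtSpace n := ⟨T, hTn⟩
  let A : Matrix (Unit ⊕ Fin n) (Unit ⊕ Fin n) ℂ :=
    Matrix.of fun i j => T (EuclideanSpace.single j (1 : ℂ)) i
  have hAA : A.conjTranspose * A = 1 := by
    ext i j
    have h1 := TI.inner_map_map (EuclideanSpace.single i (1 : ℂ)) (EuclideanSpace.single j (1 : ℂ))
    have h2 : inner ℂ (T (EuclideanSpace.single i (1 : ℂ))) (T (EuclideanSpace.single j (1 : ℂ))) =
        (A.conjTranspose * A) i j := by
      rw [Matrix.mul_apply, PiLp.inner_apply]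
      refine Finset.sum_congr rfl fun k _ => ?_
      simp [A, Matrix.conjTranspose_apply, mul_comm]
    rw [← h2]
    refine h1.trans ?_
    rw [EuclideanSpace.inner_single_left]
    simp [Matrix.one_apply]
  have hAA' : A * A.conjTranspose = 1 := mul_eq_one_comm.1 hAA
  have hdetA : ‖A.det‖ = 1 := by
    have h1 := congrArg Matrix.det hAA
    rw [Matrix.det_mul, Matrix.det_conjTranspose, Matrix.det_one] at h1
    have h2 := congrArg norm h1
    rw [norm_mul, norm_star, norm_one] at h2
    nlinarith [norm_nonneg A.det]
  have hAr : ∀ i j, A i (Sum.inr j) = L (Pi.single j (1 : ℂ)) i := by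
    intro i j
    have h1 : (fun k => (EuclideanSpace.single (Sum.inr j : Unit ⊕ Fin n) (1 : ℂ)) (Sum.inr k)) =
        (Pi.single j (1 : ℂ) : Cn n) := by
      funext k
      simp [Pi.single_apply]
    simp only [A, Matrix.of_apply]
    rw [hTapp, h1]
    simp
  have hAl : ∀ i, A i (Sum.inl ()) = G z₀ i - ∑ j, z₀ j * A i (Sum.inr j) := by
    intro i
    have h1 : (fun k => (EuclideanSpace.single (Sum.inl () : Unit ⊕ Fin n) (1 : ℂ)) (Sum.inr k)) =
        (0 : Cn n) := by
      funext k
      simp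
    simp only [hAr]
    simp only [A, Matrix.of_apply]
    rw [hTapp, h1, linear_eq_sum_single (L : Cn n →ₗ[ℂ] ExtSpace n) z₀ |> fun h => (h : L z₀ = _)]
    simp [WithLp.ofLp_sum, Finset.sum_apply]
  -- the Jacobian determinant
  have hcol : ∀ z ∈ Metric.ball z₀ ρ, ∀ i, A i (Sum.inl ()) + ∑ j, A i (Sum.inr j) * z j = G z i := by
    intro z hz i
    have h1 : L (z - z₀) = ∑ j, (z - z₀) j • L (Pi.single j (1 : ℂ)) :=
      linear_eq_sum_single (L : Cn n →ₗ[ℂ] ExtSpace n) (z - z₀)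
    have h2 : (L (z - z₀)) i = ∑ j, (z j - z₀ j) * A i (Sum.inr j) := by
      rw [h1]
      simp [WithLp.ofLp_sum, Finset.sum_apply, hAr]
    rw [hAl, hGaff z hz, PiLp.add_apply, h2]
    simp only [sub_mul, Finset.sum_sub_distrib, mul_comm]
    ring
  have hgL : ∀ z ∈ Metric.ball z₀ ρ, HasFDerivAt g
      ((EuclideanSpace.proj (Sum.inl ()) : ExtSpace n →L[ℂ] ℂ).comp L) z := fun z hz =>
    ((EuclideanSpace.proj (Sum.inl ()) : ExtSpace n →L[ℂ] ℂ).hasFDerivAt).comp z (hGder z hz)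
  have hFL : ∀ z ∈ Metric.ball z₀ ρ, ∀ i j, A (Sum.inr i) (Sum.inr j) =
      g z * fderiv ℂ F z (Pi.single j (1 : ℂ)) i + F z i * A (Sum.inl ()) (Sum.inr j) := by
    intro z hz i j
    have h1 : HasFDerivAt (fun w => g w * F w i)
        ((EuclideanSpace.proj (Sum.inr i) : ExtSpace n →L[ℂ] ℂ).comp L) z :=
      ((EuclideanSpace.proj (Sum.inr i) : ExtSpace n →L[ℂ] ℂ).hasFDerivAt).comp z (hGder z hz)
    have h2 : HasFDerivAt F (fderiv ℂ F z) z :=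
      ((hFd z hz).differentiableAt (Metric.isOpen_ball.mem_nhds hz)).hasFDerivAt
    have h3 := h1.unique ((hgL z hz).mul (hasFDerivAt_pi'.1 h2 i))
    have h4 := congrArg (fun l : Cn n →L[ℂ] ℂ => l (Pi.single j (1 : ℂ))) h3
    simp only [hAr]
    simpa using h4
  have hJg : ∀ z ∈ Metric.ball z₀ ρ, g z ^ (n + 1) * J z = A.det := by
    intro z hz
    let b : Matrix Unit (Fin n) ℂ := Matrix.of fun _ j => A (Sum.inl ()) (Sum.inr j)
    let Jm : Matrix (Fin n) (Fin n) ℂ := Matrix.of fun i j => fderiv ℂ F z (Pi.single j (1 : ℂ)) i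
    -- The unipotent factor on the left replaces the first column of `A` by `A (1, z) = (g, gF)`.
    -- Splitting off the column `F` leaves a block triangular matrix with diagonal blocks `g` and `g
    -- J`, of determinant `gⁿ⁺¹ det J`.
    have h1 : A * Matrix.fromBlocks 1 0 (Matrix.of fun i (_ : Unit) => z i) 1 =
        Matrix.fromBlocks 1 0 (Matrix.of fun i (_ : Unit) => F z i) 1 *
          Matrix.fromBlocks (Matrix.of fun (_ _ : Unit) => g z) b 0 (g z • Jm) := by
      rw [Matrix.fromBlocks_multiply]
      ext i j
      rw [Matrix.mul_apply, Fintype.sum_sum_type]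
      rcases j with ⟨⟩ | j
      · have h2 := hcol z hz i
        rcases i with ⟨⟩ | i
        · simpa [G] using h2
        · simpa [G, Matrix.mul_apply, mul_comm (F z i)] using h2
      · rcases i with ⟨⟩ | i
        · simp [b, Matrix.one_apply]
        · have h2 := hFL z hz i j
          simp [b, Jm, Matrix.one_apply, Matrix.mul_apply, h2, add_comm]
    have h2 := congrArg Matrix.det h1
    rw [Matrix.det_mul, Matrix.det_mul, Matrix.det_fromBlocks_zero₁₂, Matrix.det_fromBlocks_zero₁₂,
      Matrix.det_fromBlocks_zero₂₁, Matrix.det_smul, ← clm_det_eq] at h2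
    simp only [Matrix.det_one, mul_one, Matrix.det_unique, Matrix.of_apply,
      Fintype.card_fin, Matrix.one_apply_eq, one_mul] at h2
    rw [h2]
    simp only [hJ]
    ring
  -- These entries are the partial derivatives of `g`. They vanish because `g ^ (n + 1 + m) = κ det
  -- A` is constant and `g` has no zeros.
  have hrow : ∀ j, A (Sum.inl ()) (Sum.inr j) = 0 := by
    intro j
    have hz0 : z₀ ∈ Metric.ball z₀ ρ := Metric.mem_ball_self hρ
    have h1 : ∀ z ∈ Metric.ball z₀ ρ, g z ^ (n + 1 + m) = κ * A.det := by
      intro z hz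
      rw [pow_add, hgm z hz, ← hJg z hz]
      ring
    have h2 : HasFDerivAt (fun z => g z ^ (n + 1 + m)) (0 : Cn n →L[ℂ] ℂ) z₀ := by
      refine (hasFDerivAt_const (κ * A.det) z₀).congr_of_eventuallyEq ?_
      filter_upwards [Metric.isOpen_ball.mem_nhds hz0] with w hw using h1 w hw
    have h3 := congrArg (fun l : Cn n →L[ℂ] ℂ => l (Pi.single j (1 : ℂ)))
      (((hgL z₀ hz0).pow (n + 1 + m)).unique h2)
    have h4 : ((n + 1 + m : ℕ) : ℂ) ≠ 0 := Nat.cast_ne_zero.2 (by omega)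
    have h5 : g z₀ ^ (n + 1 + m - 1) ≠ 0 := pow_ne_zero _ (hg0 z₀ hz0)
    rw [hAr]
    simpa [h5, hg0 z₀ hz0, -Nat.cast_add, h4] using h3
  have hz0 : z₀ ∈ Metric.ball z₀ ρ := Metric.mem_ball_self hρ
  -- The first row of the unitary matrix `A` is now `(g z₀, 0, …, 0)`.
  have hg1 : ‖g z₀‖ = 1 := by
    have h1 := congrFun (congrFun hAA' (Sum.inl ())) (Sum.inl ())
    rw [Matrix.mul_apply, Fintype.sum_sum_type] at h1
    simp only [hrow, zero_mul, Finset.sum_const_zero, add_zero, Finset.univ_unique,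
      Finset.sum_singleton, Matrix.conjTranspose_apply, Matrix.one_apply_eq] at h1
    have h2 : A (Sum.inl ()) (Sum.inl ()) = g z₀ := by
      rw [hAl]
      simp [hrow, G]
    have h3 : g z₀ * star (g z₀) = 1 := by rw [← h2]; exact h1
    have h4 := congrArg norm h3
    rw [norm_mul, norm_star, norm_one] at h4
    nlinarith [norm_nonneg (g z₀)]
  have hNF : normSq (F z₀) = normSq z₀ := by
    have := hnorm z₀ hz0
    rw [hg1] at this
    linarith
  refine ⟨?_, hNF⟩
  have h1 := heq z₀ hz₀
  have h2 : ‖J z₀‖ = 1 := by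
    have := congrArg norm (hJg z₀ hz0)
    rwa [norm_mul, norm_pow, hg1, one_pow, one_mul, hdetA] at this
  have h3 : ‖(fderiv ℂ F z₀).det‖ = 1 := h2
  rw [h3, hNF, one_pow, one_mul] at h1
  have := hN z₀
  exact mul_right_cancel₀ (by positivity) h1

end Rigidity

/-! ### Norm preservation as an obstruction to Bergman equivalence -/

section Inequivalence

variable {n m : ℕ} {C C' : ℝ} {Ω Ω' : CDomain n}

theorem BergmanEquiv.exists_normSq_eq (hm : m ≠ 0) (hC : 0 < C) (hC' : 0 < C')
    (hΩ : Ω ∈ FS m n C) (hΩ' : Ω' ∈ FS m n C') (h : BergmanEquiv Ω.toManifold Ω'.toManifold) :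
    C = C' ∧ ∃ (W : Set (Cn n)) (F : Cn n → Cn n), Ω.set ⊆ closure W ∧ MapsTo F W Ω'.set ∧
      ∀ z ∈ W, normSq (F z) = normSq z := by
  obtain ⟨K, hK, hKC⟩ := hΩ
  obtain ⟨K', hK', hKC'⟩ := hΩ'
  obtain ⟨W, F, hW, hWΩ, hcl, hmaps, hF, heq⟩ := BergmanEquiv.exists_map h hK hK'
  have key : ∀ z ∈ W, C * (1 + normSq z) ^ m =
      ‖(fderiv ℂ F z).det‖ ^ 2 * (C' * (1 + normSq (F z)) ^ m) := by
    intro z hz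
    have h1 := heq z hz
    have hp : ∀ w : Cn n, 0 ≤ 1 + normSq w := fun w => by linarith [normSq_nonneg w]
    have e1 : (K z z).re = C * (1 + normSq z) ^ m := by
      rw [hKC z (hWΩ hz), Complex.ofReal_re, normSq]
    have e2 : (K' (F z) (F z)).re = C' * (1 + normSq (F z)) ^ m := by
      rw [hKC' _ (hmaps hz), Complex.ofReal_re, normSq]
    rw [e1, e2, ← ofReal_norm, ← ENNReal.ofReal_pow (norm_nonneg _),
      ← ENNReal.ofReal_mul (by positivity)] at h1
    refine (ENNReal.ofReal_eq_ofReal_iff ?_ ?_).1 h1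
    · have := hp z; positivity
    · have := hp (F z); positivity
  have hne : W.Nonempty := by
    obtain ⟨z, hz⟩ := Ω.nonempty_set
    exact closure_nonempty_iff.1 ⟨z, hcl hz⟩
  obtain ⟨z, hz⟩ := hne
  exact ⟨(rigidity hm hC hC' hW hF key hz).1, W, F, hcl, hmaps, fun w hw =>
    (rigidity hm hC hC' hW hF key hw).2⟩

/-- The map attached to an equivalence preserves the Euclidean norm on a dense set, so it would
carry points near `z₀` into the hole of `Ω'`. -/
theorem not_bergmanEquiv_of_normSq_lt (hm : m ≠ 0) (hC : 0 < C) (hC' : 0 < C')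
    (hΩ : Ω ∈ FS m n C) (hΩ' : Ω' ∈ FS m n C') {a : ℝ} (ha : ∀ z ∈ Ω'.set, a < normSq z)
    {z₀ : Cn n} (hz₀ : z₀ ∈ Ω.set) (hz₀a : normSq z₀ < a) :
    ¬ BergmanEquiv Ω.toManifold Ω'.toManifold := by
  intro h
  obtain ⟨-, W, F, hcl, hmaps, hFn⟩ := h.exists_normSq_eq hm hC hC' hΩ hΩ'
  obtain ⟨w, hwa, hwW⟩ := mem_closure_iff.1 (hcl hz₀) {z | normSq z < a}
    (isOpen_lt continuous_normSq continuous_const) hz₀a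
  have h1 := ha _ (hmaps hwW)
  rw [hFn w hwW] at h1
  exact lt_asymm h1 hwa

end Inequivalence

/-! ### A function on the unit interval whose sublevel sets have prescribed moments -/

section Label

open Polynomial Filter Topology

/-- The Thue–Morse bits balance polynomials of low degree. -/
theorem exists_balanced_bits (D : ℕ) : ∃ b : ℕ → ℝ, (∀ j, b j = 0 ∨ b j = 1) ∧
    ∀ p : ℝ[X], p.degree < D → ∑ j ∈ Finset.range (2 ^ D), (1 - 2 * b j) * p.eval (j : ℝ) = 0 := by
  induction D with
  | zero =>
    refine ⟨fun _ => 0, fun _ => Or.inl rfl, fun p hp => ?_⟩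
    have : p = 0 := by
      rw [← Polynomial.degree_eq_bot]
      simpa [Nat.WithBot.lt_zero_iff] using hp
    simp [this]
  | succ D ih =>
    obtain ⟨b, hb, hbal⟩ := ih
    -- The Thue–Morse recursion: the word is followed by its complement, so the sum becomes that of
    -- `p - p(· + 2 ^ D)` over the shorter word.
    refine ⟨fun j => if j < 2 ^ D then b j else 1 - b (j - 2 ^ D), fun j => ?_, fun p hp => ?_⟩
    · simp only
      split_ifs
      · exact hb j
      · rcases hb (j - 2 ^ D) with h | h <;> rw [h] <;> simp
    · rw [pow_succ, mul_two, Finset.sum_range_add]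
      have h1 : ∀ j ∈ Finset.range (2 ^ D),
          (1 - 2 * (if j < 2 ^ D then b j else 1 - b (j - 2 ^ D))) * p.eval (j : ℝ) =
          (1 - 2 * b j) * p.eval (j : ℝ) := fun j hj => by
        rw [if_pos (Finset.mem_range.1 hj)]
      have h2 : ∀ j ∈ Finset.range (2 ^ D),
          (1 - 2 * (if 2 ^ D + j < 2 ^ D then b (2 ^ D + j) else 1 - b (2 ^ D + j - 2 ^ D))) *
            p.eval ((2 ^ D + j : ℕ) : ℝ) =
          -((1 - 2 * b j) * (taylor ((2 : ℝ) ^ D) p).eval (j : ℝ)) := fun j _ => by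
        rw [if_neg (by omega), Nat.add_sub_cancel_left, taylor_eval]
        push_cast
        rw [add_comm ((2 : ℝ) ^ D)]
        ring
      rw [Finset.sum_congr rfl h1, Finset.sum_congr rfl h2, ← Finset.sum_add_distrib]
      rcases eq_or_ne p 0 with rfl | hp0
      · simp
      -- A translate has the same leading term, so the difference drops in degree.
      have h3 : (p - taylor ((2 : ℝ) ^ D) p).degree < (D : WithBot ℕ) := by
        have h4 : (p - taylor ((2 : ℝ) ^ D) p).degree < p.degree :=
          degree_sub_lt_left (degree_taylor _ _).symm hp0 (leadingCoeff_taylor _ _).symm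
        refine h4.trans_le ?_
        rw [degree_eq_natDegree hp0] at hp ⊢
        exact_mod_cast Nat.lt_succ_iff.1 (by exact_mod_cast hp)
      rw [← hbal _ h3]
      refine Finset.sum_congr rfl fun j _ => ?_
      rw [eval_sub]
      ring

open Classical in
/-- The iterates of a self-similar function: on the `j`-th of `M` cells of the unit interval, the
first binary digit is `b j`. -/
def labelIter (M : ℕ) (b : ℕ → ℝ) : ℕ → ℝ → ℝ
  | 0, _ => 1
  | i + 1, x =>
    if x ∈ Ioo (0 : ℝ) 1 ∧ Int.fract (M * x) ≠ 0 then
      (b ⌊M * x⌋₊ + labelIter M b i (Int.fract (M * x))) / 2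
    else 1

variable {M : ℕ} {b : ℕ → ℝ}

theorem mem_cell_iff (hM : M ≠ 0) {x : ℝ} {j : ℕ} :
    x ∈ Ioo ((j : ℝ) / M) ((j + 1) / M) ↔ (j : ℝ) < M * x ∧ M * x < j + 1 := by
  have : (0 : ℝ) < M := by positivity
  rw [mem_Ioo, div_lt_iff₀' this, lt_div_iff₀' this]

theorem labelIter_succ_of_mem (hM : M ≠ 0) {j : ℕ} (hj : j < M) {x : ℝ}
    (hx : x ∈ Ioo ((j : ℝ) / M) ((j + 1) / M)) (i : ℕ) :
    labelIter M b (i + 1) x = (b j + labelIter M b i (M * x - j)) / 2 := by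
  have hx' := (mem_cell_iff hM).1 hx
  have hM' : (0 : ℝ) < M := by positivity
  have hjM : (j : ℝ) + 1 ≤ M := by exact_mod_cast hj
  have hpos : (0 : ℝ) ≤ j := by positivity
  have hfl : ⌊(M : ℝ) * x⌋₊ = j := (Nat.floor_eq_iff (by linarith)).2 ⟨hx'.1.le, hx'.2⟩
  have hfr : Int.fract ((M : ℝ) * x) = M * x - j := by
    rw [Int.fract_eq_iff]
    exact ⟨by linarith, by linarith, j, by push_cast; ring⟩
  have h01 : x ∈ Ioo (0 : ℝ) 1 := by
    constructor
    · by_contra! h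
      nlinarith
    · by_contra! h
      nlinarith
  rw [labelIter, if_pos ⟨h01, by rw [hfr]; linarith⟩, hfl, hfr]

theorem exists_mem_cell (hM : M ≠ 0) {x : ℝ} (hx : x ∈ Ioo (0 : ℝ) 1)
    (hfr : Int.fract (M * x) ≠ 0) : ∃ j < M, x ∈ Ioo ((j : ℝ) / M) ((j + 1) / M) := by
  have hM' : (0 : ℝ) < M := by positivity
  have h0 : 0 ≤ (M : ℝ) * x := by have := hx.1; positivity
  refine ⟨⌊(M : ℝ) * x⌋₊, ?_, (mem_cell_iff hM).2 ⟨?_, Nat.lt_floor_add_one _⟩⟩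
  · rw [Nat.floor_lt h0]
    nlinarith [hx.2]
  · refine lt_of_le_of_ne (Nat.floor_le h0) fun h => hfr ?_
    rw [Int.fract_eq_iff]
    exact ⟨le_rfl, one_pos, ⌊(M : ℝ) * x⌋₊, by rw [sub_zero]; push_cast; exact h.symm⟩

theorem labelIter_mem_Icc (hb : ∀ j, b j = 0 ∨ b j = 1) (i : ℕ) (x : ℝ) :
    labelIter M b i x ∈ Icc (0 : ℝ) 1 := by
  induction i generalizing x with
  | zero => simp [labelIter]
  | succ i ih =>
    rw [labelIter]
    split_ifs
    · have h1 := ih (Int.fract (M * x))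
      rcases hb ⌊M * x⌋₊ with h | h <;> rw [h] <;> constructor <;> linarith [h1.1, h1.2]
    · simp

theorem labelIter_succ_of_not {x : ℝ} (h : ¬(x ∈ Ioo (0 : ℝ) 1 ∧ Int.fract (M * x) ≠ 0)) (i : ℕ) :
    labelIter M b (i + 1) x = 1 := by
  rw [labelIter, if_neg h]

theorem labelIter_succ_of_fract_ne {x : ℝ} (h : x ∈ Ioo (0 : ℝ) 1 ∧ Int.fract (M * x) ≠ 0) (i : ℕ) :
    labelIter M b (i + 1) x = (b ⌊M * x⌋₊ + labelIter M b i (Int.fract (M * x))) / 2 := by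
  rw [labelIter, if_pos h]

theorem labelIter_succ_le (hb : ∀ j, b j = 0 ∨ b j = 1) (i : ℕ) (x : ℝ) :
    labelIter M b (i + 1) x ≤ labelIter M b i x := by
  induction i generalizing x with
  | zero => exact (labelIter_mem_Icc hb 1 x).2
  | succ i ih =>
    by_cases h : x ∈ Ioo (0 : ℝ) 1 ∧ Int.fract (M * x) ≠ 0
    · rw [labelIter_succ_of_fract_ne h, labelIter_succ_of_fract_ne h]
      linarith [ih (Int.fract (M * x))]
    · rw [labelIter_succ_of_not h, labelIter_succ_of_not h]

theorem antitone_labelIter (hb : ∀ j, b j = 0 ∨ b j = 1) (x : ℝ) :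
    Antitone fun i => labelIter M b i x :=
  antitone_nat_of_succ_le fun i => labelIter_succ_le hb i x

/-- Upper semicontinuity. Inside a cell it is inherited from the previous iterate; at cell
boundaries and outside the interval the default value `1` is the maximum. -/
theorem isOpen_labelIter_lt (hM : M ≠ 0) (hb : ∀ j, b j = 0 ∨ b j = 1) (i : ℕ) (s : ℝ) :
    IsOpen {x | labelIter M b i x < s} := by
  induction i generalizing s with
  | zero => simp only [labelIter]; exact isOpen_const
  | succ i ih =>
    refine isOpen_iff_mem_nhds.2 fun x hx => ?_
    by_cases hc : x ∈ Ioo (0 : ℝ) 1 ∧ Int.fract (M * x) ≠ 0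
    · obtain ⟨j, hj, hxj⟩ := exists_mem_cell hM hc.1 hc.2
      have ho : IsOpen ((fun x : ℝ => M * x - j) ⁻¹' {y | labelIter M b i y < 2 * s - b j}) :=
        (ih _).preimage (by fun_prop)
      rw [mem_ofPred_eq, labelIter_succ_of_mem hM hj hxj] at hx
      filter_upwards [isOpen_Ioo.mem_nhds hxj, ho.mem_nhds (by
        simp only [mem_preimage, mem_ofPred_eq]; linarith)] with y hy1 hy2
      rw [labelIter_succ_of_mem hM hj hy1]
      simp only [mem_preimage, mem_ofPred_eq] at hy2
      linarith
    · rw [mem_ofPred_eq, labelIter, if_neg hc] at hx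
      exact Filter.Eventually.of_forall fun y => (labelIter_mem_Icc hb _ y).2.trans_lt hx

theorem measurable_labelIter (hM : M ≠ 0) (hb : ∀ j, b j = 0 ∨ b j = 1) (i : ℕ) :
    Measurable (labelIter M b i) :=
  measurable_of_Iio fun s => (isOpen_labelIter_lt hM hb i s).measurableSet

/-- The mean of `h` over the multiples of `2⁻ⁱ` in `(0,1]`. -/
def dyadicMean : ℕ → (ℝ → ℝ) → ℝ
  | 0, h => h 1
  | i + 1, h => (dyadicMean i (fun u => h ((0 + u) / 2)) + dyadicMean i (fun u => h ((1 + u) / 2))) / 2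

/-- The first two clauses drive the induction: for `s ≤ 1/2` the upper half contributes `0`, for `s
> 1/2` the lower half contributes `1`. Only one half carries an error, which is therefore halved. -/
theorem dyadicMean_indicator (i : ℕ) (s : ℝ) :
    (s ≤ 0 → dyadicMean i ((Iio s).indicator 1) = 0) ∧
    (1 < s → dyadicMean i ((Iio s).indicator 1) = 1) ∧
    |dyadicMean i ((Iio s).indicator 1) - max 0 (min s 1)| ≤ (1 / 2) ^ i := by
  induction i generalizing s with
  | zero =>
    simp only [dyadicMean, indicator, mem_Iio, Pi.one_apply, pow_zero]
    refine ⟨fun h => if_neg (by linarith), fun h => if_pos h, ?_⟩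
    split_ifs with h
    · rw [min_eq_right h.le]; norm_num
    · rw [min_eq_left (not_lt.1 h), zero_sub, abs_neg, abs_of_nonneg (le_max_left _ _)]
      exact max_le zero_le_one (not_lt.1 h)
  | succ i ih =>
    have e0 : (fun u : ℝ => (Iio s).indicator (1 : ℝ → ℝ) ((0 + u) / 2)) =
        (Iio (2 * s)).indicator 1 := by
      funext u
      have : (0 + u) / 2 ∈ Iio s ↔ u ∈ Iio (2 * s) := by
        simp only [mem_Iio]; constructor <;> intro h <;> linarith
      simp only [indicator, this, Pi.one_apply]
    have e1 : (fun u : ℝ => (Iio s).indicator (1 : ℝ → ℝ) ((1 + u) / 2)) =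
        (Iio (2 * s - 1)).indicator 1 := by
      funext u
      have : (1 + u) / 2 ∈ Iio s ↔ u ∈ Iio (2 * s - 1) := by
        simp only [mem_Iio]; constructor <;> intro h <;> linarith
      simp only [indicator, this, Pi.one_apply]
    rw [dyadicMean, e0, e1]
    obtain ⟨h00, h01, h0⟩ := ih (2 * s)
    obtain ⟨h10, h11, h1⟩ := ih (2 * s - 1)
    refine ⟨fun hs => ?_, fun hs => ?_, ?_⟩
    · rw [h00 (by linarith), h10 (by linarith)]; norm_num
    · rw [h01 (by linarith), h11 (by linarith)]; norm_num
    · rw [abs_le] at h0 h1 ⊢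
      rw [pow_succ]
      rcases le_or_gt (2 * s) 1 with hs | hs
      · have e2 : max 0 (min (2 * s) 1) = 2 * max 0 (min s 1) := by grind
        rw [e2] at h0
        rw [h10 (by linarith)]
        constructor <;> linarith [h0.1, h0.2]
      · have e2 : max 0 (min (2 * s - 1) 1) = 2 * max 0 (min s 1) - 1 := by grind
        rw [e2] at h1
        rw [h01 hs]
        constructor <;> linarith [h1.1, h1.2]

theorem tendsto_dyadicMean_indicator {s : ℝ} (hs : s ∈ Icc (0 : ℝ) 1) :
    Tendsto (fun i => dyadicMean i ((Iio s).indicator 1)) atTop (𝓝 s) := by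
  rw [tendsto_iff_dist_tendsto_zero]
  refine squeeze_zero (fun _ => dist_nonneg) (fun i => ?_)
    (tendsto_pow_atTop_nhds_zero_of_lt_one (r := (1 / 2 : ℝ)) (by norm_num) (by norm_num))
  have := (dyadicMean_indicator i s).2.2
  rwa [min_eq_left hs.2, max_eq_right hs.1] at this

theorem integral_eq_sum_cells (hM : M ≠ 0) {f : ℝ → ℝ} (hf : IntervalIntegrable f volume 0 1) :
    ∫ x in (0 : ℝ)..1, f x = ∑ j ∈ Finset.range M, (M : ℝ)⁻¹ * ∫ y in (0 : ℝ)..1, f ((y + j) / M) := by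
  have hM' : (0 : ℝ) < M := by positivity
  have h1 := intervalIntegral.sum_integral_adjacent_intervals (μ := volume) (f := f)
    (a := fun k : ℕ => (k : ℝ) / M) (n := M) (fun k hk => by
      refine hf.mono_set ?_
      rw [uIcc_of_le zero_le_one, uIcc_of_le (by gcongr; simp)]
      refine Icc_subset_Icc (by positivity) ?_
      rw [div_le_one hM']
      exact_mod_cast hk)
  rw [Nat.cast_zero, zero_div, div_self hM'.ne'] at h1
  rw [← h1]
  refine Finset.sum_congr rfl fun j _ => ?_
  have h2 := intervalIntegral.integral_comp_mul_sub (a := (j : ℝ) / M) (b := ((j + 1 : ℕ) : ℝ) / M)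
    (fun y => f ((y + j) / M)) hM'.ne' (j : ℝ)
  have e1 : (M : ℝ) * (j / M) - j = 0 := by field_simp; ring
  have e2 : (M : ℝ) * (((j + 1 : ℕ) : ℝ) / M) - j = 1 := by push_cast; field_simp; ring
  rw [e1, e2, smul_eq_mul] at h2
  rw [← h2]
  refine intervalIntegral.integral_congr fun x _ => ?_
  simp only [sub_add_cancel]
  rw [mul_div_cancel_left₀ _ hM'.ne']

theorem intervalIntegrable_eval_mul {u : ℝ → ℝ} (hu : Measurable u) (hu1 : ∀ x, |u x| ≤ 1)
    (p : ℝ[X]) : IntervalIntegrable (fun x => p.eval x * u x) volume 0 1 := by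
  have h1 : IntervalIntegrable u volume 0 1 := by
    rw [intervalIntegrable_iff]
    exact Measure.integrableOn_of_bounded (M := 1) (by simp) hu.aestronglyMeasurable
      (Filter.Eventually.of_forall hu1)
  exact h1.continuousOn_mul p.continuous.continuousOn

/-- The values of the label are independent of all polynomials of degree at most `d`. On each cell
the label is a rescaled copy with its first digit prescribed, so the induction hypothesis gives one
of two means; the balance of the digits `b` makes the two occur equally often against `p`. -/
theorem integral_eval_mul_labelIter (hM : M ≠ 0) (hb : ∀ j, b j = 0 ∨ b j = 1) {d : ℕ}
    (hbal : ∀ p : ℝ[X], p.natDegree ≤ d →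
      ∑ j ∈ Finset.range M, (1 - 2 * b j) * p.eval (j : ℝ) = 0) (i : ℕ) {h : ℝ → ℝ}
    (hh : Measurable h) (hh1 : ∀ x, |h x| ≤ 1) {p : ℝ[X]} (hp : p.natDegree ≤ d) :
    ∫ x in (0 : ℝ)..1, p.eval x * h (labelIter M b i x) =
      dyadicMean i h * ∫ x in (0 : ℝ)..1, p.eval x := by
  induction i generalizing h p with
  | zero => simp only [labelIter, dyadicMean, intervalIntegral.integral_mul_const]; ring
  | succ i ih =>
    have hM' : (0 : ℝ) < M := by positivity
    rw [integral_eq_sum_cells hM (intervalIntegrable_eval_mul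
      (u := fun x => h (labelIter M b (i + 1) x))
      (hh.comp (measurable_labelIter hM hb (i + 1))) (fun _ => hh1 _) p)]
    let q : ℕ → ℝ[X] := fun j => p.comp (C (M : ℝ)⁻¹ * (X + C (j : ℝ)))
    have hq : ∀ j, (q j).natDegree ≤ d := fun j => by
      refine natDegree_comp_le.trans ?_
      have : (C (M : ℝ)⁻¹ * (X + C (j : ℝ))).natDegree ≤ 1 :=
        (natDegree_C_mul_le _ _).trans (natDegree_X_add_C _).le
      nlinarith
    have hqe : ∀ j y, (q j).eval y = p.eval ((y + j) / M) := fun j y => by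
      simp only [q, eval_comp, eval_mul, eval_C, eval_add, eval_X]
      congr 1
      field_simp
    -- The mean on the `j`-th cell is the overall mean plus half the difference of the two means
    -- with sign `1 - 2 * b j`.
    have h1 : ∀ j ∈ Finset.range M, (M : ℝ)⁻¹ * ∫ y in (0 : ℝ)..1,
        p.eval ((y + j) / M) * h (labelIter M b (i + 1) ((y + j) / M)) =
        dyadicMean (i + 1) h * ((M : ℝ)⁻¹ * ∫ y in (0 : ℝ)..1, p.eval ((y + j) / M)) +
        (dyadicMean i (fun u => h ((0 + u) / 2)) - dyadicMean i (fun u => h ((1 + u) / 2))) / 2 *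
          (M : ℝ)⁻¹ * ((1 - 2 * b j) * ∫ y in (0 : ℝ)..1, p.eval ((y + j) / M)) := by
      intro j hj
      have h2 : ∫ y in (0 : ℝ)..1, p.eval ((y + j) / M) * h (labelIter M b (i + 1) ((y + j) / M)) =
          ∫ y in (0 : ℝ)..1, (q j).eval y * (fun u => h ((b j + u) / 2)) (labelIter M b i y) := by
        refine intervalIntegral.integral_congr_Ioo_of_le zero_le_one fun y hy => ?_
        have hmem : (y + j) / M ∈ Ioo ((j : ℝ) / M) ((j + 1) / M) := by
          rw [mem_cell_iff hM, mul_div_cancel₀ _ hM'.ne']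
          constructor <;> linarith [hy.1, hy.2]
        simp only
        rw [labelIter_succ_of_mem hM (Finset.mem_range.1 hj) hmem, hqe,
          mul_div_cancel₀ _ hM'.ne', add_sub_cancel_right]
      rw [h2, ih (h := fun u => h ((b j + u) / 2)) (by fun_prop) (fun _ => hh1 _) (hq j)]
      simp only [hqe, dyadicMean]
      rcases hb j with h | h <;> rw [h] <;> ring
    rw [Finset.sum_congr rfl h1, Finset.sum_add_distrib, ← Finset.mul_sum,
      ← integral_eq_sum_cells hM (p.continuous.intervalIntegrable _ _), ← Finset.mul_sum]
    -- For fixed `y` the integrand is a polynomial in `j` of degree at most `d`, so the balance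
    -- condition applies pointwise in `y`.
    have h3 : ∑ j ∈ Finset.range M, (1 - 2 * b j) * ∫ y in (0 : ℝ)..1, p.eval ((y + j) / M) = 0 := by
      simp only [← intervalIntegral.integral_const_mul]
      rw [← intervalIntegral.integral_finsetSum]
      · rw [intervalIntegral.integral_congr (g := fun _ => 0) fun y _ => ?_]
        · simp
        · let r : ℝ[X] := p.comp (C (M : ℝ)⁻¹ * (X + C y))
          have hr : r.natDegree ≤ d := by
            refine natDegree_comp_le.trans ?_
            have : (C (M : ℝ)⁻¹ * (X + C y)).natDegree ≤ 1 :=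
              (natDegree_C_mul_le _ _).trans (natDegree_X_add_C _).le
            nlinarith
          simp only
          rw [← hbal r hr]
          refine Finset.sum_congr rfl fun j _ => ?_
          simp only [r, eval_comp, eval_mul, eval_C, eval_add, eval_X]
          congr 2
          field_simp
          ring
      · intro j _
        exact Continuous.intervalIntegrable (by fun_prop) _ _
    rw [h3]
    ring

/-- There is an upper semicontinuous function on the line whose sublevel sets in the unit interval
are equidistributed with respect to all polynomials of bounded degree. -/
theorem exists_label (d : ℕ) : ∃ lam : ℝ → ℝ, (∀ s, IsOpen {x | lam x < s}) ∧
    ∀ s ∈ Icc (0 : ℝ) 1, ∀ p : ℝ[X], p.natDegree ≤ d →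
      ∫ x in Ioo 0 1 ∩ {x | lam x < s}, p.eval x = s * ∫ x in (0 : ℝ)..1, p.eval x := by
  obtain ⟨b, hb, hbal⟩ := exists_balanced_bits (d + 1)
  set M : ℕ := 2 ^ (d + 1) with hMdef
  have hM : M ≠ 0 := by positivity
  have hbdd : ∀ x, BddBelow (range fun i => labelIter M b i x) := fun x =>
    ⟨0, by rintro _ ⟨i, rfl⟩; exact (labelIter_mem_Icc hb i x).1⟩
  -- Since the iterates decrease, the sublevel sets of the limit are increasing unions of theirs.
  -- This gives both openness and convergence of the integrals.
  have hlt : ∀ s, {x | ⨅ i, labelIter M b i x < s} = ⋃ i, {x | labelIter M b i x < s} := by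
    intro s
    ext x
    rw [mem_iUnion]
    exact ⟨fun h => exists_lt_of_ciInf_lt (mem_ofPred_eq ▸ h), fun ⟨i, hi⟩ => (ciInf_le (hbdd x) i).trans_lt hi⟩
  refine ⟨fun x => ⨅ i, labelIter M b i x, fun s => ?_, fun s hs p hp => ?_⟩
  · rw [hlt]
    exact isOpen_iUnion fun i => isOpen_labelIter_lt hM hb i s
  · rw [hlt, inter_iUnion]
    have hms : ∀ i, MeasurableSet {x | labelIter M b i x < s} := fun i =>
      (isOpen_labelIter_lt hM hb i s).measurableSet
    have h1 := tendsto_setIntegral_of_monotone (μ := volume) (f := fun x => p.eval x)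
      (s := fun i => Ioo (0 : ℝ) 1 ∩ {x | labelIter M b i x < s})
      (fun i => measurableSet_Ioo.inter (hms i))
      (fun i j hij => inter_subset_inter_right _ fun x hx =>
        (antitone_labelIter hb x hij).trans_lt hx)
      ((p.continuous.continuousOn.integrableOn_Icc (a := 0) (b := 1)).mono_set
        (iUnion_subset fun i => inter_subset_left.trans Ioo_subset_Icc_self))
    refine tendsto_nhds_unique h1 ?_
    have h2 : ∀ i, ∫ x in Ioo 0 1 ∩ {x | labelIter M b i x < s}, p.eval x =
        dyadicMean i ((Iio s).indicator 1) * ∫ x in (0 : ℝ)..1, p.eval x := by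
      intro i
      rw [← integral_eval_mul_labelIter hM hb (d := d) (fun p hp => hbal p ?_) i
        (measurable_one.indicator measurableSet_Iio) (fun x => ?_) hp,
        intervalIntegral.integral_of_le zero_le_one, integral_Ioc_eq_integral_Ioo,
        ← setIntegral_indicator (hms i)]
      · refine setIntegral_congr_fun measurableSet_Ioo fun x _ => ?_
        simp only [indicator, mem_ofPred_eq, mem_Iio, Pi.one_apply]
        split_ifs <;> simp
      · exact (degree_le_natDegree.trans (Nat.cast_le.2 hp)).trans_lt
          (Nat.cast_lt.2 d.lt_succ_self)
      · simp only [indicator]; split_ifs <;> simp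
    simp only [h2]
    exact (tendsto_dyadicMean_indicator hs).mul_const _

end Label

/-! ### Beta integrals -/

section Beta

open Nat

theorem integral_pow_mul_one_sub_pow (p q : ℕ) :
    ∫ x in (0 : ℝ)..1, x ^ p * (1 - x) ^ q = (p ! * q ! : ℝ) / (p + q + 1)! := by
  induction q generalizing p with
  | zero =>
    simp only [pow_zero, mul_one, integral_pow, factorial_zero, add_zero, factorial_succ]
    have : (p ! : ℝ) ≠ 0 := by positivity
    push_cast
    field_simp
    simp
  | succ q ih =>
    -- Integration by parts: this primitive vanishes at both ends.
    have h1 : ∀ x ∈ uIcc (0 : ℝ) 1, HasDerivAt (fun x : ℝ => x ^ (p + 1) * (1 - x) ^ (q + 1))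
        ((p + 1) * (x ^ p * (1 - x) ^ (q + 1)) - (q + 1) * (x ^ (p + 1) * (1 - x) ^ q)) x := by
      intro x _
      have h2 : HasDerivAt (fun x : ℝ => x ^ (p + 1)) ((p + 1 : ℕ) * x ^ p) x := hasDerivAt_pow _ _
      have h3 : HasDerivAt (fun x : ℝ => (1 - x) ^ (q + 1)) ((q + 1 : ℕ) * (1 - x) ^ q * (-1)) x := by
        simpa using ((hasDerivAt_id x).const_sub 1).fun_pow (q + 1)
      refine (h2.fun_mul h3).congr_deriv ?_
      push_cast
      ring
    have h4 := intervalIntegral.integral_eq_sub_of_hasDerivAt h1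
      (Continuous.intervalIntegrable (by fun_prop) _ _)
    rw [intervalIntegral.integral_sub (Continuous.intervalIntegrable (by fun_prop) _ _)
      (Continuous.intervalIntegrable (by fun_prop) _ _), intervalIntegral.integral_const_mul,
      intervalIntegral.integral_const_mul, ih] at h4
    simp only [one_pow, sub_self, ne_eq, add_eq_zero, one_ne_zero, and_false, not_false_eq_true,
      zero_pow, mul_zero, zero_mul] at h4
    have h5 : ((p : ℝ) + 1) ≠ 0 := by positivity
    refine mul_left_cancel₀ h5 ?_
    rw [sub_eq_zero.1 h4, show p + (q + 1) + 1 = p + 1 + q + 1 by ring, factorial_succ p,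
      factorial_succ q]
    push_cast
    ring

theorem image_div_one_add : (fun t : ℝ => t / (1 + t)) '' Ioi 0 = Ioo 0 1 := by
  ext x
  simp only [mem_image, mem_Ioi, mem_Ioo]
  constructor
  · rintro ⟨t, ht, rfl⟩
    exact ⟨by positivity, by rw [div_lt_one (by positivity)]; linarith⟩
  · rintro ⟨h0, h1⟩
    have : 1 - x ≠ 0 := by linarith
    refine ⟨x / (1 - x), div_pos h0 (by linarith), ?_⟩
    field_simp
    ring

/-- The substitution `x = t / (1 + t)` turns the integral into the beta integral on `(0,1)`. -/
theorem integrableOn_pow_div_one_add_pow (p q : ℕ) :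
    IntegrableOn (fun t : ℝ => t ^ p / (1 + t) ^ (p + q + 2)) (Ioi 0) ∧
    ∫ t in Ioi (0 : ℝ), t ^ p / (1 + t) ^ (p + q + 2) = (p ! * q ! : ℝ) / (p + q + 1)! := by
  have hder : ∀ t ∈ Ioi (0 : ℝ), HasDerivWithinAt (fun t : ℝ => t / (1 + t)) (1 / (1 + t) ^ 2)
      (Ioi 0) t := by
    intro t ht
    have ht' : 0 < t := ht
    have h1 := ((hasDerivAt_id t).div ((hasDerivAt_id t).const_add 1)
      (by simp only [id]; positivity)).hasDerivWithinAt (s := Ioi 0)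
    refine h1.congr_deriv ?_
    simp
  have hinj : InjOn (fun t : ℝ => t / (1 + t)) (Ioi 0) := by
    intro s hs t ht hst
    have hs' : 0 < s := hs
    have ht' : 0 < t := ht
    simp only at hst
    field_simp at hst
    linarith
  have hfun : EqOn (fun t : ℝ => |1 / (1 + t) ^ 2| • ((t / (1 + t)) ^ p * (1 - t / (1 + t)) ^ q))
      (fun t : ℝ => t ^ p / (1 + t) ^ (p + q + 2)) (Ioi 0) := by
    intro t ht
    have ht' : 0 < t := ht
    have h1 : 1 - t / (1 + t) = 1 / (1 + t) := by field_simp; ring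
    simp only
    rw [abs_of_pos (by positivity), h1, smul_eq_mul, div_pow, div_pow, pow_add, pow_add, one_pow]
    field_simp
  have h1 := integrableOn_image_iff_integrableOn_abs_deriv_smul measurableSet_Ioi hder hinj
    (fun x => x ^ p * (1 - x) ^ q)
  have h2 := integral_image_eq_integral_abs_deriv_smul measurableSet_Ioi hder hinj
    (fun x => x ^ p * (1 - x) ^ q)
  rw [image_div_one_add] at h1 h2
  rw [integrableOn_congr_fun hfun measurableSet_Ioi] at h1
  rw [setIntegral_congr_fun measurableSet_Ioi hfun, ← integral_Ioc_eq_integral_Ioo,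
    ← intervalIntegral.integral_of_le zero_le_one, integral_pow_mul_one_sub_pow] at h2
  refine ⟨h1.1 ?_, h2.symm⟩
  refine IntegrableOn.mono_set (t := Icc 0 1) ?_ Ioo_subset_Icc_self
  exact ContinuousOn.integrableOn_Icc (by fun_prop)

end Beta

/-! ### Radial profiles with prescribed moments -/

section Profile

open Polynomial

/-- The polynomials `(t - 1) (2 - t) tⁱ`. -/
def bumpPoly (i : ℕ) : ℝ[X] := (X - 1) * (2 - X) * X ^ i

theorem eval_bumpPoly (i : ℕ) (t : ℝ) : (bumpPoly i).eval t = (t - 1) * (2 - t) * t ^ i := by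
  simp [bumpPoly]

theorem exists_bumpPoly_bound (m : ℕ) : ∃ B : ℝ, 0 < B ∧ ∀ i : Fin (m + 1), ∀ t ∈ Icc (1 : ℝ) 2,
    |(bumpPoly i).eval t| ≤ B ∧ |(derivative (bumpPoly i)).eval t| ≤ B := by
  have h1 : ∀ p : ℝ[X], ∃ B : ℝ, ∀ t ∈ Icc (1 : ℝ) 2, |p.eval t| ≤ B := fun p =>
    isCompact_Icc.exists_bound_of_continuousOn p.continuous.continuousOn
  choose B hB using h1
  refine ⟨1 + ∑ i : Fin (m + 1), (|B (bumpPoly i)| + |B (derivative (bumpPoly i))|), by positivity,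
    fun i t ht => ?_⟩
  have h2 : |B (bumpPoly i)| + |B (derivative (bumpPoly i))| ≤
      ∑ i : Fin (m + 1), (|B (bumpPoly i)| + |B (derivative (bumpPoly i))|) :=
    Finset.single_le_sum (f := fun i : Fin (m + 1) =>
      |B (bumpPoly i)| + |B (derivative (bumpPoly i))|) (fun i _ => by positivity)
      (Finset.mem_univ i)
  have h3 := hB (bumpPoly i) t ht
  have h4 := hB (derivative (bumpPoly i)) t ht
  have h5 := le_abs_self (B (bumpPoly i))
  have h6 := le_abs_self (B (derivative (bumpPoly i)))
  have h7 := abs_nonneg (B (bumpPoly i))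
  have h8 := abs_nonneg (B (derivative (bumpPoly i)))
  constructor <;> linarith

/-- Linear combinations of the polynomials `bumpPoly i`. -/
def bumpSum {m : ℕ} (v : Fin (m + 1) → ℝ) : ℝ[X] := ∑ i, C (v i) * bumpPoly i

theorem eval_bumpSum {m : ℕ} (v : Fin (m + 1) → ℝ) (t : ℝ) :
    (bumpSum v).eval t = ∑ i, v i * (bumpPoly i).eval t := by
  simp [bumpSum, eval_finsetSum]

/-- The moment matrix is invertible: its quadratic form is `∫ tᵉ (t - 1)(2 - t) p(t)²` with `p = ∑
vᵢ tⁱ`, which vanishes only for `p = 0`. The constant `K` bounds the inverse. -/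
theorem exists_bumpSum_moments (m e : ℕ) : ∃ K : ℝ, 0 < K ∧ ∀ ρ : Fin (m + 1) → ℝ,
    ∃ v : Fin (m + 1) → ℝ, (∀ k : Fin (m + 1),
      ∫ t in (1 : ℝ)..2, t ^ ((k : ℕ) + e) * (bumpSum v).eval t = ρ k) ∧
      ∀ i, |v i| ≤ K * ‖ρ‖ := by
  let A : Matrix (Fin (m + 1)) (Fin (m + 1)) ℝ := Matrix.of fun k i =>
    ∫ t in (1 : ℝ)..2, t ^ ((k : ℕ) + e) * (bumpPoly i).eval t
  have hA : ∀ v k, A.mulVec v k = ∫ t in (1 : ℝ)..2, t ^ ((k : ℕ) + e) * (bumpSum v).eval t := by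
    intro v k
    simp only [Matrix.mulVec, dotProduct, A, Matrix.of_apply, eval_bumpSum, Finset.mul_sum]
    rw [intervalIntegral.integral_finsetSum
      (fun i _ => Continuous.intervalIntegrable (by fun_prop) _ _)]
    refine Finset.sum_congr rfl fun i _ => ?_
    rw [← intervalIntegral.integral_mul_const]
    exact intervalIntegral.integral_congr fun t _ => by ring
  have hinj : Function.Injective A.mulVecLin := by
    rw [← LinearMap.ker_eq_bot, LinearMap.ker_eq_bot']
    intro v hv
    let p : ℝ[X] := ∑ i : Fin (m + 1), C (v i) * X ^ (i : ℕ)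
    have hpe : ∀ t, p.eval t = ∑ i : Fin (m + 1), v i * t ^ (i : ℕ) := fun t => by
      simp [p, eval_finsetSum]
    have hint : ∫ t in (1 : ℝ)..2, t ^ e * ((t - 1) * (2 - t)) * p.eval t ^ 2 = 0 := by
      have h1 : ∑ k, v k * A.mulVec v k = 0 := by
        refine Finset.sum_eq_zero fun k _ => ?_
        have := congrFun hv k
        rw [Matrix.mulVecLin_apply] at this
        rw [this, Pi.zero_apply, mul_zero]
      rw [← h1]
      simp only [hA, ← intervalIntegral.integral_const_mul]
      rw [← intervalIntegral.integral_finsetSum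
        (fun i _ => Continuous.intervalIntegrable (by fun_prop) _ _)]
      refine intervalIntegral.integral_congr fun t _ => ?_
      have h2 : (bumpSum v).eval t = (t - 1) * (2 - t) * p.eval t := by
        rw [eval_bumpSum, hpe, Finset.mul_sum]
        exact Finset.sum_congr rfl fun i _ => by rw [eval_bumpPoly]; ring
      rw [h2, sq]
      nth_rw 1 [hpe]
      rw [Finset.sum_mul, Finset.mul_sum]
      exact Finset.sum_congr rfl fun i _ => by rw [pow_add]; ring
    have hroot : ∀ t ∈ Ioo (1 : ℝ) 2, p.eval t = 0 := by
      intro t ht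
      by_contra hne
      have hpos : 0 < ∫ t in (1 : ℝ)..2, t ^ e * ((t - 1) * (2 - t)) * p.eval t ^ 2 := by
        refine intervalIntegral.integral_pos (by norm_num) (by fun_prop) (fun s hs => ?_)
          ⟨t, Ioo_subset_Icc_self ht, ?_⟩
        · have h1 : 0 ≤ s - 1 := by linarith [hs.1]
          have h2 : 0 ≤ 2 - s := by linarith [hs.2]
          have h3 : 0 ≤ s := by linarith
          positivity
        · have h1 : 0 < t - 1 := by linarith [ht.1]
          have h2 : 0 < 2 - t := by linarith [ht.2]
          have h3 : 0 < t := by linarith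
          positivity
      exact hpos.ne' hint
    have hp0 : p = 0 := eq_zero_of_infinite_isRoot p
      ((Ioo_infinite (by norm_num : (1 : ℝ) < 2)).mono fun t ht => hroot t ht)
    funext k
    have h1 := congrArg (fun q : ℝ[X] => q.coeff k) hp0
    simpa [p, finsetSum_coeff, coeff_C_mul, coeff_X_pow, Fin.val_inj] using h1
  let L : (Fin (m + 1) → ℝ) ≃L[ℝ] (Fin (m + 1) → ℝ) :=
    (LinearEquiv.ofInjectiveEndo A.mulVecLin hinj).toContinuousLinearEquiv
  refine ⟨‖(L.symm : (Fin (m + 1) → ℝ) →L[ℝ] (Fin (m + 1) → ℝ))‖ + 1, by positivity, fun ρ =>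
    ⟨L.symm ρ, fun k => ?_, fun i => ?_⟩⟩
  · rw [← hA]
    have h1 : L (L.symm ρ) = ρ := L.apply_symm_apply ρ
    exact congrFun h1 k
  · have h1 := (L.symm : (Fin (m + 1) → ℝ) →L[ℝ] (Fin (m + 1) → ℝ)).le_opNorm ρ
    have h2 := norm_le_pi_norm (L.symm ρ) i
    rw [Real.norm_eq_abs] at h2
    refine h2.trans (h1.trans ?_)
    gcongr
    linarith

open scoped Nat in
/-- Radial profiles: the function `t ↦ c (1 + t)^{-(e+m+2)}` can be modified, on `(0,b)` and on
`(1,2)`, to a function which is `0` on `(0,a)` and `1` on `(a,b)`, with the same moments. -/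
theorem exists_profile (m e : ℕ) {c : ℝ} (hc : 0 < c) (hc2 : c < 1 / 2) : ∃ a₀ : ℝ, 0 < a₀ ∧
    ∀ μ ∈ Ioo (0 : ℝ) 1, ∃ (b : ℝ) (θ : ℝ → ℝ), a₀ * μ < b ∧ b < 1 ∧ Continuous θ ∧
      AntitoneOn θ (Ioi 0) ∧ (∀ t, 0 < t → 0 < θ t ∧ θ t ≤ 1) ∧
      (∀ t, 2 ≤ t → θ t = c / (1 + t) ^ (e + m + 2)) ∧
      ∀ k ≤ m, IntegrableOn (fun t => t ^ (k + e) * θ t) (Ioi b) ∧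
        (∫ t in (a₀ * μ)..b, t ^ (k + e)) + ∫ t in Ioi b, t ^ (k + e) * θ t =
          c * (((k + e)! * (m - k)! : ℝ) / (e + m + 1)!) := by
  obtain ⟨B, hB0, hB⟩ := exists_bumpPoly_bound m
  obtain ⟨K, hK0, hK⟩ := exists_bumpSum_moments m e
  set N : ℕ := e + m + 2 with hN
  -- On `[1,2]` both `(1 + t)^{-N}` and the absolute value of its derivative are at least `κ`. A
  -- bump bounded by `κ / 2` together with its derivative keeps positivity and monotonicity.
  set κ : ℝ := 1 / 3 ^ (N + 1) with hκ
  have hκ0 : 0 < κ := by positivity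
  have hκ1 : κ ≤ 1 := by
    rw [hκ, div_le_one (by positivity)]
    exact one_le_pow₀ (by norm_num)
  -- A moment defect of size `ε` is corrected by `m + 1` coefficients of size at most `K * ε`, hence
  -- by a bump of size at most `κ / 2`.
  set ε : ℝ := min 1 (κ / (2 * ((m + 1) * (K * B)))) with hε
  have hε0 : 0 < ε := by positivity
  have hε1 : ε ≤ 1 := min_le_left _ _
  have hεK : (m + 1) * (K * ε * B) ≤ κ / 2 := by
    have h1 : ε ≤ κ / (2 * ((m + 1) * (K * B))) := min_le_right _ _
    rw [le_div_iff₀ (by positivity)] at h1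
    linarith
  refine ⟨ε / 4, by positivity, fun μ hμ => ?_⟩
  set a : ℝ := ε / 4 * μ with ha
  have ha0 : 0 < a := mul_pos (by positivity) hμ.1
  have ha1 : a < ε / 4 := by
    have := hμ.2
    nlinarith
  -- The width is proportional to `c`, because the density `1` on `(a,b)` is divided by `c` in the
  -- defect.
  set b : ℝ := a + c * ε / 4 with hb
  have hab : a < b := by
    have : 0 < c * ε / 4 := by positivity
    linarith
  have hb1 : b < ε / 2 := by nlinarith
  set G : ℝ → ℝ := fun t => 1 / (1 + |t|) ^ N with hG
  have hGc : Continuous G := by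
    refine continuous_const.div (by fun_prop) fun t => ?_
    positivity
  have hG1 : ∀ t, 0 < G t ∧ G t ≤ 1 := by
    intro t
    refine ⟨by positivity, ?_⟩
    simp only [hG]
    rw [div_le_one (by positivity)]
    exact one_le_pow₀ (by linarith [abs_nonneg t])
  have hGeq : ∀ t, 0 < t → G t = 1 / (1 + t) ^ N := fun t ht => by simp only [hG, abs_of_pos ht]
  have hGanti : ∀ s t, 0 < s → s ≤ t → G t ≤ G s := by
    intro s t hs hst
    rw [hGeq s hs, hGeq t (hs.trans_le hst)]
    gcongr
  -- The moments lost on `(0,b)` minus those put back by the full shell, in units of `c`.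
  let ρ : Fin (m + 1) → ℝ := fun k =>
    (∫ t in (0 : ℝ)..b, t ^ ((k : ℕ) + e) * G t) - (∫ t in a..b, t ^ ((k : ℕ) + e)) / c
  have hρ : ‖ρ‖ ≤ ε := by
    rw [pi_norm_le_iff_of_nonneg hε0.le]
    intro k
    have h1 : ‖∫ t in (0 : ℝ)..b, t ^ ((k : ℕ) + e) * G t‖ ≤ 1 * |b - 0| := by
      refine intervalIntegral.norm_integral_le_of_norm_le_const fun t ht => ?_
      rw [uIoc_of_le (by linarith)] at ht
      rw [norm_mul, norm_pow, Real.norm_of_nonneg ht.1.le, Real.norm_of_nonneg (hG1 t).1.le]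
      exact mul_le_one₀ (pow_le_one₀ ht.1.le (by linarith [ht.2])) (hG1 t).1.le (hG1 t).2
    have h2 : ‖∫ t in a..b, t ^ ((k : ℕ) + e)‖ ≤ 1 * |b - a| := by
      refine intervalIntegral.norm_integral_le_of_norm_le_const fun t ht => ?_
      rw [uIoc_of_le hab.le] at ht
      have h0 : 0 < t := ha0.trans ht.1
      rw [norm_pow, Real.norm_of_nonneg h0.le]
      exact pow_le_one₀ h0.le (by linarith [ht.2])
    rw [one_mul, sub_zero, abs_of_pos (ha0.trans hab)] at h1
    rw [one_mul, abs_of_pos (sub_pos.2 hab)] at h2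
    refine (norm_sub_le _ _).trans ?_
    rw [norm_div, Real.norm_of_nonneg hc.le]
    have h3 : ‖∫ t in a..b, t ^ ((k : ℕ) + e)‖ / c ≤ ε / 4 := by
      rw [div_le_iff₀ hc]
      linarith
    linarith
  obtain ⟨v, hv, hvb⟩ := hK ρ
  have hvb' : ∀ i, |v i| ≤ K * ε := fun i => (hvb i).trans (by gcongr)
  set P : ℝ[X] := bumpSum v with hP
  have hsum : ∀ f : Fin (m + 1) → ℝ, (∀ i, |f i| ≤ B) → |∑ i, v i * f i| ≤ κ / 2 := by
    intro f hf
    refine (Finset.abs_sum_le_sum_abs _ _).trans (le_trans (Finset.sum_le_card_nsmul _ _ (K * ε * B)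
      fun i _ => ?_) ?_)
    · rw [abs_mul]
      exact mul_le_mul (hvb' i) (hf i) (abs_nonneg _) (by positivity)
    · simpa using hεK
  have hPb : ∀ t ∈ Icc (1 : ℝ) 2, |P.eval t| ≤ κ / 2 := fun t ht => by
    rw [hP, eval_bumpSum]
    exact hsum _ fun i => (hB i t ht).1
  have hPd : ∀ t ∈ Icc (1 : ℝ) 2, |(derivative P).eval t| ≤ κ / 2 := fun t ht => by
    have h1 : (derivative P).eval t = ∑ i, v i * (derivative (bumpPoly i)).eval t := by
      simp [hP, bumpSum, eval_finsetSum]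
    rw [h1]
    exact hsum _ fun i => (hB i t ht).2
  have hP1 : P.eval 1 = 0 := by simp [hP, eval_bumpSum, eval_bumpPoly]
  have hP2 : P.eval 2 = 0 := by simp [hP, eval_bumpSum, eval_bumpPoly]
  have hanti12 : AntitoneOn (fun t => 1 / (1 + t) ^ N + P.eval t) (Icc 1 2) := by
    have hd : ∀ t ∈ Icc (1 : ℝ) 2, HasDerivAt (fun t => 1 / (1 + t) ^ N + P.eval t)
        (-(N * (1 + t) ^ (N - 1)) / ((1 + t) ^ N) ^ 2 + (derivative P).eval t) t := by
      intro t ht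
      have h0 : (0 : ℝ) < 1 + t := by linarith [ht.1]
      have h1 : HasDerivAt (fun t : ℝ => (1 + t) ^ N) (N * (1 + t) ^ (N - 1)) t := by
        simpa using ((hasDerivAt_id t).const_add 1).fun_pow N
      simpa [one_div] using (h1.fun_inv (by positivity)).fun_add (P.hasDerivAt t)
    refine antitoneOn_of_deriv_nonpos (convex_Icc _ _) (fun t ht =>
      (hd t ht).continuousAt.continuousWithinAt) (fun t ht => ?_) (fun t ht => ?_)
    · exact (hd t (interior_subset ht)).differentiableAt.differentiableWithinAt
    · have ht' := interior_subset ht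
      rw [(hd t ht').deriv]
      have h0 : (0 : ℝ) < 1 + t := by linarith [ht'.1]
      have h1 := (abs_le.1 (hPd t ht')).2
      have h2 : κ ≤ N * (1 + t) ^ (N - 1) / ((1 + t) ^ N) ^ 2 := by
        have h3 : (N : ℝ) * (1 + t) ^ (N - 1) / ((1 + t) ^ N) ^ 2 = N / (1 + t) ^ (N + 1) := by
          have h4 : ((1 + t) ^ N) ^ 2 = (1 + t) ^ (N - 1) * (1 + t) ^ (N + 1) := by
            rw [← pow_mul, ← pow_add]
            congr 1
            omega
          rw [h4]
          field_simp
        rw [h3, hκ]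
        have h5 : (1 : ℝ) ≤ N := by rw [hN]; push_cast; linarith [(Nat.cast_nonneg e : (0 : ℝ) ≤ e),
          (Nat.cast_nonneg m : (0 : ℝ) ≤ m)]
        gcongr
        linarith [ht'.2]
      rw [neg_div]
      linarith
  -- Composing with this clamp extends the bump continuously by zero, since `P` vanishes at `1` and
  -- `2`.
  set pr : ℝ → ℝ := fun t => max 1 (min t 2) with hpr
  have hpr12 : ∀ t, pr t ∈ Icc (1 : ℝ) 2 := fun t =>
    ⟨le_max_left _ _, max_le (by norm_num) (min_le_right _ _)⟩
  set Q : ℝ → ℝ := fun t => P.eval (pr t) with hQ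
  have hQc : Continuous Q := P.continuous.comp (by fun_prop)
  have hQ1 : ∀ t, t ≤ 1 → Q t = 0 := fun t ht => by
    have : pr t = 1 := max_eq_left ((min_le_left _ _).trans ht)
    simp only [hQ, this, hP1]
  have hQ2 : ∀ t, 2 ≤ t → Q t = 0 := fun t ht => by
    have : pr t = 2 := by simp only [hpr]; rw [min_eq_right ht]; norm_num
    simp only [hQ, this, hP2]
  have hQ12 : ∀ t ∈ Icc (1 : ℝ) 2, Q t = P.eval t := fun t ht => by
    have : pr t = t := by simp only [hpr]; rw [min_eq_left ht.2, max_eq_right ht.1]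
    simp only [hQ, this]
  have hQb : ∀ t, |Q t| ≤ κ / 2 := fun t => hPb _ (hpr12 t)
  have hθanti : ∀ s t, 0 < s → s ≤ t → G t + Q t ≤ G s + Q s := by
    intro s t hs hst
    rcases le_or_gt t 1 with h1 | h1
    · rw [hQ1 t h1, hQ1 s (hst.trans h1)]
      linarith [hGanti s t hs hst]
    rcases le_or_gt 2 s with h2 | h2
    · rw [hQ2 s h2, hQ2 t (h2.trans hst)]
      linarith [hGanti s t hs hst]
    have hs1 : s ≤ pr s := by simp only [hpr]; rw [min_eq_left h2.le]; exact le_max_right _ _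
    have ht1 : pr t ≤ t := max_le h1.le (min_le_left _ _)
    have hprst : pr s ≤ pr t := by simp only [hpr]; gcongr
    have h3 := hanti12 (hpr12 s) (hpr12 t) hprst
    simp only at h3
    have hps : 0 < pr s := by linarith [(hpr12 s).1]
    have hpt : 0 < pr t := by linarith [(hpr12 t).1]
    rw [← hGeq _ hps, ← hGeq _ hpt] at h3
    have h4 := hGanti s (pr s) hs hs1
    have h5 := hGanti (pr t) t hpt ht1
    simp only [hQ]
    linarith
  refine ⟨b, fun t => c * (G t + Q t), hab, by linarith, by fun_prop, fun s hs t ht hst => ?_,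
    fun t ht => ⟨mul_pos hc ?_, ?_⟩, fun t ht => ?_, fun k hk => ?_⟩
  · exact mul_le_mul_of_nonneg_left (hθanti s t hs hst) hc.le
  · rcases le_or_gt t 2 with h | h
    · have h1 : κ ≤ G t := by
        rw [hGeq t ht, hκ]
        have h2 : (1 + t) ^ N ≤ 3 ^ (N + 1) := by
          have : (1 + t) ^ N ≤ 3 ^ N := by gcongr; linarith
          refine this.trans (pow_le_pow_right₀ (by norm_num) (by omega))
        exact one_div_le_one_div_of_le (by positivity) h2
      linarith [(abs_le.1 (hQb t)).1]
    · rw [hQ2 t h.le, add_zero]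
      exact (hG1 t).1
  · have h1 := (abs_le.1 (hQb t)).2
    have h2 := (hG1 t).2
    -- Here `c < 1 / 2` gives the bound `1` for the profile.
    have h3 : G t + Q t ≤ 2 := by linarith
    nlinarith
  · simp only
    rw [hQ2 t ht, add_zero, hGeq t (by linarith), mul_one_div]
  · have hGi : IntegrableOn (fun t => t ^ (k + e) * G t) (Ioi 0) ∧
        ∫ t in Ioi (0 : ℝ), t ^ (k + e) * G t = ((k + e)! * (m - k)! : ℝ) / (e + m + 1)! := by
      have h1 := integrableOn_pow_div_one_add_pow (k + e) (m - k)
      have h2 : k + e + (m - k) = e + m := by omega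
      rw [h2, ← hN] at h1
      have h3 : EqOn (fun t : ℝ => t ^ (k + e) / (1 + t) ^ N) (fun t => t ^ (k + e) * G t)
          (Ioi 0) := fun t ht => by
        simp only
        rw [hGeq t ht, mul_one_div]
      rw [integrableOn_congr_fun h3 measurableSet_Ioi,
        setIntegral_congr_fun measurableSet_Ioi h3] at h1
      exact h1
    have hGib : IntegrableOn (fun t => t ^ (k + e) * G t) (Ioi b) :=
      hGi.1.mono_set (Ioi_subset_Ioi (ha0.trans hab).le)
    have hQind : EqOn (fun t => t ^ (k + e) * Q t)
        ((Ioc (1 : ℝ) 2).indicator fun t => t ^ (k + e) * P.eval t) (Ioi b) := by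
      intro t _
      by_cases ht : t ∈ Ioc (1 : ℝ) 2
      · rw [indicator_of_mem ht]
        simp only
        rw [hQ12 t (Ioc_subset_Icc_self ht)]
      · rw [indicator_of_notMem ht]
        simp only
        rcases le_or_gt t 1 with h | h
        · rw [hQ1 t h, mul_zero]
        · rw [hQ2 t (by by_contra! h2; exact ht ⟨h, h2.le⟩), mul_zero]
    have hPint : IntegrableOn (fun t => t ^ (k + e) * P.eval t) (Ioc (1 : ℝ) 2) :=
      (ContinuousOn.integrableOn_Icc (by fun_prop)).mono_set Ioc_subset_Icc_self
    have hQi : IntegrableOn (fun t => t ^ (k + e) * Q t) (Ioi b) := by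
      rw [integrableOn_congr_fun hQind measurableSet_Ioi]
      exact ((integrable_indicator_iff measurableSet_Ioc).2 hPint).integrableOn
    have hsub : Ioc (1 : ℝ) 2 ⊆ Ioi b := fun t ht => by
      rw [mem_Ioi]
      linarith [ht.1]
    have hQint : ∫ t in Ioi b, t ^ (k + e) * Q t = ρ ⟨k, by omega⟩ := by
      rw [setIntegral_congr_fun measurableSet_Ioi hQind, setIntegral_indicator measurableSet_Ioc,
        inter_eq_right.2 hsub, ← hv,
        intervalIntegral.integral_of_le (by norm_num)]
    have hθeq : (fun t => t ^ (k + e) * (c * (G t + Q t))) =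
        fun t => c * (t ^ (k + e) * G t + t ^ (k + e) * Q t) := by
      funext t; ring
    rw [hθeq]
    refine ⟨(hGib.add hQi).const_mul c, ?_⟩
    rw [integral_const_mul, integral_add hGib hQi, hQint]
    have hsplit : (∫ t in (0 : ℝ)..b, t ^ (k + e) * G t) + ∫ t in Ioi b, t ^ (k + e) * G t =
        ((k + e)! * (m - k)! : ℝ) / (e + m + 1)! := by
      rw [← hGi.2, ← Ioc_union_Ioi_eq_Ioi (ha0.trans hab).le,
        setIntegral_union (Ioc_disjoint_Ioi le_rfl) measurableSet_Ioi
          (hGi.1.mono_set Ioc_subset_Ioi_self) hGib,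
        intervalIntegral.integral_of_le (ha0.trans hab).le]
    rw [← hsplit]
    simp only [ρ]
    field_simp
    ring

end Profile

/-! ### Integration of Reinhardt functions -/

section Polar

open scoped Nat

theorem image_sq_Ioi : (fun r : ℝ => r ^ 2) '' Ioi 0 = Ioi 0 := by
  ext u
  simp only [mem_image, mem_Ioi]
  constructor
  · rintro ⟨r, hr, rfl⟩; positivity
  · intro hu
    exact ⟨Real.sqrt u, Real.sqrt_pos.2 hu, Real.sq_sqrt hu.le⟩

/-- Polar coordinates followed by `u = r²`. -/
theorem lintegral_comp_norm_sq {ψ : ℝ → ℝ≥0∞} (hψ : Measurable ψ) :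
    ∫⁻ z : ℂ, ψ (‖z‖ ^ 2) = ENNReal.ofReal Real.pi * ∫⁻ u in Ioi 0, ψ u := by
  rw [← Complex.lintegral_comp_polarCoord_symm, polarCoord_target]
  have h1 : ∀ p ∈ Ioi (0 : ℝ) ×ˢ Ioo (-Real.pi) Real.pi,
      ENNReal.ofReal p.1 • ψ (‖Complex.polarCoord.symm p‖ ^ 2) = ENNReal.ofReal p.1 * ψ (p.1 ^ 2) := by
    intro p _
    rw [Complex.norm_polarCoord_symm, sq_abs, smul_eq_mul]
  rw [setLIntegral_congr_fun (measurableSet_Ioi.prod measurableSet_Ioo) h1,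
    Measure.volume_eq_prod, setLIntegral_prod_symm _ (by fun_prop)]
  have h2 := lintegral_image_eq_lintegral_abs_deriv_mul (s := Ioi (0 : ℝ)) (f := fun r : ℝ => r ^ 2)
    (f' := fun r => 2 * r) measurableSet_Ioi
    (fun r _ => by simpa using ((hasDerivAt_id r).fun_pow 2).hasDerivWithinAt)
    (fun r hr s hs h => by
      have hr' : (0 : ℝ) < r := hr
      have hs' : (0 : ℝ) < s := hs
      exact (pow_left_inj₀ hr'.le hs'.le two_ne_zero).1 h) ψ
  rw [image_sq_Ioi] at h2
  have h3 : ∀ r ∈ Ioi (0 : ℝ), ENNReal.ofReal |2 * r| * ψ (r ^ 2) =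
      2 * (ENNReal.ofReal r * ψ (r ^ 2)) := by
    intro r hr
    have hr' : (0 : ℝ) < r := hr
    rw [abs_of_pos (by positivity), ENNReal.ofReal_mul (by norm_num), mul_assoc]
    simp
  rw [setLIntegral_congr_fun measurableSet_Ioi h3, lintegral_const_mul _ (by fun_prop)] at h2
  simp only
  rw [h2, setLIntegral_const, Real.volume_Ioo, sub_neg_eq_add, ← two_mul,
    ENNReal.ofReal_mul (by norm_num)]
  simp only [ENNReal.ofReal_ofNat]
  ring

theorem image_mul_Ioo {t : ℝ} (ht : 0 < t) : (fun x : ℝ => t * x) '' Ioo 0 1 = Ioo 0 t := by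
  simpa using image_mul_left_Ioo ht 0 1

/-- The coordinates `t = u + s`, `x = u / t` are reached by a translation in `s`, Tonelli, and the
scaling `u = t x`; no two-dimensional Jacobian is needed. -/
theorem lintegral_add_div_eq {Φ : ℝ → ℝ → ℝ≥0∞} (hΦ : Measurable (Function.uncurry Φ)) (a N : ℕ) :
    ∫⁻ u in Ioi (0 : ℝ), ∫⁻ s in Ioi (0 : ℝ),
      ENNReal.ofReal (u ^ a * s ^ N) * Φ (u + s) (u / (u + s)) =
    ∫⁻ t in Ioi (0 : ℝ), ENNReal.ofReal (t ^ (a + N + 1)) *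
      ∫⁻ x in Ioo (0 : ℝ) 1, ENNReal.ofReal (x ^ a * (1 - x) ^ N) * Φ t x := by
  let F : ℝ → ℝ → ℝ≥0∞ := fun u t =>
    {p : ℝ × ℝ | 0 < p.1 ∧ p.1 < p.2}.indicator
      (fun p => ENNReal.ofReal (p.1 ^ a * (p.2 - p.1) ^ N) * Φ p.2 (p.1 / p.2)) (u, t)
  have hset : MeasurableSet {p : ℝ × ℝ | 0 < p.1 ∧ p.1 < p.2} :=
    (measurableSet_lt measurable_const measurable_fst).inter
      (measurableSet_lt measurable_fst measurable_snd)
  have hFm : Measurable (Function.uncurry F) := by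
    refine Measurable.indicator ?_ hset
    have h1 : Measurable fun p : ℝ × ℝ => Φ p.2 (p.1 / p.2) :=
      hΦ.comp (measurable_snd.prodMk (measurable_fst.div measurable_snd))
    fun_prop
  have hL : ∀ u ∈ Ioi (0 : ℝ), ∫⁻ s in Ioi (0 : ℝ),
      ENNReal.ofReal (u ^ a * s ^ N) * Φ (u + s) (u / (u + s)) = ∫⁻ t, F u t := by
    intro u hu
    have hu' : (0 : ℝ) < u := hu
    rw [← lintegral_indicator measurableSet_Ioi, ← lintegral_sub_right_eq_self _ u]
    refine lintegral_congr fun t => ?_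
    simp only [F, indicator, mem_Ioi, mem_ofPred_eq, hu', true_and, sub_pos, add_sub_cancel]
  have hR : ∀ t ∈ Ioi (0 : ℝ), ∫⁻ u, F u t = ENNReal.ofReal (t ^ (a + N + 1)) *
      ∫⁻ x in Ioo (0 : ℝ) 1, ENNReal.ofReal (x ^ a * (1 - x) ^ N) * Φ t x := by
    intro t ht
    have ht' : (0 : ℝ) < t := ht
    have h1 : ∀ u, F u t = (Ioo 0 t).indicator
        (fun u => ENNReal.ofReal (u ^ a * (t - u) ^ N) * Φ t (u / t)) u := fun u => by
      simp only [F, indicator, mem_ofPred_eq, mem_Ioo]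
    have h2 := lintegral_image_eq_lintegral_abs_deriv_mul (s := Ioo (0 : ℝ) 1)
      (f := fun x : ℝ => t * x) (f' := fun _ => t) measurableSet_Ioo
      (fun x _ => by simpa using ((hasDerivAt_id x).const_mul t).hasDerivWithinAt)
      (fun x _ y _ h => mul_left_cancel₀ ht'.ne' h)
      (fun u => ENNReal.ofReal (u ^ a * (t - u) ^ N) * Φ t (u / t))
    rw [image_mul_Ioo ht'] at h2
    simp only [h1]
    have hm : Measurable fun x => Φ t x := hΦ.comp (measurable_const.prodMk measurable_id)
    rw [lintegral_indicator measurableSet_Ioo, h2, ← lintegral_const_mul _ (by fun_prop)]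
    refine setLIntegral_congr_fun measurableSet_Ioo fun x hx => ?_
    have hx0 := hx.1
    have hx1 : 0 < 1 - x := by linarith [hx.2]
    rw [mul_div_cancel_left₀ _ ht'.ne', abs_of_pos ht', ← mul_assoc, ← mul_assoc,
      ← ENNReal.ofReal_mul ht'.le, ← ENNReal.ofReal_mul (by positivity)]
    congr 2
    rw [show t - t * x = t * (1 - x) by ring, mul_pow, mul_pow]
    ring
  have hneg : ∀ t, t ∉ Ioi (0 : ℝ) → ∫⁻ u, F u t = 0 := by
    intro t ht
    rw [lintegral_eq_zero_iff' (hFm.of_uncurry_right).aemeasurable]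
    refine Filter.Eventually.of_forall fun u => ?_
    simp only [F, indicator, mem_ofPred_eq, Pi.zero_apply]
    rw [if_neg]
    rintro ⟨h1, h2⟩
    exact ht (h1.trans h2)
  have hneg' : ∀ u, u ∉ Ioi (0 : ℝ) → ∫⁻ t, F u t = 0 := by
    intro u hu
    rw [lintegral_eq_zero_iff' (hFm.of_uncurry_left).aemeasurable]
    refine Filter.Eventually.of_forall fun t => ?_
    simp only [F, indicator, mem_ofPred_eq, Pi.zero_apply]
    rw [if_neg]
    rintro ⟨h1, h2⟩
    exact hu h1
  rw [setLIntegral_congr_fun measurableSet_Ioi hL,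
    ← setLIntegral_congr_fun measurableSet_Ioi hR, ← lintegral_indicator measurableSet_Ioi,
    ← lintegral_indicator measurableSet_Ioi]
  have e1 : (Ioi (0 : ℝ)).indicator (fun u => ∫⁻ t, F u t) = fun u => ∫⁻ t, F u t :=
    indicator_eq_self.2 fun u hu => by
      by_contra h
      exact hu (hneg' u h)
  have e2 : (Ioi (0 : ℝ)).indicator (fun t => ∫⁻ u, F u t) = fun t => ∫⁻ u, F u t :=
    indicator_eq_self.2 fun u hu => by
      by_contra h
      exact hu (hneg u h)
  rw [e1, e2]
  exact lintegral_lintegral_swap hFm.aemeasurable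

variable {n : ℕ}

theorem normSq_eq_succ (z : Cn (n + 1)) : normSq z = ‖z 0‖ ^ 2 + normSq (Fin.tail z) := by
  simp only [normSq, Fin.sum_univ_succ, Fin.tail]

theorem lintegral_fin_succ {F : ℂ → Cn n → ℝ≥0∞} (hF : Measurable (Function.uncurry F)) :
    ∫⁻ z : Cn (n + 1), F (z 0) (Fin.tail z) = ∫⁻ w, ∫⁻ v, F w v := by
  have h1 := (volume_preserving_piFinSuccAbove (fun _ : Fin (n + 1) => ℂ) 0).lintegral_comp hF
  rw [Measure.volume_eq_prod, lintegral_prod _ hF.aemeasurable] at h1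
  exact h1

theorem measurable_normSq : Measurable (normSq (n := n)) := continuous_normSq.measurable

/-- The radial moment formula in `n + 1` variables implies the formula in `n + 2` variables for
functions of the norm and of the first coordinate. -/
theorem lintegral_monomial_mul_of_radial {a N : ℕ} {α : Fin n → ℕ} {c : ℝ≥0∞}
    (hrad : ∀ ψ : ℝ → ℝ≥0∞, Measurable ψ →
      ∫⁻ w : Cn n, ENNReal.ofReal (∏ i, (‖w i‖ ^ 2) ^ α i) * ψ (normSq w) =
        c * ∫⁻ s in Ioi (0 : ℝ), ENNReal.ofReal (s ^ N) * ψ s)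
    {Φ : ℝ → ℝ → ℝ≥0∞} (hΦ : Measurable (Function.uncurry Φ)) :
    ∫⁻ z : Cn (n + 1), ENNReal.ofReal ((‖z 0‖ ^ 2) ^ a * ∏ i, (‖z (Fin.succ i)‖ ^ 2) ^ α i) *
        Φ (normSq z) (‖z 0‖ ^ 2 / normSq z) =
      ENNReal.ofReal Real.pi * c * ∫⁻ t in Ioi (0 : ℝ), ENNReal.ofReal (t ^ (a + N + 1)) *
        ∫⁻ x in Ioo (0 : ℝ) 1, ENNReal.ofReal (x ^ a * (1 - x) ^ N) * Φ t x := by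
  have hΦ2 : Measurable fun p : ℝ × ℝ => Φ (p.1 + p.2) (p.1 / (p.1 + p.2)) :=
    hΦ.comp ((measurable_fst.add measurable_snd).prodMk
      (measurable_fst.div (measurable_fst.add measurable_snd)))
  let F : ℂ → Cn n → ℝ≥0∞ := fun w v =>
    ENNReal.ofReal ((‖w‖ ^ 2) ^ a * ∏ i, (‖v i‖ ^ 2) ^ α i) *
      Φ (‖w‖ ^ 2 + normSq v) (‖w‖ ^ 2 / (‖w‖ ^ 2 + normSq v))
  have hF : Measurable (Function.uncurry F) := by
    have h1 : Measurable fun p : ℂ × Cn n =>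
        Φ (‖p.1‖ ^ 2 + normSq p.2) (‖p.1‖ ^ 2 / (‖p.1‖ ^ 2 + normSq p.2)) :=
      hΦ2.comp ((measurable_fst.norm.pow_const 2).prodMk (measurable_normSq.comp measurable_snd))
    refine Measurable.mul ?_ h1
    refine ENNReal.measurable_ofReal.comp (Continuous.measurable ?_)
    fun_prop
  have h1 := lintegral_fin_succ hF
  have h2 : ∀ w : ℂ, ∫⁻ v, F w v = ENNReal.ofReal ((‖w‖ ^ 2) ^ a) * (c *
      ∫⁻ s in Ioi (0 : ℝ), ENNReal.ofReal (s ^ N) *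
        Φ (‖w‖ ^ 2 + s) (‖w‖ ^ 2 / (‖w‖ ^ 2 + s))) := by
    intro w
    have hm : Measurable fun s => Φ (‖w‖ ^ 2 + s) (‖w‖ ^ 2 / (‖w‖ ^ 2 + s)) :=
      hΦ2.comp (measurable_const.prodMk measurable_id)
    rw [← hrad _ hm, ← lintegral_const_mul]
    · refine lintegral_congr fun v => ?_
      simp only [F]
      rw [ENNReal.ofReal_mul (by positivity), mul_assoc]
    · refine Measurable.mul ?_ (hm.comp measurable_normSq)
      refine ENNReal.measurable_ofReal.comp (Continuous.measurable ?_)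
      fun_prop
  let ψ : ℝ → ℝ≥0∞ := fun u => ENNReal.ofReal (u ^ a) * (c *
      ∫⁻ s in Ioi (0 : ℝ), ENNReal.ofReal (s ^ N) * Φ (u + s) (u / (u + s)))
  have hm2 : Measurable fun p : ℝ × ℝ =>
      ENNReal.ofReal (p.2 ^ N) * Φ (p.1 + p.2) (p.1 / (p.1 + p.2)) :=
    Measurable.mul (by fun_prop) hΦ2
  have hψi : Measurable fun u : ℝ => ∫⁻ s in Ioi (0 : ℝ),
      ENNReal.ofReal (s ^ N) * Φ (u + s) (u / (u + s)) := hm2.lintegral_prod_right'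
  have hψ : Measurable ψ := by
    simp only [ψ]
    fun_prop
  calc _ = ∫⁻ z : Cn (n + 1), F (z 0) (Fin.tail z) := by
        refine lintegral_congr fun z => ?_
        simp only [F, normSq_eq_succ, Fin.tail]
    _ = ∫⁻ w : ℂ, ψ (‖w‖ ^ 2) := by rw [h1]; simp only [h2, ψ]
    _ = ENNReal.ofReal Real.pi * ∫⁻ u in Ioi (0 : ℝ), ψ u := lintegral_comp_norm_sq hψ
    _ = ENNReal.ofReal Real.pi * (c * ∫⁻ u in Ioi (0 : ℝ), ∫⁻ s in Ioi (0 : ℝ),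
          ENNReal.ofReal (u ^ a * s ^ N) * Φ (u + s) (u / (u + s))) := by
        congr 1
        rw [← lintegral_const_mul]
        · refine setLIntegral_congr_fun measurableSet_Ioi fun u hu => ?_
          have hu' : (0 : ℝ) < u := hu
          simp only [ψ]
          have hm3 : Measurable fun s => ENNReal.ofReal (s ^ N) * Φ (u + s) (u / (u + s)) :=
            hm2.comp (measurable_const.prodMk measurable_id)
          rw [mul_left_comm, ← lintegral_const_mul _ hm3]
          congr 1
          refine lintegral_congr fun s => ?_
          rw [ENNReal.ofReal_mul (by positivity), mul_assoc]
        · have hm4 : Measurable fun p : ℝ × ℝ =>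
              ENNReal.ofReal (p.1 ^ a * p.2 ^ N) * Φ (p.1 + p.2) (p.1 / (p.1 + p.2)) :=
            Measurable.mul (by fun_prop) hΦ2
          exact hm4.lintegral_prod_right'
    _ = _ := by rw [lintegral_add_div_eq hΦ, mul_assoc]

theorem lintegral_pow_mul_one_sub_pow (p q : ℕ) :
    ∫⁻ x in Ioo (0 : ℝ) 1, ENNReal.ofReal (x ^ p * (1 - x) ^ q) =
      ENNReal.ofReal ((p ! * q ! : ℝ) / (p + q + 1)!) := by
  rw [← integral_pow_mul_one_sub_pow, intervalIntegral.integral_of_le zero_le_one,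
    integral_Ioc_eq_integral_Ioo, ofReal_integral_eq_lintegral_ofReal]
  · exact (ContinuousOn.integrableOn_Icc (by fun_prop)).mono_set Ioo_subset_Icc_self
  · refine (ae_restrict_iff' measurableSet_Ioo).2 (Filter.Eventually.of_forall fun x hx => ?_)
    have h1 := hx.1
    have h2 : 0 < 1 - x := by linarith [hx.2]
    simp only [Pi.zero_apply]
    positivity

/-- Induction on the number of variables: splitting off one coordinate contributes a beta integral,
whose factorials telescope. -/
theorem lintegral_monomial_mul_radial (α : Fin (n + 1) → ℕ) {ψ : ℝ → ℝ≥0∞} (hψ : Measurable ψ) :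
    ∫⁻ z : Cn (n + 1), ENNReal.ofReal (∏ i, (‖z i‖ ^ 2) ^ α i) * ψ (normSq z) =
      ENNReal.ofReal (Real.pi ^ (n + 1) * (∏ i, (α i)! : ℝ) / (∑ i, α i + n)!) *
        ∫⁻ t in Ioi (0 : ℝ), ENNReal.ofReal (t ^ (∑ i, α i + n)) * ψ t := by
  induction n generalizing ψ with
  | zero =>
    have h1 := lintegral_fin_succ (n := 0) (F := fun w _ => ENNReal.ofReal ((‖w‖ ^ 2) ^ α 0) *
      ψ (‖w‖ ^ 2)) (Measurable.mul (by fun_prop)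
        (hψ.comp ((measurable_fst.norm.pow_const 2))))
    have h2 : ∀ w : ℂ, ∫⁻ _v : Cn 0, ENNReal.ofReal ((‖w‖ ^ 2) ^ α 0) * ψ (‖w‖ ^ 2) =
        ENNReal.ofReal ((‖w‖ ^ 2) ^ α 0) * ψ (‖w‖ ^ 2) := fun w => by
      have h0 : (volume : Measure (Cn 0)) univ = 1 := by
        rw [← Set.pi_univ univ, volume_pi_pi]
        simp
      rw [lintegral_const, h0, mul_one]
    simp only [h2] at h1
    rw [lintegral_comp_norm_sq (ψ := fun u => ENNReal.ofReal (u ^ α 0) * ψ u) (by fun_prop)] at h1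
    have h3 : ((α 0)! : ℝ) ≠ 0 := by positivity
    simpa [normSq_eq_succ, normSq, Fin.prod_univ_succ, mul_div_cancel_right₀ _ h3] using h1
  | succ n ih =>
    have h1 := lintegral_monomial_mul_of_radial (a := α 0) (fun ψ hψ => ih (Fin.tail α) (ψ := ψ) hψ)
      (Φ := fun t _ => ψ t) (hψ.comp measurable_fst)
    have hs : α 0 + (∑ i, Fin.tail α i + n) + 1 = ∑ i, α i + (n + 1) := by
      rw [Fin.sum_univ_succ α]; simp only [Fin.tail]; ring
    have hin : ∀ t, ∫⁻ x in Ioo (0 : ℝ) 1,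
        ENNReal.ofReal (x ^ α 0 * (1 - x) ^ (∑ i, Fin.tail α i + n)) * ψ t =
        ENNReal.ofReal (((α 0)! * (∑ i, Fin.tail α i + n)! : ℝ) / (∑ i, α i + (n + 1))!) * ψ t := by
      intro t
      rw [lintegral_mul_const _ (by fun_prop), lintegral_pow_mul_one_sub_pow, hs]
    have h2 : ∀ z : Cn (n + 2), (‖z 0‖ ^ 2) ^ α 0 * ∏ i, (‖z (Fin.succ i)‖ ^ 2) ^ Fin.tail α i =
        ∏ i, (‖z i‖ ^ 2) ^ α i := fun z => by
      rw [Fin.prod_univ_succ (fun i => (‖z i‖ ^ 2) ^ α i)]; rfl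
    have h3 : (∏ i, (α i)! : ℝ) = (α 0)! * ∏ i, ((Fin.tail α i)! : ℝ) := by
      rw [Fin.prod_univ_succ]; simp [Fin.tail]
    simp only [h2, hin, hs] at h1
    rw [h1]
    have h4 : ∀ t, ENNReal.ofReal (t ^ (∑ i, α i + (n + 1))) * (ENNReal.ofReal
        (((α 0)! * (∑ i, Fin.tail α i + n)! : ℝ) / (∑ i, α i + (n + 1))!) * ψ t) =
        ENNReal.ofReal (((α 0)! * (∑ i, Fin.tail α i + n)! : ℝ) / (∑ i, α i + (n + 1))!) *
          (ENNReal.ofReal (t ^ (∑ i, α i + (n + 1))) * ψ t) := fun t => mul_left_comm _ _ _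
    simp only [h4]
    rw [lintegral_const_mul _ (by fun_prop), ← mul_assoc, ← ENNReal.ofReal_mul (by positivity),
      ← ENNReal.ofReal_mul (by positivity), h3]
    congr 2
    have h5 : ((∑ i, Fin.tail α i + n)! : ℝ) ≠ 0 := by positivity
    field_simp
    ring

/-- Integration of monomials against functions of the norm and of the first coordinate. -/
theorem lintegral_monomial_mul (α : Fin (n + 2) → ℕ) {Φ : ℝ → ℝ → ℝ≥0∞}
    (hΦ : Measurable (Function.uncurry Φ)) :
    ∫⁻ z : Cn (n + 2), ENNReal.ofReal (∏ i, (‖z i‖ ^ 2) ^ α i) *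
        Φ (normSq z) (‖z 0‖ ^ 2 / normSq z) =
      ENNReal.ofReal (Real.pi ^ (n + 2) * (∏ i, (Fin.tail α i)! : ℝ) / (∑ i, Fin.tail α i + n)!) *
        ∫⁻ t in Ioi (0 : ℝ), ENNReal.ofReal (t ^ (∑ i, α i + (n + 1))) *
          ∫⁻ x in Ioo (0 : ℝ) 1,
            ENNReal.ofReal (x ^ α 0 * (1 - x) ^ (∑ i, Fin.tail α i + n)) * Φ t x := by
  have h1 := lintegral_monomial_mul_of_radial (a := α 0)
    (fun ψ hψ => lintegral_monomial_mul_radial (Fin.tail α) (ψ := ψ) hψ) hΦ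
  have hs : α 0 + (∑ i, Fin.tail α i + n) + 1 = ∑ i, α i + (n + 1) := by
    rw [Fin.sum_univ_succ α]; simp only [Fin.tail]; ring
  have h2 : ∀ z : Cn (n + 2), (‖z 0‖ ^ 2) ^ α 0 * ∏ i, (‖z (Fin.succ i)‖ ^ 2) ^ Fin.tail α i =
      ∏ i, (‖z i‖ ^ 2) ^ α i := fun z => by
    rw [Fin.prod_univ_succ (fun i => (‖z i‖ ^ 2) ^ α i)]; rfl
  simp only [h2, hs] at h1
  rw [h1, ← ENNReal.ofReal_mul (by positivity)]
  congr 2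
  ring

end Polar

/-! ### Fourier coefficients of functions on Reinhardt domains -/

section Fourier

open UnitAddTorus Filter Topology

variable {n : ℕ}

/-- The normalized Haar measure of the torus. -/
def torusMeasure (n : ℕ) : Measure (UnitAddTorus (Fin n)) :=
  Measure.pi fun _ => AddCircle.haarAddCircle

instance : IsProbabilityMeasure (torusMeasure n) := by
  unfold torusMeasure; infer_instance

instance : (torusMeasure n).IsAddRightInvariant := by
  unfold torusMeasure; infer_instance

/-- The point `(e^{2π i t₁}, …, e^{2π i tₙ})`. -/
def torusPt (t : UnitAddTorus (Fin n)) : Cn n := fun j => (AddCircle.toCircle (t j) : ℂ)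

theorem norm_torusPt (t : UnitAddTorus (Fin n)) (j : Fin n) : ‖torusPt t j‖ = 1 :=
  Circle.norm_coe _

theorem torusPt_ne_zero (t : UnitAddTorus (Fin n)) (j : Fin n) : torusPt t j ≠ 0 :=
  Circle.coe_ne_zero _

theorem continuous_torusPt : Continuous (torusPt (n := n)) :=
  continuous_pi fun j =>
    continuous_subtype_val.comp (AddCircle.continuous_toCircle.comp (continuous_apply j))

theorem torusPt_add (s t : UnitAddTorus (Fin n)) : torusPt (s + t) = torusPt s * torusPt t := by
  funext j
  simp [torusPt, AddCircle.toCircle_add]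

theorem torusPt_zero : torusPt (0 : UnitAddTorus (Fin n)) = 1 := by
  funext j
  simp [torusPt]

theorem mFourier_eq_prod (k : Fin n → ℤ) (t : UnitAddTorus (Fin n)) :
    mFourier k t = ∏ j, torusPt t j ^ k j := by
  simp only [mFourier, ContinuousMap.coe_mk, torusPt, fourier_apply, AddCircle.toCircle_zsmul,
    Circle.coe_zpow]

theorem norm_torusPt_mul (t : UnitAddTorus (Fin n)) (z : Cn n) : ‖torusPt t * z‖ = ‖z‖ := by
  simp only [Pi.norm_def, Pi.mul_apply, nnnorm_mul]
  congr 2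
  funext j
  have : ‖torusPt t j‖₊ = 1 := NNReal.eq (norm_torusPt t j)
  rw [this, one_mul]

theorem measurePreserving_torusPt_mul : MeasurePreserving
    (fun p : UnitAddTorus (Fin n) × Cn n => torusPt p.1 * p.2)
    ((torusMeasure n).prod volume) volume := by
  have h1 : Measurable fun p : UnitAddTorus (Fin n) × Cn n => torusPt p.1 * p.2 :=
    (continuous_torusPt.measurable.comp measurable_fst).mul measurable_snd
  have h2 := (MeasurePreserving.id (torusMeasure n)).skew_product (μc := (volume : Measure (Cn n)))
    (μd := volume) (g := fun t z => torusPt t * z) h1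
    (Filter.Eventually.of_forall fun t => (measurePreserving_torus (norm_torusPt t)).map_eq)
  exact measurePreserving_snd.comp h2

theorem lintegral_torus_average {φ : Cn n → ℝ≥0∞} (hφ : Measurable φ) :
    ∫⁻ z, ∫⁻ t, φ (torusPt t * z) ∂torusMeasure n = ∫⁻ z, φ z := by
  rw [← measurePreserving_torusPt_mul.lintegral_comp hφ]
  exact (lintegral_prod_symm (fun p : UnitAddTorus (Fin n) × Cn n => φ (torusPt p.1 * p.2))
    (hφ.comp measurePreserving_torusPt_mul.measurable).aemeasurable).symm

theorem integral_torus_average {φ : Cn n → ℂ} (hφ : Integrable φ) :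
    ∫ z, ∫ t, φ (torusPt t * z) ∂torusMeasure n = ∫ z, φ z := by
  have hmp := measurePreserving_torusPt_mul (n := n)
  have h1 : Integrable (fun p : UnitAddTorus (Fin n) × Cn n => φ (torusPt p.1 * p.2))
      ((torusMeasure n).prod volume) := hmp.integrable_comp_of_integrable hφ
  have h2 : ∫ p, φ (torusPt p.1 * p.2) ∂((torusMeasure n).prod volume) = ∫ z, φ z := by
    conv_rhs => rw [← hmp.map_eq]
    rw [integral_map hmp.aemeasurable]
    rw [hmp.map_eq]
    exact hφ.aestronglyMeasurable
  rw [← h2, integral_prod_symm _ h1]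

theorem enorm_integral_sq_le {X : Type*} [MeasurableSpace X] {μ : Measure X}
    [IsProbabilityMeasure μ] {g : X → ℂ} (hg : AEStronglyMeasurable g μ) :
    ‖∫ x, g x ∂μ‖ₑ ^ 2 ≤ ∫⁻ x, ‖g x‖ₑ ^ 2 ∂μ := by
  rw [← eLpNorm_two_sq]
  gcongr
  refine (enorm_integral_le_lintegral_enorm _).trans ?_
  rw [← eLpNorm_one_eq_lintegral_enorm]
  exact eLpNorm_le_eLpNorm_of_exponent_le (by norm_num) hg

/-- The Fourier coefficients of `f` on the orbits of the torus. -/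
def torusCoeff (f : Cn n → ℂ) (k : Fin n → ℤ) (z : Cn n) : ℂ :=
  ∫ t, mFourier (-k) t * f (torusPt t * z) ∂torusMeasure n

/-- Translation invariance of Haar measure: the coefficient transforms like the monomial `zᵏ`. -/
theorem torusCoeff_torusPt_mul (f : Cn n → ℂ) (k : Fin n → ℤ) (s : UnitAddTorus (Fin n)) (z : Cn n) :
    torusCoeff f k (torusPt s * z) = (∏ j, torusPt s j ^ k j) * torusCoeff f k z := by
  unfold torusCoeff
  rw [← integral_const_mul, ← integral_add_right_eq_self (μ := torusMeasure n)
    (fun t => (∏ j, torusPt s j ^ k j) * (mFourier (-k) t * f (torusPt t * z))) s]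
  refine integral_congr_ae (Filter.Eventually.of_forall fun t => ?_)
  simp only
  rw [torusPt_add, mul_assoc (torusPt t), ← mul_assoc (∏ j, torusPt s j ^ k j)]
  congr 1
  rw [mFourier_eq_prod, mFourier_eq_prod, ← Finset.prod_mul_distrib]
  refine Finset.prod_congr rfl fun j _ => ?_
  rw [torusPt_add, Pi.mul_apply, mul_zpow, Pi.neg_apply, mul_left_comm,
    ← zpow_add₀ (torusPt_ne_zero s j), add_neg_cancel, zpow_zero, mul_one]

variable {Ω : CDomain n} {f : Cn n → ℂ}

theorem CDomain.IsReinhardt.torusPt_mul_mem (hR : Ω.IsReinhardt) {z : Cn n} (hz : z ∈ Ω.set)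
    (t : UnitAddTorus (Fin n)) : torusPt t * z ∈ Ω.set :=
  hR z hz (torusPt t) (norm_torusPt t)

theorem CDomain.IsReinhardt.torusPt_mul_mem_iff (hR : Ω.IsReinhardt) {z : Cn n}
    (t : UnitAddTorus (Fin n)) : torusPt t * z ∈ Ω.set ↔ z ∈ Ω.set := by
  refine ⟨fun h => ?_, fun h => hR.torusPt_mul_mem h t⟩
  have := hR.torusPt_mul_mem h (-t)
  rwa [← mul_assoc, ← torusPt_add, neg_add_cancel, torusPt_zero, one_mul] at this

theorem CDomain.IsReinhardt.continuous_orbit (hR : Ω.IsReinhardt) (hf : ContinuousOn f Ω.set)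
    {z : Cn n} (hz : z ∈ Ω.set) : Continuous fun t => f (torusPt t * z) :=
  hf.comp_continuous (continuous_torusPt.mul continuous_const) fun t => hR.torusPt_mul_mem hz t

/-- Vanishing coefficients are summable, so the Fourier series of the continuous orbit function
converges to it pointwise, in particular at the identity. -/
theorem CDomain.IsReinhardt.eq_zero_of_torusCoeff (hR : Ω.IsReinhardt) (hf : ContinuousOn f Ω.set)
    {z : Cn n} (hz : z ∈ Ω.set) (h : ∀ k, torusCoeff f k z = 0) : f z = 0 := by
  let g : C(UnitAddTorus (Fin n), ℂ) := ⟨fun t => f (torusPt t * z), hR.continuous_orbit hf hz⟩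
  have h1 : mFourierCoeff g = 0 := by
    funext k
    exact h k
  have h2 : Summable (mFourierCoeff g) := by rw [h1]; exact summable_zero
  have h3 := hasSum_mFourier_series_apply_of_summable h2 0
  have h4 : ∀ i, mFourierCoeff g i • mFourier i (0 : UnitAddTorus (Fin n)) = 0 := fun i => by
    rw [h1, Pi.zero_apply, zero_smul]
  simp only [h4] at h3
  have h5 := h3.unique hasSum_zero
  simpa [g, torusPt_zero] using h5

/-- Differentiation under the integral. The torus orbit of a point is compact, so `f` is bounded on
a uniform neighbourhood of it and the derivative bound supplies a constant majorant. -/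
theorem CDomain.IsReinhardt.differentiableOn_torusCoeff (hR : Ω.IsReinhardt)
    (hf : DifferentiableOn ℂ f Ω.set) (k : Fin n → ℤ) :
    DifferentiableOn ℂ (torusCoeff f k) Ω.set := by
  intro z₀ hz₀
  refine DifferentiableAt.differentiableWithinAt ?_
  have hKc : IsCompact (range fun t => torusPt t * z₀) :=
    isCompact_range (continuous_torusPt.mul continuous_const)
  obtain ⟨δ, hδ, hsub⟩ := hKc.exists_cthickening_subset_open Ω.isOpen_set
    (by rintro _ ⟨t, rfl⟩; exact hR.torusPt_mul_mem hz₀ t)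
  obtain ⟨C, hC⟩ := hKc.cthickening.exists_bound_of_continuousOn (hf.continuousOn.mono hsub)
  have hmem : ∀ t, ∀ z ∈ Metric.ball z₀ (δ / 2), Metric.ball (torusPt t * z) (δ / 2) ⊆
      Metric.cthickening δ (range fun t => torusPt t * z₀) := by
    intro t z hz w hw
    refine Metric.mem_cthickening_of_dist_le w (torusPt t * z₀) δ _ ⟨t, rfl⟩ ?_
    have h1 : dist (torusPt t * z) (torusPt t * z₀) = dist z z₀ := by
      rw [dist_eq_norm, ← mul_sub, norm_torusPt_mul, dist_eq_norm]
    have h2 := dist_triangle w (torusPt t * z) (torusPt t * z₀)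
    rw [h1] at h2
    rw [Metric.mem_ball] at hz hw
    linarith
  let D : UnitAddTorus (Fin n) → Cn n →L[ℂ] Cn n := fun t => ContinuousLinearMap.mul ℂ (Cn n) (torusPt t)
  have hDc : Continuous D := (ContinuousLinearMap.mul ℂ (Cn n)).continuous.comp continuous_torusPt
  have hDn : ∀ t, ‖D t‖ ≤ 1 := fun t =>
    ContinuousLinearMap.opNorm_le_bound _ zero_le_one fun z => by
      rw [one_mul]
      exact (norm_torusPt_mul t z).le
  have hmn : ∀ t, ‖mFourier (-k) t‖ = 1 := fun t => by
    rw [mFourier_eq_prod, norm_prod]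
    exact Finset.prod_eq_one fun j _ => by rw [norm_zpow, norm_torusPt, one_zpow]
  have hball : Metric.ball z₀ (δ / 2) ⊆ Ω.set := fun z hz => by
    have h1 := hsub (hmem 0 z hz (Metric.mem_ball_self (by positivity)))
    rwa [torusPt_zero, one_mul] at h1
  have hint : ∀ z ∈ Ω.set, Continuous fun t => mFourier (-k) t * f (torusPt t * z) := fun z hz =>
    (mFourier (-k)).continuous.mul (hR.continuous_orbit hf.continuousOn hz)
  refine (hasFDerivAt_integral_of_dominated_of_fderiv_le (μ := torusMeasure n)
    (F := fun z t => mFourier (-k) t * f (torusPt t * z))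
    (F' := fun z t => mFourier (-k) t • (fderiv ℂ f (torusPt t * z)).comp (D t))
    (bound := fun _ => 2 * C / (δ / 2))
    (Metric.ball_mem_nhds z₀ (by positivity : 0 < δ / 2)) ?_ ?_ ?_ ?_ (integrable_const _)
    ?_).differentiableAt
  · filter_upwards [Ω.isOpen_set.mem_nhds hz₀] with z hz
    exact (hint z hz).aestronglyMeasurable
  · exact (hint z₀ hz₀).integrable_of_hasCompactSupport (HasCompactSupport.of_compactSpace _)
  · refine (mFourier (-k)).continuous.aestronglyMeasurable.smul ?_
    have h1 : Measurable fun t => fderiv ℂ f (torusPt t * z₀) :=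
      (measurable_fderiv ℂ f).comp (continuous_torusPt.mul continuous_const).measurable
    exact (isBoundedBilinearMap_comp (𝕜 := ℂ)).continuous.comp_aestronglyMeasurable
      (h1.aestronglyMeasurable.prodMk hDc.aestronglyMeasurable)
  · refine Filter.Eventually.of_forall fun t z hz => ?_
    rw [norm_smul, hmn, one_mul]
    refine (ContinuousLinearMap.opNorm_comp_le _ _).trans ?_
    have h1 := norm_fderiv_le_of_forall_mem_ball (f := f) (c := torusPt t * z) (r := δ / 2)
      (by positivity) (hf.mono ((hmem t z hz).trans hsub)) fun w hw => hC w (hmem t z hz hw)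
    exact (mul_le_mul h1 (hDn t) (norm_nonneg _) ((norm_nonneg _).trans h1)).trans (mul_one _).le
  · refine Filter.Eventually.of_forall fun t z hz => ?_
    have h1 : HasFDerivAt f (fderiv ℂ f (torusPt t * z)) (torusPt t * z) :=
      (hf.differentiableAt (Ω.isOpen_set.mem_nhds (hR.torusPt_mul_mem (hball hz) t))).hasFDerivAt
    exact (h1.comp z (D t).hasFDerivAt).const_mul _

/-- A function which is holomorphic near a point off the coordinate hyperplanes and invariant under
small rotations is locally constant. -/
theorem fderiv_eq_zero_of_torus_invariant {g : Cn n → ℂ} {z : Cn n} (hg : DifferentiableAt ℂ g z)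
    (hz : ∀ j, z j ≠ 0) (hinv : ∀ t, g (torusPt t * z) = g z) : fderiv ℂ g z = 0 := by
  have h1 : ∀ j, fderiv ℂ g z (Pi.single j (1 : ℂ)) = 0 := by
    intro j
    -- The curve rotates the `j`-th coordinate only. Its velocity at `0` is a nonzero complex
    -- multiple of the `j`-th basis vector because `z j ≠ 0`.
    let γ : ℝ → Cn n := fun s => z + (Complex.exp (2 * Real.pi * Complex.I * s) - 1) • Pi.single j (z j)
    have hγ : ∀ s : ℝ, γ s = torusPt (Pi.single j (s : UnitAddCircle)) * z := by
      intro s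
      funext i
      rcases eq_or_ne i j with rfl | hij
      · simp only [γ, torusPt, Pi.add_apply, Pi.smul_apply, Pi.single_eq_same, smul_eq_mul,
          Pi.mul_apply, AddCircle.toCircle_apply_mk, Circle.coe_exp, div_one]
        push_cast
        rw [show (2 * Real.pi * s * Complex.I : ℂ) = 2 * Real.pi * Complex.I * s by ring]
        ring
      · simp [γ, torusPt, Pi.single_eq_of_ne hij]
    have hγ0 : γ 0 = z := by simp [γ]
    have hγd : HasDerivAt γ ((2 * Real.pi * Complex.I) • Pi.single j (z j)) 0 := by
      have h2 : HasDerivAt (fun s : ℝ => Complex.exp (2 * Real.pi * Complex.I * s) - 1)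
          (2 * Real.pi * Complex.I) 0 := by
        have h3 : HasDerivAt (fun s : ℂ => Complex.exp (2 * Real.pi * Complex.I * s) - 1)
            (2 * Real.pi * Complex.I) ((0 : ℝ) : ℂ) := by
          have h4 := (((hasDerivAt_id (((0 : ℝ) : ℂ))).const_mul
            (2 * Real.pi * Complex.I)).cexp).sub_const 1
          simpa using h4
        exact h3.comp_ofReal
      exact (h2.smul_const (Pi.single j (z j) : Cn n)).const_add z
    have hgd : HasFDerivAt g ((fderiv ℂ g z).restrictScalars ℝ) (γ 0) := by
      rw [hγ0]
      exact hg.hasFDerivAt.restrictScalars ℝ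
    have h5 := hgd.comp_hasDerivAt 0 hγd
    have h6 : g ∘ γ = fun _ => g z := funext fun s => by rw [Function.comp, hγ, hinv]
    rw [h6] at h5
    have h7 := h5.unique (hasDerivAt_const 0 (g z))
    have h8 : (Pi.single j (z j) : Cn n) = z j • Pi.single j (1 : ℂ) := by
      rw [← Pi.single_smul, smul_eq_mul, mul_one]
    rw [ContinuousLinearMap.coe_restrictScalars', map_smul, h8, map_smul] at h7
    have h9 : (2 * Real.pi * Complex.I : ℂ) ≠ 0 := Complex.two_pi_I_ne_zero
    simpa [h9, hz j] using h7
  ext v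
  have h2 := linear_eq_sum_single (fderiv ℂ g z : Cn n →ₗ[ℂ] ℂ) v
  simp only [ContinuousLinearMap.coe_coe, h1, smul_zero, Finset.sum_const_zero] at h2
  exact h2

theorem differentiableAt_prod_zpow (k : Fin n → ℤ) {z : Cn n} (hz : ∀ j, z j ≠ 0) :
    DifferentiableAt ℂ (fun z : Cn n => ∏ j, z j ^ k j) z := by
  have h1 : ∀ j ∈ Finset.univ, DifferentiableAt ℂ (fun z : Cn n => z j ^ k j) z := fun j _ => by
    have h2 : DifferentiableAt ℂ (fun w : ℂ => w ^ k j) (z j) :=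
      differentiableAt_zpow.2 (Or.inl (hz j))
    have h3 : DifferentiableAt ℂ (fun z : Cn n => z j) z := differentiableAt_apply j z
    exact h2.comp z h3
  exact (HasFDerivAt.finsetProd fun j hj => (h1 j hj).hasFDerivAt).differentiableAt

/-- Off the coordinate hyperplanes, the Fourier coefficients of a holomorphic function are locally
multiples of monomials. -/
theorem CDomain.IsReinhardt.exists_torusCoeff_eq (hR : Ω.IsReinhardt)
    (hf : DifferentiableOn ℂ f Ω.set) (k : Fin n → ℤ) {z₀ : Cn n} (hz₀ : z₀ ∈ Ω.set)
    (hz₀' : ∀ j, z₀ j ≠ 0) : ∃ A : ℂ, ∃ r > 0, Metric.ball z₀ r ⊆ Ω.set ∧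
      ∀ z ∈ Metric.ball z₀ r, (∀ j, z j ≠ 0) ∧ torusCoeff f k z = A * ∏ j, z j ^ k j := by
  have hopen : IsOpen (Ω.set ∩ {z | ∀ j, z j ≠ 0}) := by
    refine Ω.isOpen_set.inter ?_
    simp only [ofPred_forall]
    exact isOpen_iInter_of_finite fun j => isOpen_ne.preimage (continuous_apply j)
  obtain ⟨r, hr, hball⟩ := Metric.isOpen_iff.1 hopen z₀ ⟨hz₀, hz₀'⟩
  -- Dividing by the monomial with the same equivariance gives a torus-invariant holomorphic
  -- function.
  let g : Cn n → ℂ := fun z => torusCoeff f k z * ∏ j, z j ^ (-k) j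
  have hgd : DifferentiableOn ℂ g (Metric.ball z₀ r) := fun z hz =>
    (((hR.differentiableOn_torusCoeff hf k).differentiableAt
      (Ω.isOpen_set.mem_nhds (hball hz).1)).mul
        (differentiableAt_prod_zpow (-k) (hball hz).2)).differentiableWithinAt
  have hg0 : EqOn (fderiv ℂ g) 0 (Metric.ball z₀ r) := fun z hz => by
    refine fderiv_eq_zero_of_torus_invariant
      (hgd.differentiableAt (Metric.isOpen_ball.mem_nhds hz)) (hball hz).2 fun t => ?_
    simp only [g]
    rw [torusCoeff_torusPt_mul, mul_comm (∏ j, torusPt t j ^ k j), mul_assoc,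
      ← Finset.prod_mul_distrib]
    congr 1
    refine Finset.prod_congr rfl fun j _ => ?_
    rw [Pi.mul_apply, mul_zpow, ← mul_assoc, Pi.neg_apply, ← zpow_add₀ (torusPt_ne_zero t j),
      add_neg_cancel, zpow_zero, one_mul]
  refine ⟨g z₀, r, hr, hball.trans inter_subset_left, fun z hz => ⟨(hball hz).2, ?_⟩⟩
  rw [← Metric.isOpen_ball.is_const_of_fderiv_eq_zero (convex_ball z₀ r).isPreconnected hgd hg0 hz
    (Metric.mem_ball_self hr)]
  simp only [g]
  rw [mul_assoc, ← Finset.prod_mul_distrib, Finset.prod_eq_one, mul_one]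
  intro j _
  rw [Pi.neg_apply, ← zpow_add₀ ((hball hz).2 j), neg_add_cancel, zpow_zero]

theorem differentiable_monomial (α : Fin n → ℕ) : Differentiable ℂ fun z : Cn n => ∏ j, z j ^ α j := by
  fun_prop

theorem CDomain.eqOn_of_eqOn_ball {g h : Cn n → ℂ} (hg : DifferentiableOn ℂ g Ω.set)
    (hh : DifferentiableOn ℂ h Ω.set) {z₀ : Cn n} {r : ℝ} (hr : 0 < r)
    (hsub : Metric.ball z₀ r ⊆ Ω.set) (heq : EqOn g h (Metric.ball z₀ r)) : EqOn g h Ω.set := by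
  have h1 := eqOn_zero_of_isPreconnected Ω.isOpen_set Ω.connected.isPreconnected (hg.sub hh)
    Metric.isOpen_ball hsub ⟨z₀, Metric.mem_ball_self hr⟩ fun z hz => by
      simp [heq hz]
  intro z hz
  have := h1 hz
  simpa [sub_eq_zero] using this

/-- Locally the coefficient is `A zᵏ`. Clearing the negative powers gives an identity of holomorphic
functions on all of `Ω`; at `z₁` its left side vanishes with the factor `z j`, which is absent from
the right side, so `A = 0`. -/
theorem CDomain.IsReinhardt.torusCoeff_eqOn_zero_of_neg (hR : Ω.IsReinhardt)
    (hf : DifferentiableOn ℂ f Ω.set) {k : Fin n → ℤ} {z₀ : Cn n} (hz₀ : z₀ ∈ Ω.set)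
    (hz₀' : ∀ j, z₀ j ≠ 0) {j : Fin n} (hk : k j < 0) {z₁ : Cn n} (hz₁ : z₁ ∈ Ω.set)
    (hz₁j : z₁ j = 0) (hz₁' : ∀ i, i ≠ j → z₁ i ≠ 0) : EqOn (torusCoeff f k) 0 Ω.set := by
  obtain ⟨A, r, hr, hsub, hA⟩ := hR.exists_torusCoeff_eq hf k hz₀ hz₀'
  have hd := hR.differentiableOn_torusCoeff hf k
  have h1 : EqOn (fun z => torusCoeff f k z * ∏ i, z i ^ (-k i).toNat)
      (fun z => A * ∏ i, z i ^ (k i).toNat) Ω.set := by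
    refine Ω.eqOn_of_eqOn_ball (hd.mul (differentiable_monomial _).differentiableOn)
      ((differentiable_monomial _).differentiableOn.const_mul A) hr hsub fun z hz => ?_
    rw [(hA z hz).2, mul_assoc, ← Finset.prod_mul_distrib]
    congr 1
    refine Finset.prod_congr rfl fun i _ => ?_
    rw [← zpow_natCast, ← zpow_natCast, ← zpow_add₀ ((hA z hz).1 i)]
    congr 1
    omega
  have h2 := h1 hz₁
  simp only at h2
  rw [Finset.prod_eq_zero (Finset.mem_univ j), mul_zero] at h2
  · have h3 : ∏ i, z₁ i ^ (k i).toNat ≠ 0 := by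
      refine Finset.prod_ne_zero_iff.2 fun i _ => ?_
      rcases eq_or_ne i j with rfl | hij
      · rw [Int.toNat_of_nonpos hk.le, pow_zero]
        exact one_ne_zero
      · exact pow_ne_zero _ (hz₁' i hij)
    have hA0 : A = 0 := by
      rcases mul_eq_zero.1 h2.symm with h | h
      · exact h
      · exact absurd h h3
    refine Ω.eqOn_of_eqOn_ball hd (differentiableOn_const 0) hr hsub fun z hz => ?_
    rw [(hA z hz).2, hA0, zero_mul, Pi.zero_apply]
  · rw [hz₁j, zero_pow]
    omega

theorem CDomain.IsReinhardt.exists_torusCoeff_natCast_eqOn (hR : Ω.IsReinhardt)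
    (hf : DifferentiableOn ℂ f Ω.set) (α : Fin n → ℕ) {z₀ : Cn n} (hz₀ : z₀ ∈ Ω.set)
    (hz₀' : ∀ j, z₀ j ≠ 0) : ∃ A : ℂ,
      EqOn (torusCoeff f fun j => (α j : ℤ)) (fun z => A * ∏ j, z j ^ α j) Ω.set := by
  obtain ⟨A, r, hr, hsub, hA⟩ := hR.exists_torusCoeff_eq hf (fun j => (α j : ℤ)) hz₀ hz₀'
  refine ⟨A, Ω.eqOn_of_eqOn_ball (hR.differentiableOn_torusCoeff hf _)
    ((differentiable_monomial α).differentiableOn.const_mul A) hr hsub fun z hz => ?_⟩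
  simpa using (hA z hz).2

/-- Cauchy–Schwarz on each orbit, then invariance of Lebesgue measure under the torus. The bound
excludes monomials of infinite norm. -/
theorem CDomain.IsReinhardt.lintegral_torusCoeff_le (hR : Ω.IsReinhardt)
    (hf : ContinuousOn f Ω.set) (k : Fin n → ℤ) :
    ∫⁻ z in Ω.set, ‖torusCoeff f k z‖ₑ ^ 2 ≤ ∫⁻ z in Ω.set, ‖f z‖ₑ ^ 2 := by
  have hfm := measurable_indicator_of_continuousOn Ω.isOpen_set hf
  have h1 : ∀ z ∈ Ω.set, ‖torusCoeff f k z‖ₑ ^ 2 ≤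
      ∫⁻ t, ‖Ω.set.indicator f (torusPt t * z)‖ₑ ^ 2 ∂torusMeasure n := by
    intro z hz
    refine (enorm_integral_sq_le (((mFourier (-k)).continuous.mul
      (hR.continuous_orbit hf hz)).aestronglyMeasurable)).trans (lintegral_mono fun t => ?_)
    have h2 : ‖mFourier (-k) t‖ₑ = 1 := by
      rw [mFourier_eq_prod, ← ofReal_norm, norm_prod, Finset.prod_eq_one, ENNReal.ofReal_one]
      intro j _
      rw [norm_zpow, norm_torusPt, one_zpow]
    rw [indicator_of_mem (hR.torusPt_mul_mem hz t), Pi.mul_apply, enorm_mul, h2, one_mul]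
  calc _ ≤ ∫⁻ z in Ω.set, ∫⁻ t, ‖Ω.set.indicator f (torusPt t * z)‖ₑ ^ 2 ∂torusMeasure n :=
        setLIntegral_mono' Ω.isOpen_set.measurableSet h1
    _ ≤ ∫⁻ z, ∫⁻ t, ‖Ω.set.indicator f (torusPt t * z)‖ₑ ^ 2 ∂torusMeasure n :=
        setLIntegral_le_lintegral _ _
    _ = ∫⁻ z, ‖Ω.set.indicator f z‖ₑ ^ 2 :=
        lintegral_torus_average (φ := fun z => ‖Ω.set.indicator f z‖ₑ ^ 2) (by fun_prop)
    _ = _ := by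
        rw [← lintegral_indicator Ω.isOpen_set.measurableSet]
        refine lintegral_congr fun z => ?_
        by_cases hz : z ∈ Ω.set
        · rw [indicator_of_mem hz, indicator_of_mem hz]
        · rw [indicator_of_notMem hz, indicator_of_notMem hz]
          simp

theorem CDomain.IsReinhardt.setIntegral_torusCoeff (hR : Ω.IsReinhardt) (α : Fin n → ℕ)
    (hi : IntegrableOn (fun z => f z * conj (∏ j, z j ^ α j)) Ω.set) :
    ∫ z in Ω.set, torusCoeff f (fun j => (α j : ℤ)) z * conj (∏ j, z j ^ α j) =
      ∫ z in Ω.set, f z * conj (∏ j, z j ^ α j) := by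
  let h : Cn n → ℂ := fun z => f z * conj (∏ j, z j ^ α j)
  have hms := Ω.isOpen_set.measurableSet
  have h1 := integral_torus_average (n := n) ((integrable_indicator_iff hms).2 hi)
  rw [integral_indicator hms] at h1
  rw [← h1, ← integral_indicator hms]
  refine integral_congr_ae (Filter.Eventually.of_forall fun z => ?_)
  simp only
  by_cases hz : z ∈ Ω.set
  · rw [indicator_of_mem hz, torusCoeff, ← integral_mul_const]
    refine integral_congr_ae (Filter.Eventually.of_forall fun t => ?_)
    simp only
    rw [indicator_of_mem (hR.torusPt_mul_mem hz t), mFourier_eq_prod]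
    have h2 : ∏ j, torusPt t j ^ (-fun j => (α j : ℤ)) j = conj (∏ j, torusPt t j ^ α j) := by
      rw [map_prod]
      refine Finset.prod_congr rfl fun j _ => ?_
      rw [Pi.neg_apply, zpow_neg, zpow_natCast, map_pow, ← inv_pow]
      congr 1
      rw [torusPt, ← Circle.coe_inv, Circle.coe_inv_eq_conj]
    rw [h2]
    simp only [Pi.mul_apply, mul_pow, Finset.prod_mul_distrib, map_mul]
    ring
  · have h3 : ∀ t, Ω.set.indicator h (torusPt t * z) = 0 := fun t =>
      indicator_of_notMem (fun h' => hz ((hR.torusPt_mul_mem_iff t).1 h')) _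
    rw [indicator_of_notMem hz]
    simp only [h] at h3
    simp only [h3, integral_zero]

theorem CDomain.integrableOn_mul_conj {g : Cn n → ℂ} (hf : Ω.MemA2 f) (hg : Ω.MemA2 g) :
    IntegrableOn (fun z => f z * conj (g z)) Ω.set :=
  hf.2.integrable_mul hg.2.star

theorem CDomain.memA2_monomial_iff (α : Fin n → ℕ) :
    Ω.MemA2 (fun z => ∏ j, z j ^ α j) ↔ ∫⁻ z in Ω.set, ‖∏ j, z j ^ α j‖ₑ ^ 2 < ⊤ := by
  rw [CDomain.memA2_iff]
  exact and_iff_right (differentiable_monomial α).differentiableOn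

/-- A square integrable holomorphic function on a Reinhardt domain which meets all coordinate
hyperplanes vanishes if it is orthogonal to all square integrable monomials. -/
theorem CDomain.IsReinhardt.eqOn_zero_of_inner_monomial (hR : Ω.IsReinhardt) {z₀ : Cn n}
    (hz₀ : z₀ ∈ Ω.set) (hz₀' : ∀ j, z₀ j ≠ 0)
    (hax : ∀ j, ∃ z ∈ Ω.set, z j = 0 ∧ ∀ i, i ≠ j → z i ≠ 0) (hf : Ω.MemA2 f)
    (horth : ∀ α : Fin n → ℕ, Ω.MemA2 (fun z => ∏ j, z j ^ α j) →
      Ω.inner f (fun z => ∏ j, z j ^ α j) = 0) : ∀ z ∈ Ω.set, f z = 0 := by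
  intro z hz
  refine hR.eq_zero_of_torusCoeff hf.1.continuousOn hz fun k => ?_
  by_cases hk : ∃ j, k j < 0
  · obtain ⟨j, hj⟩ := hk
    obtain ⟨z₁, hz₁, hz₁j, hz₁'⟩ := hax j
    exact hR.torusCoeff_eqOn_zero_of_neg hf.1 hz₀ hz₀' hj hz₁ hz₁j hz₁' hz
  · push Not at hk
    obtain ⟨α, rfl⟩ : ∃ α : Fin n → ℕ, k = fun j => (α j : ℤ) :=
      ⟨fun j => (k j).toNat, funext fun j => (Int.toNat_of_nonneg (hk j)).symm⟩
    obtain ⟨A, hA⟩ := hR.exists_torusCoeff_natCast_eqOn hf.1 α hz₀ hz₀'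
    suffices hA0 : A = 0 by
      rw [hA hz]
      simp only [hA0, zero_mul]
    have hms := Ω.isOpen_set.measurableSet
    have hmeas : Measurable fun z : Cn n => ‖∏ j, z j ^ α j‖ₑ ^ 2 := by
      have := (differentiable_monomial α).continuous.measurable
      fun_prop
    -- For a square integrable monomial, orthogonality says that `A` times its positive squared norm
    -- is zero; otherwise a nonzero `A` would give the coefficient, and hence `f`, infinite norm.
    by_cases hα : Ω.MemA2 (fun z => ∏ j, z j ^ α j)
    · have h1 := hR.setIntegral_torusCoeff α (Ω.integrableOn_mul_conj hf hα)
      have h2 : ∫ z in Ω.set, f z * conj (∏ j, z j ^ α j) = 0 := horth α hα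
      rw [h2, setIntegral_congr_fun hms (g := fun z => A * ((‖∏ j, z j ^ α j‖ ^ 2 : ℝ) : ℂ))
        fun z hz => by
          simp only [hA hz]
          rw [mul_assoc, Complex.mul_conj, Complex.normSq_eq_norm_sq]] at h1
      rw [integral_const_mul, integral_complex_ofReal] at h1
      have h3 : 0 < ∫ z in Ω.set, ‖∏ j, z j ^ α j‖ ^ 2 := by
        rw [setIntegral_pos_iff_support_of_nonneg_ae]
        · have h4 : IsOpen (Function.support (fun z : Cn n => ‖∏ j, z j ^ α j‖ ^ 2) ∩ Ω.set) := by
            refine IsOpen.inter ?_ Ω.isOpen_set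
            exact ((differentiable_monomial α).continuous.norm.pow 2).isOpen_support
          refine h4.measure_pos volume ⟨z₀, ?_, hz₀⟩
          have : ∏ j, z₀ j ^ α j ≠ 0 := Finset.prod_ne_zero_iff.2 fun j _ => pow_ne_zero _ (hz₀' j)
          exact pow_ne_zero 2 (norm_ne_zero_iff.2 this)
        · exact Filter.Eventually.of_forall fun z => by simp only [Pi.zero_apply]; positivity
        · exact hα.2.integrable_norm_pow (by norm_num)
      rcases mul_eq_zero.1 h1 with h | h
      · exact h
      · rw [Complex.ofReal_eq_zero] at h
        exact absurd h h3.ne'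
    · rw [CDomain.memA2_monomial_iff, not_lt, top_le_iff] at hα
      by_contra hA0
      have h1 := hR.lintegral_torusCoeff_le hf.1.continuousOn fun j => (α j : ℤ)
      rw [setLIntegral_congr_fun hms (g := fun z => ‖A‖ₑ ^ 2 * ‖∏ j, z j ^ α j‖ₑ ^ 2) fun z hz => by
        simp only [hA hz]
        rw [enorm_mul, mul_pow], lintegral_const_mul _ hmeas, hα, ENNReal.mul_top (by simpa using hA0),
        top_le_iff] at h1
      exact (CDomain.memA2_iff.1 hf).2.ne h1

end Fourier

/-! ### Bergman spaces spanned by the monomials of low degree -/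

section Monomials

open scoped Nat

variable {n : ℕ}

/-- The multi-indices of length at most `m`. -/
def lowDegree (n m : ℕ) : Finset (Fin n → ℕ) :=
  (Finset.range (m + 1)).biUnion fun k => Finset.piAntidiag Finset.univ k

theorem mem_lowDegree {m : ℕ} {α : Fin n → ℕ} : α ∈ lowDegree n m ↔ ∑ i, α i ≤ m := by
  simp [lowDegree, Finset.mem_piAntidiag]

/-- The multinomial theorem for `(1 + x₁ + ⋯ + xₙ) ^ m`. -/
theorem one_add_sum_pow (m : ℕ) (x : Fin n → ℝ) :
    (1 + ∑ i, x i) ^ m = ∑ α ∈ lowDegree n m,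
      (m ! : ℝ) / ((∏ i, ((α i)! : ℝ)) * (m - ∑ i, α i)!) * ∏ i, x i ^ α i := by
  rw [lowDegree, Finset.sum_biUnion, add_comm, add_pow]
  · refine Finset.sum_congr rfl fun k hk => ?_
    have hkm : k ≤ m := Nat.lt_succ_iff.1 (Finset.mem_range.1 hk)
    rw [one_pow, mul_one, Finset.sum_pow_eq_sum_piAntidiag, Finset.sum_mul]
    refine Finset.sum_congr rfl fun α hα => ?_
    have hs : ∑ i, α i = k := (Finset.mem_piAntidiag.1 hα).1
    have h1 := Nat.multinomial_spec Finset.univ α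
    have h2 := Nat.choose_mul_factorial_mul_factorial hkm
    rw [hs] at h1
    rw [hs]
    have h3 : (∏ i, ((α i)! : ℝ)) * (Nat.multinomial Finset.univ α : ℝ) = k ! := by
      exact_mod_cast h1
    have h4 : (m.choose k : ℝ) * k ! * (m - k)! = m ! := by exact_mod_cast h2
    have h5 : (∏ i, ((α i)! : ℝ)) ≠ 0 := Finset.prod_ne_zero_iff.2 fun i _ => by positivity
    have h6 : ((m - k)! : ℝ) ≠ 0 := by positivity
    rw [← h4, ← h3]
    field_simp
  · intro k _ l _ hkl
    refine Finset.disjoint_left.2 fun α h1 h2 => hkl ?_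
    rw [← (Finset.mem_piAntidiag.1 h1).1, (Finset.mem_piAntidiag.1 h2).1]

variable {Ω : CDomain n} {f g : Cn n → ℂ}

/-- Rotating a coordinate `j` with `α j ≠ β j` by the angle `π / (α j - β j)` multiplies the
integrand by `-1` and preserves domain and measure. No integrability is needed. -/
theorem CDomain.IsReinhardt.inner_monomial_eq_zero (hR : Ω.IsReinhardt) {α β : Fin n → ℕ}
    (hαβ : α ≠ β) : Ω.inner (fun z => ∏ j, z j ^ α j) (fun z => ∏ j, z j ^ β j) = 0 := by
  obtain ⟨j, hj⟩ := Function.ne_iff.1 hαβ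
  have hne : ((α j : ℝ) - β j) ≠ 0 := sub_ne_zero.2 (by exact_mod_cast hj)
  let u : ℝ := Real.pi / (α j - β j)
  let ζ : Fin n → ℂ := fun i => if i = j then Complex.exp (u * Complex.I) else 1
  have hζ : ∀ i, ‖ζ i‖ = 1 := fun i => by
    simp only [ζ]
    split_ifs
    · exact Complex.norm_exp_ofReal_mul_I u
    · exact norm_one
  have hζ' : ∀ i, ‖(ζ i)⁻¹‖ = 1 := fun i => by rw [norm_inv, hζ, inv_one]
  have hζ0 : ∀ i, ζ i ≠ 0 := fun i h => by simpa [h] using hζ i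
  have hpre : (fun (z : Cn n) i => ζ i * z i) ⁻¹' Ω.set = Ω.set := by
    ext z
    refine ⟨fun h => ?_, fun h => hR z h ζ hζ⟩
    have h1 := hR _ h (fun i => (ζ i)⁻¹) hζ'
    have h2 : (fun i => (ζ i)⁻¹ * (ζ i * z i)) = z := funext fun i => inv_mul_cancel_left₀ (hζ0 i) _
    rwa [h2] at h1
  have h1 := (measurePreserving_torus hζ).setIntegral_preimage_emb (measurableEmbedding_torus hζ)
    (fun z : Cn n => (∏ i, z i ^ α i) * conj (∏ i, z i ^ β i)) Ω.set
  rw [hpre] at h1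
  have h2 : ∀ z : Cn n, (∏ i, (ζ i * z i) ^ α i) * conj (∏ i, (ζ i * z i) ^ β i) =
      (-1) * ((∏ i, z i ^ α i) * conj (∏ i, z i ^ β i)) := by
    intro z
    have h3 : (∏ i, ζ i ^ α i) * conj (∏ i, ζ i ^ β i) = -1 := by
      have h4 : ∀ γ : Fin n → ℕ, ∏ i, ζ i ^ γ i = Complex.exp (u * Complex.I) ^ γ j := fun γ => by
        rw [Finset.prod_eq_single j]
        · simp [ζ]
        · intro i _ hi
          simp [ζ, hi]
        · simp
      rw [h4, h4, map_pow, ← Complex.exp_conj, ← Complex.exp_nat_mul, ← Complex.exp_nat_mul,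
        ← Complex.exp_add, map_mul, Complex.conj_ofReal, Complex.conj_I, ← Complex.exp_pi_mul_I]
      congr 1
      have h5 : (u : ℂ) * (α j - β j) = Real.pi := by
        simp only [u]
        push_cast
        rw [div_mul_cancel₀]
        exact_mod_cast hne
      linear_combination Complex.I * h5
    simp only [mul_pow, Finset.prod_mul_distrib, map_mul]
    linear_combination (∏ i, z i ^ α i) * conj (∏ i, z i ^ β i) * h3
  simp only [h2] at h1
  rw [integral_const_mul] at h1
  have h6 : Ω.inner (fun z => ∏ j, z j ^ α j) (fun z => ∏ j, z j ^ β j) =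
      ∫ z in Ω.set, (∏ i, z i ^ α i) * conj (∏ i, z i ^ β i) := rfl
  rw [← h6] at h1
  linear_combination (-1 / 2) * h1

theorem CDomain.inner_smul_smul (c d : ℂ) :
    Ω.inner (c • f) (d • g) = c * conj d * Ω.inner f g := by
  unfold CDomain.inner
  rw [← integral_const_mul]
  refine integral_congr_ae (Filter.Eventually.of_forall fun z => ?_)
  simp only [Pi.smul_apply, smul_eq_mul, map_mul]
  ring

theorem CDomain.inner_sub_left {h : Cn n → ℂ} (hf : Ω.MemA2 f) (hg : Ω.MemA2 g) (hh : Ω.MemA2 h) :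
    Ω.inner (f - g) h = Ω.inner f h - Ω.inner g h := by
  unfold CDomain.inner
  rw [← integral_sub (Ω.integrableOn_mul_conj hf hh) (Ω.integrableOn_mul_conj hg hh)]
  refine integral_congr_ae (Filter.Eventually.of_forall fun z => ?_)
  simp only [Pi.sub_apply]
  ring

theorem CDomain.inner_sum_left {ι : Type*} {s : Finset ι} {F : ι → Cn n → ℂ} {h : Cn n → ℂ}
    (hF : ∀ i ∈ s, Ω.MemA2 (F i)) (hh : Ω.MemA2 h) :
    Ω.inner (∑ i ∈ s, F i) h = ∑ i ∈ s, Ω.inner (F i) h := by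
  unfold CDomain.inner
  rw [← integral_finsetSum _ fun i hi => Ω.integrableOn_mul_conj (hF i hi) hh]
  refine integral_congr_ae (Filter.Eventually.of_forall fun z => ?_)
  simp only [Finset.sum_apply, Finset.sum_mul]

theorem CDomain.inner_self_monomial {α : Fin n → ℕ} {r : ℝ} (hr : 0 ≤ r)
    (h : ∫⁻ z in Ω.set, ‖∏ j, z j ^ α j‖ₑ ^ 2 = ENNReal.ofReal r) :
    Ω.inner (fun z => ∏ j, z j ^ α j) (fun z => ∏ j, z j ^ α j) = r := by
  have h1 : ∫ z in Ω.set, ‖∏ j, z j ^ α j‖ ^ 2 = r := by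
    rw [integral_eq_lintegral_of_nonneg_ae (Filter.Eventually.of_forall fun z => by positivity)
      (Continuous.aestronglyMeasurable (by fun_prop))]
    simp only [ENNReal.ofReal_pow (norm_nonneg _), ofReal_norm]
    rw [h, ENNReal.toReal_ofReal hr]
  rw [← h1, ← integral_complex_ofReal]
  unfold CDomain.inner
  refine integral_congr_ae (Filter.Eventually.of_forall fun z => ?_)
  simp only
  rw [Complex.mul_conj, Complex.normSq_eq_norm_sq]

/-- The inverse of the squared norm of the monomial `z^α`. -/
def monomialWeight (m : ℕ) (C : ℝ) (α : Fin n → ℕ) : ℝ :=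
  C * ((m ! : ℝ) / ((∏ i, ((α i)! : ℝ)) * (m - ∑ i, α i)!))

theorem monomialWeight_pos (m : ℕ) {C : ℝ} (hC : 0 < C) (α : Fin n → ℕ) :
    0 < monomialWeight m C α := by
  have h5 : 0 < (∏ i, ((α i)! : ℝ)) := Finset.prod_pos fun i _ => by positivity
  unfold monomialWeight
  positivity

/-- The normalized monomials. -/
def normMonomial (m : ℕ) (C : ℝ) (α : Fin n → ℕ) : Cn n → ℂ :=
  (Real.sqrt (monomialWeight m C α) : ℂ) • fun z => ∏ j, z j ^ α j

theorem CDomain.IsOrthonormalBasis.comp_equiv {ι κ : Type} {ψ : ι → Cn n → ℂ}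
    (h : Ω.IsOrthonormalBasis ψ) (e : κ ≃ ι) : Ω.IsOrthonormalBasis (ψ ∘ e) :=
  ⟨fun k => h.1 _, fun k => h.2.1 _, fun k l hkl => h.2.2.1 _ _ (e.injective.ne hkl),
    fun f hf h0 => h.2.2.2 f hf fun k => by simpa using h0 (e.symm k)⟩

/-- These conditions determine the Bergman space and its kernel. The points with exactly one zero
coordinate rule out Laurent monomials with negative exponents. -/
structure CDomain.HasMonomialNorms (Ω : CDomain n) (m : ℕ) (C : ℝ) : Prop where
  isReinhardt : Ω.IsReinhardt
  exists_ne_zero : ∃ z ∈ Ω.set, ∀ j, z j ≠ 0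
  exists_eq_zero : ∀ j, ∃ z ∈ Ω.set, z j = 0 ∧ ∀ i, i ≠ j → z i ≠ 0
  lintegral_eq : ∀ α : Fin n → ℕ, ∑ i, α i ≤ m →
    ∫⁻ z in Ω.set, ‖∏ j, z j ^ α j‖ₑ ^ 2 = ENNReal.ofReal (monomialWeight m C α)⁻¹
  lintegral_eq_top : ∀ α : Fin n → ℕ, m < ∑ i, α i → ∫⁻ z in Ω.set, ‖∏ j, z j ^ α j‖ₑ ^ 2 = ⊤

namespace CDomain.HasMonomialNorms

variable {m : ℕ} {C : ℝ}

theorem memA2_monomial_iff (h : Ω.HasMonomialNorms m C) (α : Fin n → ℕ) :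
    Ω.MemA2 (fun z => ∏ j, z j ^ α j) ↔ ∑ i, α i ≤ m := by
  rw [CDomain.memA2_monomial_iff]
  refine ⟨fun h1 => ?_, fun h1 => ?_⟩
  · by_contra! h2
    exact h1.ne (h.lintegral_eq_top α h2)
  · rw [h.lintegral_eq α h1]
    exact ENNReal.ofReal_lt_top

theorem memA2_normMonomial (h : Ω.HasMonomialNorms m C) (α : lowDegree n m) :
    Ω.MemA2 (normMonomial m C α.1) :=
  ((h.memA2_monomial_iff α.1).2 (mem_lowDegree.1 α.2)).const_smul _

theorem isOrthonormalBasis (h : Ω.HasMonomialNorms m C) (hC : 0 < C) :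
    Ω.IsOrthonormalBasis fun α : lowDegree n m => normMonomial m C α.1 := by
  refine ⟨h.memA2_normMonomial, fun α => ?_, fun α β hαβ => ?_, fun f hf h0 => ?_⟩
  · have hw := monomialWeight_pos m hC α.1
    have h1 : ((monomialWeight m C α.1 : ℝ) : ℂ) ≠ 0 := Complex.ofReal_ne_zero.2 hw.ne'
    unfold normMonomial
    rw [inner_smul_smul, inner_self_monomial (inv_nonneg.2 hw.le)
      (h.lintegral_eq α.1 (mem_lowDegree.1 α.2)), Complex.conj_ofReal, ← Complex.ofReal_mul,
      Real.mul_self_sqrt hw.le, Complex.ofReal_inv, mul_inv_cancel₀ h1]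
  · unfold normMonomial
    rw [inner_smul_smul, h.isReinhardt.inner_monomial_eq_zero (fun h1 => hαβ (Subtype.ext h1)),
      mul_zero]
  · obtain ⟨z₀, hz₀, hz₀'⟩ := h.exists_ne_zero
    refine h.isReinhardt.eqOn_zero_of_inner_monomial hz₀ hz₀' h.exists_eq_zero hf fun α hα => ?_
    have hα' := (h.memA2_monomial_iff α).1 hα
    have hw := monomialWeight_pos m hC α
    have h1 := h0 ⟨α, mem_lowDegree.2 hα'⟩
    have h2 : (Real.sqrt (monomialWeight m C α) : ℂ) ≠ 0 :=
      Complex.ofReal_ne_zero.2 (Real.sqrt_pos.2 hw).ne'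
    simp only [normMonomial] at h1
    rw [← one_smul ℂ f, inner_smul_smul, one_mul, Complex.conj_ofReal] at h1
    exact (mul_eq_zero.1 h1).resolve_left h2

/-- The normalised monomials form a finite orthonormal basis, and their squared moduli are the terms
of the multinomial expansion of `C (1 + |z|²)ᵐ`. -/
theorem mem_FS (h : Ω.HasMonomialNorms m C) (hC : 0 < C) : Ω ∈ FS m n C := by
  obtain ⟨g, hg⟩ := exists_injective_nat (lowDegree n m)
  let e := Equiv.ofInjective g hg
  let ψ : lowDegree n m → Cn n → ℂ := fun α => normMonomial m C α.1
  refine ⟨fun z w => ∑ α : lowDegree n m, ψ α z * conj (ψ α w), ⟨range g, ψ ∘ e.symm,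
    (h.isOrthonormalBasis hC).comp_equiv e.symm, fun z _ w _ => ?_⟩, fun z _ => ?_⟩
  · exact (e.symm.hasSum_iff (f := fun α => ψ α z * conj (ψ α w))).2 (hasSum_fintype _)
  · rw [one_add_sum_pow, Finset.mul_sum, ← Finset.sum_coe_sort (lowDegree n m),
      Complex.ofReal_sum]
    refine Finset.sum_congr rfl fun α _ => ?_
    have hw := monomialWeight_pos m hC α.1
    simp only [ψ, normMonomial, Pi.smul_apply, smul_eq_mul]
    rw [Complex.mul_conj, Complex.normSq_eq_norm_sq, norm_mul, Complex.norm_real,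
      Real.norm_of_nonneg (Real.sqrt_nonneg _), mul_pow, Real.sq_sqrt hw.le, norm_prod,
      ← Finset.prod_pow]
    congr 1
    rw [monomialWeight, ← mul_assoc]
    congr 1
    refine Finset.prod_congr rfl fun i _ => ?_
    rw [norm_pow, ← pow_mul, ← pow_mul, mul_comm]

theorem a2SpannedByMonomials (h : Ω.HasMonomialNorms m C) (hC : 0 < C) :
    Ω.A2SpannedByMonomials m := by
  intro f
  constructor
  · intro hf
    let ψ : lowDegree n m → Cn n → ℂ := fun α => normMonomial m C α.1
    obtain ⟨hψ, hψ1, hψ0, hψc⟩ := h.isOrthonormalBasis hC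
    let p : Cn n → ℂ := ∑ α, Ω.inner f (ψ α) • ψ α
    have hpm : ∀ α ∈ Finset.univ, Ω.MemA2 (Ω.inner f (ψ α) • ψ α) := fun α _ => (hψ α).const_smul _
    have hp : Ω.MemA2 p := Finset.sum_induction _ Ω.MemA2 (fun _ _ => CDomain.MemA2.add)
      Ω.memA2_zero hpm
    refine ⟨p, Submodule.sum_mem _ fun α _ => Submodule.smul_mem _ _ (Submodule.smul_mem _ _
      (Submodule.subset_span ⟨α.1, mem_lowDegree.1 α.2, rfl⟩)), fun z hz => ?_⟩
    have h1 := hψc (f - p) (hf.sub hp) (fun β => ?_) z hz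
    · exact sub_eq_zero.1 h1
    · rw [inner_sub_left hf hp (hψ β), inner_sum_left hpm (hψ β), Finset.sum_eq_single β]
      · have h2 := inner_smul_smul (Ω := Ω) (f := ψ β) (g := ψ β) (Ω.inner f (ψ β)) 1
        rw [one_smul, map_one, mul_one, hψ1, mul_one] at h2
        rw [h2, sub_self]
      · intro α _ hαβ
        have h2 := inner_smul_smul (Ω := Ω) (f := ψ α) (g := ψ β) (Ω.inner f (ψ α)) 1
        rw [one_smul, hψ0 α β hαβ, mul_zero] at h2
        exact h2
      · simp
  · rintro ⟨g, hg, hfg⟩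
    have h1 : Ω.MemA2 g := by
      clear hfg
      induction hg using Submodule.span_induction with
      | mem x hx =>
        obtain ⟨α, hα, rfl⟩ := hx
        exact (h.memA2_monomial_iff α).2 hα
      | zero => exact Ω.memA2_zero
      | add x y _ _ hx hy => exact hx.add hy
      | smul a x _ hx => exact hx.const_smul a
    rw [CDomain.memA2_iff] at h1 ⊢
    refine ⟨h1.1.congr hfg, ?_⟩
    rw [setLIntegral_congr_fun Ω.isOpen_set.measurableSet (g := fun z => ‖g z‖ₑ ^ 2)
      fun z hz => by simp only [hfg hz]]
    exact h1.2

end CDomain.HasMonomialNorms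

end Monomials

/-! ### Domains defined by a radial profile and a label -/

section ProfileDomain

open Polynomial
open scoped Nat

/-- Labels and radial profiles with the moments of the Fubini–Study kernel, for domains in
`n + 2` variables. -/
structure IsProfile (n m : ℕ) (c a b : ℝ) (lam θ : ℝ → ℝ) : Prop where
  c_pos : 0 < c
  a_pos : 0 < a
  lt : a < b
  lt_one : b < 1
  isOpen_label : ∀ s, IsOpen {x | lam x < s}
  label_moment : ∀ s ∈ Icc (0 : ℝ) 1, ∀ p : ℝ[X], p.natDegree ≤ m + n + 2 →
    ∫ x in Ioo 0 1 ∩ {x | lam x < s}, p.eval x = s * ∫ x in (0 : ℝ)..1, p.eval x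
  continuous_profile : Continuous θ
  antitone_profile : AntitoneOn θ (Ioi 0)
  profile_mem : ∀ t, 0 < t → 0 < θ t ∧ θ t ≤ 1
  profile_tail : ∀ t, 2 ≤ t → θ t = c / (1 + t) ^ (n + 1 + m + 2)
  profile_moment : ∀ k ≤ m, IntegrableOn (fun t => t ^ (k + (n + 1)) * θ t) (Ioi b) ∧
    (∫ t in a..b, t ^ (k + (n + 1))) + ∫ t in Ioi b, t ^ (k + (n + 1)) * θ t =
      c * (((k + (n + 1))! * (m - k)! : ℝ) / (n + 1 + m + 1)!)

theorem normSq_smul {n : ℕ} (r : ℝ) (z : Cn n) : normSq ((r : ℂ) • z) = r ^ 2 * normSq z := by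
  simp only [normSq, Pi.smul_apply, smul_eq_mul, norm_mul, Complex.norm_real, mul_pow,
    Finset.mul_sum, Real.norm_eq_abs, sq_abs]

theorem normSq_pos_iff {n : ℕ} {z : Cn n} : 0 < normSq z ↔ z ≠ 0 := by
  rw [← not_iff_not, not_lt, not_ne_iff]
  constructor
  · intro h
    have h1 : ∑ i, ‖z i‖ ^ 2 = 0 := le_antisymm h (normSq_nonneg z)
    rw [Finset.sum_eq_zero_iff_of_nonneg fun i _ => by positivity] at h1
    funext i
    simpa using h1 i (Finset.mem_univ i)
  · rintro rfl
    simp [normSq]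

theorem normSq_scale {n : ℕ} {z : Cn n} (hz : z ≠ 0) {t : ℝ} (ht : 0 ≤ t) :
    normSq ((Real.sqrt (t / normSq z) : ℂ) • z) = t := by
  have h := normSq_pos_iff.2 hz
  rw [normSq_smul, Real.sq_sqrt (by positivity), div_mul_cancel₀ _ h.ne']

/-- The shell is the continuous image, under radial rescaling, of the punctured space times an
interval. -/
theorem isPreconnected_shell (n : ℕ) {a : ℝ} (ha : 0 ≤ a) (b : ℝ) :
    IsPreconnected {z : Cn (n + 1) | a < normSq z ∧ normSq z < b} := by
  have hrank : 1 < Module.rank ℝ (Cn (n + 1)) := by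
    rw [← Module.finrank_eq_rank, finrank_real_of_complex]
    simp only [Module.finrank_fintype_fun_eq_card, Fintype.card_fin]
    exact_mod_cast (by omega : 1 < 2 * (n + 1))
  have h1 := (isConnected_compl_singleton_of_one_lt_rank hrank (0 : Cn (n + 1))).isPreconnected
  have h2 := h1.prod (isPreconnected_Ioo (a := a) (b := b))
  have h3 := h2.image (fun p : Cn (n + 1) × ℝ => (Real.sqrt (p.2 / normSq p.1) : ℂ) • p.1) (by
    have hd : ContinuousOn (fun p : Cn (n + 1) × ℝ => p.2 / normSq p.1) ({0}ᶜ ×ˢ Ioo a b) :=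
      continuous_snd.continuousOn.div (continuous_normSq.comp continuous_fst).continuousOn
        fun p hp => (normSq_pos_iff.2 hp.1).ne'
    exact (Complex.continuous_ofReal.comp_continuousOn hd.sqrt).smul continuous_fst.continuousOn)
  convert h3
  ext z
  simp only [mem_ofPred_eq, mem_image, mem_prod, mem_compl_iff, mem_singleton_iff, mem_Ioo,
    Prod.exists]
  constructor
  · rintro ⟨hz1, hz2⟩
    have hz0 : 0 < normSq z := ha.trans_lt hz1
    refine ⟨z, normSq z, ⟨normSq_pos_iff.1 hz0, hz1, hz2⟩, ?_⟩
    rw [div_self hz0.ne', Real.sqrt_one, Complex.ofReal_one, one_smul]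
  · rintro ⟨v, r, ⟨hv, hr1, hr2⟩, rfl⟩
    rw [normSq_scale hv (ha.trans hr1.le)]
    exact ⟨hr1, hr2⟩

variable {n m : ℕ} {c a b : ℝ} {lam θ : ℝ → ℝ}

/-- The set of all `z` with `a < ‖z‖²` and either `‖z‖² < b` or
`lam (|z₀|² / ‖z‖²) < θ (‖z‖²)`. -/
def profileSet (n : ℕ) (a b : ℝ) (lam θ : ℝ → ℝ) : Set (Cn (n + 2)) :=
  {z | a < normSq z ∧ (normSq z < b ∨ lam (‖z 0‖ ^ 2 / normSq z) < θ (normSq z))}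

namespace IsProfile

theorem isOpen_lt (h : IsProfile n m c a b lam θ) : IsOpen {p : ℝ × ℝ | lam p.2 < θ p.1} := by
  have h1 : {p : ℝ × ℝ | lam p.2 < θ p.1} = ⋃ r : ℝ, {t | r < θ t} ×ˢ {x | lam x < r} := by
    ext p
    simp only [mem_ofPred_eq, mem_iUnion, mem_prod]
    exact ⟨fun hp => (exists_between hp).imp fun r hr => ⟨hr.2, hr.1⟩, fun ⟨r, hr1, hr2⟩ =>
      hr2.trans hr1⟩
  rw [h1]
  exact isOpen_iUnion fun r =>
    (isOpen_Ioi.preimage h.continuous_profile).prod (h.isOpen_label r)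

theorem isOpen_region (h : IsProfile n m c a b lam θ) :
    IsOpen {p : ℝ × ℝ | a < p.1 ∧ (p.1 < b ∨ lam p.2 < θ p.1)} :=
  (isOpen_Ioi.preimage continuous_fst).inter
    ((isOpen_Iio.preimage continuous_fst).union h.isOpen_lt)

theorem isOpen_profileSet (h : IsProfile n m c a b lam θ) : IsOpen (profileSet n a b lam θ) := by
  have h1 : ContinuousOn (fun z : Cn (n + 2) => (normSq z, ‖z 0‖ ^ 2 / normSq z))
      {z | a < normSq z} := by
    refine continuous_normSq.continuousOn.prodMk (ContinuousOn.div (by fun_prop)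
      continuous_normSq.continuousOn fun z hz => ?_)
    exact (h.a_pos.trans hz).ne'
  have h2 := h1.isOpen_inter_preimage (isOpen_Ioi.preimage continuous_normSq) h.isOpen_region
  convert h2 using 1
  ext z
  simp only [profileSet, mem_ofPred_eq, mem_inter_iff, mem_preimage]
  tauto

theorem exists_mem_of_ne_zero (h : IsProfile n m c a b lam θ) {v : Cn (n + 2)} (hv : v ≠ 0) {t : ℝ}
    (hat : a < t) (htb : t < b) :
    ∃ s : ℝ, 0 < s ∧ (s : ℂ) • v ∈ profileSet n a b lam θ ∧ normSq ((s : ℂ) • v) = t := by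
  have ht : 0 < t := h.a_pos.trans hat
  have h1 := normSq_scale hv ht.le
  refine ⟨Real.sqrt (t / normSq v), Real.sqrt_pos.2 (div_pos ht (normSq_pos_iff.2 hv)), ?_, h1⟩
  exact ⟨by rw [h1]; exact hat, Or.inl (by rw [h1]; exact htb)⟩

/-- The ratio `|z₀|²/|z|²` is constant on rays and `θ` decreases, so a point outside the shell can
be shrunk radially into it without leaving the set. -/
theorem isConnected_profileSet (h : IsProfile n m c a b lam θ) :
    IsConnected (profileSet n a b lam θ) := by
  obtain ⟨t, hat, htb⟩ := exists_between h.lt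
  have ht : 0 < t := h.a_pos.trans hat
  obtain ⟨s₀, -, hs₀, hs₀t⟩ := h.exists_mem_of_ne_zero (v := 1) one_ne_zero hat htb
  set x : Cn (n + 2) := (s₀ : ℂ) • 1 with hx
  set S : Set (Cn (n + 2)) := {z | a < normSq z ∧ normSq z < b} with hS
  have hSpre : IsPreconnected S := isPreconnected_shell (n + 1) h.a_pos.le b
  have hSsub : S ⊆ profileSet n a b lam θ := fun z hz => ⟨hz.1, Or.inl hz.2⟩
  have hxS : x ∈ S := ⟨hs₀t ▸ hat, hs₀t ▸ htb⟩
  refine ⟨⟨x, hs₀⟩, isPreconnected_of_forall x fun y hy => ?_⟩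
  rcases lt_or_ge (normSq y) b with hyb | hyb
  · exact ⟨S, hSsub, hxS, ⟨hy.1, hyb⟩, hSpre⟩
  have hy0 : 0 < normSq y := h.a_pos.trans hy.1
  have hlam := hy.2.resolve_left (not_lt.2 hyb)
  set σ : ℝ := Real.sqrt (t / normSq y) with hσ
  have hσ0 : 0 < σ := Real.sqrt_pos.2 (by positivity)
  have hσ1 : σ ≤ 1 := by
    rw [hσ, Real.sqrt_le_iff, one_pow, div_le_one hy0]
    exact ⟨zero_le_one, by linarith⟩
  have hσt : normSq ((σ : ℂ) • y) = t := normSq_scale (normSq_pos_iff.1 hy0) ht.le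
  let G : Set (Cn (n + 2)) := (fun r : ℝ => (r : ℂ) • y) '' Icc σ 1
  have hG : IsPreconnected G := isPreconnected_Icc.image _ (by fun_prop)
  have hGsub : G ⊆ profileSet n a b lam θ := by
    rintro _ ⟨r, hr, rfl⟩
    have hr0 : 0 < r := hσ0.trans_le hr.1
    have h1 : t ≤ normSq ((r : ℂ) • y) := by
      rw [← hσt, normSq_smul, normSq_smul]
      have := hr.1
      gcongr
    have h2 : normSq ((r : ℂ) • y) ≤ normSq y := by
      rw [normSq_smul]
      have : r ^ 2 ≤ 1 := pow_le_one₀ hr0.le hr.2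
      nlinarith
    have h3 : ‖((r : ℂ) • y) 0‖ ^ 2 / normSq ((r : ℂ) • y) = ‖y 0‖ ^ 2 / normSq y := by
      rw [normSq_smul, Pi.smul_apply, smul_eq_mul, norm_mul, Complex.norm_real, mul_pow,
        Real.norm_eq_abs, sq_abs, mul_div_mul_left _ _ (by positivity)]
    refine ⟨hat.trans_le h1, Or.inr ?_⟩
    rw [h3]
    exact hlam.trans_le (h.antitone_profile (ht.trans_le h1) hy0 h2)
  have hσG : (σ : ℂ) • y ∈ G := ⟨σ, ⟨le_rfl, hσ1⟩, rfl⟩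
  have hσS : (σ : ℂ) • y ∈ S := ⟨hσt.symm ▸ hat, hσt.symm ▸ htb⟩
  refine ⟨S ∪ G, union_subset hSsub hGsub, Or.inl hxS, Or.inr ⟨1, ⟨hσ1, le_rfl⟩, by simp⟩,
    hSpre.union _ hσS hσG hG⟩

/-- The domain defined by a profile. -/
def domain (h : IsProfile n m c a b lam θ) : CDomain (n + 2) where
  carrier := ⟨profileSet n a b lam θ, h.isOpen_profileSet⟩
  connected := h.isConnected_profileSet

theorem domain_set (h : IsProfile n m c a b lam θ) : h.domain.set = profileSet n a b lam θ := rfl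

theorem isReinhardt_domain (h : IsProfile n m c a b lam θ) : h.domain.IsReinhardt := by
  intro z hz ζ hζ
  have h1 : normSq (fun j => ζ j * z j) = normSq z := by
    simp only [normSq, norm_mul, hζ, one_mul]
  rw [domain_set, profileSet, mem_ofPred_eq] at hz ⊢
  rw [h1, norm_mul, hζ, one_mul]
  exact hz

/-- The moment identity for the polynomial `1` gives the sublevel set positive measure. -/
theorem exists_label_lt (h : IsProfile n m c a b lam θ) {s : ℝ} (hs : 0 < s) :
    ∃ x ∈ Ioo (0 : ℝ) 1, lam x < s := by
  have h1 := h.label_moment (min s 1) ⟨by positivity, min_le_right _ _⟩ 1 (by simp)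
  by_contra! hcon
  have h2 : Ioo (0 : ℝ) 1 ∩ {x | lam x < min s 1} = ∅ := by
    ext x
    simp only [mem_inter_iff, mem_ofPred_eq, mem_empty_iff_false, iff_false, not_and, not_lt]
    exact fun hx => (min_le_left _ _).trans (hcon x hx)
  rw [h2] at h1
  have h3 : 0 < min s 1 := by positivity
  simp at h1
  linarith

end IsProfile

theorem exists_normSq_eq (n : ℕ) {t x : ℝ} (ht : 0 < t) (hx : x ∈ Icc (0 : ℝ) 1) :
    ∃ z : Cn (n + 2), normSq z = t ∧ ‖z 0‖ ^ 2 / normSq z = x := by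
  let z : Cn (n + 2) := Fin.cons (Real.sqrt (t * x) : ℂ)
    (Fin.cons (Real.sqrt (t * (1 - x)) : ℂ) 0)
  have hx0 := hx.1
  have hx1 : 0 ≤ 1 - x := by linarith [hx.2]
  have h0 : ‖z 0‖ ^ 2 = t * x := by
    simp only [z, Fin.cons_zero]
    rw [Complex.norm_real, Real.norm_eq_abs, sq_abs, Real.sq_sqrt (by positivity)]
  have h1 : normSq z = t := by
    rw [normSq_eq_succ, h0]
    simp only [z, Fin.tail_cons, normSq, Fin.sum_univ_succ, Fin.cons_zero, Fin.cons_succ]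
    rw [Complex.norm_real, Real.norm_eq_abs, sq_abs, Real.sq_sqrt (by positivity)]
    simp
    ring
  exact ⟨z, h1, by rw [h1, h0, mul_div_cancel_left₀ _ ht.ne']⟩

namespace IsProfile

theorem exists_mem_profileSet (h : IsProfile n m c a b lam θ) {t : ℝ} (ht : a < t) :
    ∃ z ∈ profileSet n a b lam θ, normSq z = t := by
  have ht0 : 0 < t := h.a_pos.trans ht
  obtain ⟨x, hx, hlt⟩ := h.exists_label_lt (h.profile_mem t ht0).1
  obtain ⟨z, hz1, hz2⟩ := exists_normSq_eq n ht0 (Ioo_subset_Icc_self hx)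
  exact ⟨z, ⟨by rw [hz1]; exact ht, Or.inr (by rw [hz1] at hz2 ⊢; rw [hz2]; exact hlt)⟩, hz1⟩

theorem isUnbounded_domain (h : IsProfile n m c a b lam θ) : h.domain.IsUnbounded := by
  intro hb
  obtain ⟨R, hR⟩ := (isBounded_iff_forall_norm_le.1 hb)
  obtain ⟨z, hz, hzt⟩ := h.exists_mem_profileSet (t := (n + 2) * R ^ 2 + a + 1)
    (by have : 0 ≤ (n + 2) * R ^ 2 := by positivity
        linarith)
  have h1 := hR z hz
  have h2 : normSq z ≤ (n + 2) * R ^ 2 := by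
    have h3 : ∀ i, ‖z i‖ ^ 2 ≤ R ^ 2 := fun i =>
      pow_le_pow_left₀ (norm_nonneg _) ((norm_le_pi_norm z i).trans h1) 2
    have h4 := Finset.sum_le_sum fun i (_ : i ∈ Finset.univ) => h3 i
    simpa [normSq] using h4
  have := h.a_pos
  linarith

/-- The label is common to both domains: on the unit sphere, outside both holes, a point with label
below both profile values lies in each. -/
theorem domain_inter_nonempty {m' : ℕ} {c' a' b' : ℝ} {θ' : ℝ → ℝ}
    (h : IsProfile n m c a b lam θ) (h' : IsProfile n m' c' a' b' lam θ') :
    (h.domain.set ∩ h'.domain.set).Nonempty := by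
  obtain ⟨x, hx, hlt⟩ := h.exists_label_lt
    (lt_min (h.profile_mem 1 one_pos).1 (h'.profile_mem 1 one_pos).1)
  obtain ⟨z, hz1, hz2⟩ := exists_normSq_eq n one_pos (Ioo_subset_Icc_self hx)
  rw [hz1] at hz2
  refine ⟨z, ⟨?_, Or.inr ?_⟩, ⟨?_, Or.inr ?_⟩⟩
  · rw [hz1]; exact h.lt.trans h.lt_one
  · rw [hz1, hz2]; exact hlt.trans_le (min_le_left _ _)
  · rw [hz1]; exact h'.lt.trans h'.lt_one
  · rw [hz1, hz2]; exact hlt.trans_le (min_le_right _ _)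

theorem exists_ne_zero (h : IsProfile n m c a b lam θ) : ∃ z ∈ h.domain.set, ∀ j, z j ≠ 0 := by
  obtain ⟨t, hat, htb⟩ := exists_between h.lt
  obtain ⟨s, hs, hmem, -⟩ := h.exists_mem_of_ne_zero (v := 1) one_ne_zero hat htb
  refine ⟨_, hmem, fun j => ?_⟩
  simpa using hs.ne'

theorem exists_eq_zero (h : IsProfile n m c a b lam θ) (j : Fin (n + 2)) :
    ∃ z ∈ h.domain.set, z j = 0 ∧ ∀ i, i ≠ j → z i ≠ 0 := by
  obtain ⟨t, hat, htb⟩ := exists_between h.lt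
  let v : Cn (n + 2) := Function.update 1 j 0
  have hv : v ≠ 0 := by
    obtain ⟨i, hi⟩ := exists_ne j
    intro h0
    have := congrFun h0 i
    simp [v, Function.update_of_ne hi] at this
  obtain ⟨s, hs, hmem, -⟩ := h.exists_mem_of_ne_zero hv hat htb
  refine ⟨_, hmem, by simp [v], fun i hi => ?_⟩
  simpa [v, Function.update_of_ne hi] using hs.ne'

end IsProfile

end ProfileDomain

/-! ### The norms of the monomials on domains defined by a profile -/

section ProfileMoments

open Polynomial
open scoped Nat

variable {n m : ℕ} {c a b : ℝ} {lam θ : ℝ → ℝ}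

open Classical in
/-- The indicator function of the region defining `profileSet`. -/
def regionIndicator (a b : ℝ) (lam θ : ℝ → ℝ) (t x : ℝ) : ℝ≥0∞ :=
  if a < t ∧ (t < b ∨ lam x < θ t) then 1 else 0

theorem setLIntegral_eq_mul_regionIndicator {g : Cn (n + 2) → ℝ≥0∞}
    (hs : MeasurableSet (profileSet n a b lam θ)) :
    ∫⁻ z in profileSet n a b lam θ, g z =
      ∫⁻ z, g z * regionIndicator a b lam θ (normSq z) (‖z 0‖ ^ 2 / normSq z) := by
  rw [← lintegral_indicator hs]
  refine lintegral_congr fun z => ?_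
  by_cases hz : z ∈ profileSet n a b lam θ
  · have hz' : a < normSq z ∧ (normSq z < b ∨ lam (‖z 0‖ ^ 2 / normSq z) < θ (normSq z)) := hz
    rw [indicator_of_mem hz, regionIndicator, if_pos hz', mul_one]
  · have hz' : ¬ (a < normSq z ∧ (normSq z < b ∨ lam (‖z 0‖ ^ 2 / normSq z) < θ (normSq z))) := hz
    rw [indicator_of_notMem hz, regionIndicator, if_neg hz', mul_zero]

theorem enorm_monomial_sq {k : ℕ} (α : Fin k → ℕ) (z : Cn k) :
    ‖∏ j, z j ^ α j‖ₑ ^ 2 = ENNReal.ofReal (∏ i, (‖z i‖ ^ 2) ^ α i) := by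
  rw [← ofReal_norm, ← ENNReal.ofReal_pow (norm_nonneg _), norm_prod, ← Finset.prod_pow]
  congr 1
  refine Finset.prod_congr rfl fun i _ => ?_
  rw [norm_pow, ← pow_mul, ← pow_mul, mul_comm]

/-- The polynomial `xᵖ (1 - x)^q`. -/
def betaPoly (p q : ℕ) : ℝ[X] := X ^ p * (1 - X) ^ q

theorem eval_betaPoly (p q : ℕ) (x : ℝ) : (betaPoly p q).eval x = x ^ p * (1 - x) ^ q := by
  simp [betaPoly]

theorem natDegree_betaPoly_le (p q : ℕ) : (betaPoly p q).natDegree ≤ p + q := by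
  refine natDegree_mul_le.trans (add_le_add (natDegree_X_pow_le p) ?_)
  refine natDegree_pow_le.trans ?_
  have : (1 - X : ℝ[X]).natDegree ≤ 1 := by
    refine (natDegree_sub_le _ _).trans ?_
    simp
  nlinarith

theorem lintegral_betaPoly_eq_ofReal (p q : ℕ) {s : Set ℝ} (hs : MeasurableSet s) :
    ∫⁻ x in Ioo 0 1 ∩ s, ENNReal.ofReal (x ^ p * (1 - x) ^ q) =
      ENNReal.ofReal (∫ x in Ioo 0 1 ∩ s, (betaPoly p q).eval x) := by
  simp only [eval_betaPoly]
  rw [ofReal_integral_eq_lintegral_ofReal]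
  · exact (ContinuousOn.integrableOn_Icc (by fun_prop)).mono_set
      (inter_subset_left.trans Ioo_subset_Icc_self)
  · refine (ae_restrict_iff' (measurableSet_Ioo.inter hs)).2
      (Filter.Eventually.of_forall fun x hx => ?_)
    have h1 := hx.1.1
    have h2 : 0 < 1 - x := by linarith [hx.1.2]
    simp only [Pi.zero_apply]
    positivity

theorem lintegral_regionIndicator_of_not_lt (hlam : ∀ s, IsOpen {x | lam x < s}) (p q : ℕ) {t : ℝ}
    (hat : a < t) (htb : ¬ t < b) :
    ∫⁻ x in Ioo (0 : ℝ) 1, ENNReal.ofReal (x ^ p * (1 - x) ^ q) * regionIndicator a b lam θ t x =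
      ENNReal.ofReal (∫ x in Ioo 0 1 ∩ {x | lam x < θ t}, (betaPoly p q).eval x) := by
  have hs := (hlam (θ t)).measurableSet
  rw [← lintegral_betaPoly_eq_ofReal p q hs, inter_comm, ← Measure.restrict_restrict hs,
    ← lintegral_indicator hs]
  refine lintegral_congr fun x => ?_
  by_cases hx : lam x < θ t
  · rw [indicator_of_mem (show x ∈ {x | lam x < θ t} from hx), regionIndicator,
      if_pos ⟨hat, Or.inr hx⟩, mul_one]
  · rw [indicator_of_notMem (show x ∉ {x | lam x < θ t} from hx), regionIndicator,
      if_neg (by tauto), mul_zero]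

theorem lintegral_inv_Ioi_two : ∫⁻ t in Ioi (2 : ℝ), ENNReal.ofReal t⁻¹ = ⊤ := by
  by_contra h
  refine not_integrableOn_Ioi_inv (a := 2) ?_
  refine (lintegral_ofReal_ne_top_iff_integrable ?_ ?_).1 h
  · exact measurable_inv.aestronglyMeasurable
  · refine (ae_restrict_iff' measurableSet_Ioi).2 (Filter.Eventually.of_forall fun t ht => ?_)
    have ht' : (2 : ℝ) < t := ht
    simp only [Pi.zero_apply]
    positivity

namespace IsProfile

theorem measurable_regionIndicator (h : IsProfile n m c a b lam θ) :
    Measurable (Function.uncurry (regionIndicator a b lam θ)) := by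
  classical
  have h1 : Function.uncurry (regionIndicator a b lam θ) =
      {p : ℝ × ℝ | a < p.1 ∧ (p.1 < b ∨ lam p.2 < θ p.1)}.indicator 1 := by
    funext p
    simp only [Function.uncurry, regionIndicator, indicator, mem_ofPred_eq, Pi.one_apply]
  rw [h1]
  exact measurable_one.indicator h.isOpen_region.measurableSet

theorem lintegral_monomial (h : IsProfile n m c a b lam θ) (α : Fin (n + 2) → ℕ) :
    ∫⁻ z in h.domain.set, ‖∏ j, z j ^ α j‖ₑ ^ 2 =
      ENNReal.ofReal (Real.pi ^ (n + 2) * (∏ i, (Fin.tail α i)! : ℝ) / (∑ i, Fin.tail α i + n)!) *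
        ∫⁻ t in Ioi (0 : ℝ), ENNReal.ofReal (t ^ (∑ i, α i + (n + 1))) *
          ∫⁻ x in Ioo (0 : ℝ) 1, ENNReal.ofReal (x ^ α 0 * (1 - x) ^ (∑ i, Fin.tail α i + n)) *
            regionIndicator a b lam θ t x := by
  rw [domain_set, setLIntegral_eq_mul_regionIndicator h.isOpen_profileSet.measurableSet]
  simp only [enorm_monomial_sq]
  exact lintegral_monomial_mul α h.measurable_regionIndicator

/-- For large exponents the moment identity is unavailable. By Bernoulli, `(x(1-x))^M` dominates the
quadratic `6^{-M} (1 + M (6x(1-x) - 1))`, to which the identity applies; its integral is `6^{-M}`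
because `6x(1-x)` has mean `1`. -/
theorem le_setIntegral_betaPoly (h : IsProfile n m c a b lam θ) (p q : ℕ) {s : ℝ}
    (hs : s ∈ Icc (0 : ℝ) 1) : s * (1 / 6) ^ (max p q) ≤
      ∫ x in Ioo 0 1 ∩ {x | lam x < s}, (betaPoly p q).eval x := by
  set M := max p q with hM
  let r : ℝ[X] := C ((1 / 6) ^ M) * (1 + C (M : ℝ) * (6 * betaPoly 1 1 - 1))
  have hr : ∀ x, r.eval x = (1 / 6) ^ M * (1 + M * (6 * (x * (1 - x)) - 1)) := fun x => by
    simp [r, eval_betaPoly]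
  have hrd : r.natDegree ≤ 2 := by
    refine (natDegree_C_mul_le _ _).trans ?_
    refine (natDegree_add_le _ _).trans (max_le (by simp) ?_)
    refine (natDegree_C_mul_le _ _).trans ?_
    refine (natDegree_sub_le _ _).trans (max_le ?_ (by simp))
    refine natDegree_mul_le.trans ?_
    have h1 := natDegree_betaPoly_le 1 1
    have h2 : (6 : ℝ[X]).natDegree = 0 := natDegree_ofNat 6
    omega
  have hr1 : ∫ x in (0 : ℝ)..1, r.eval x = (1 / 6) ^ M := by
    simp only [hr]
    rw [intervalIntegral.integral_const_mul, intervalIntegral.integral_add (by simp)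
      (Continuous.intervalIntegrable (by fun_prop) _ _), intervalIntegral.integral_const_mul,
      intervalIntegral.integral_sub (Continuous.intervalIntegrable (by fun_prop) _ _) (by simp),
      intervalIntegral.integral_const_mul]
    have h1 := integral_pow_mul_one_sub_pow 1 1
    simp only [pow_one] at h1
    rw [h1]
    norm_num [Nat.factorial]
  have h1 := h.label_moment s hs r (hrd.trans (by omega))
  rw [hr1] at h1
  rw [← h1]
  have hint : ∀ g : ℝ[X], IntegrableOn (fun x => g.eval x) (Ioo 0 1 ∩ {x | lam x < s}) := fun g =>
    (ContinuousOn.integrableOn_Icc g.continuous.continuousOn).mono_set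
      (inter_subset_left.trans Ioo_subset_Icc_self)
  refine setIntegral_mono_on (hint r) (hint _)
    (measurableSet_Ioo.inter (h.isOpen_label s).measurableSet) fun x hx => ?_
  have hx0 := hx.1.1
  have hx1 : 0 < 1 - x := by linarith [hx.1.2]
  rw [hr, eval_betaPoly]
  have hy : 0 ≤ x * (1 - x) := by positivity
  have h2 := one_add_mul_le_pow (a := 6 * (x * (1 - x)) - 1) (by linarith) M
  calc _ ≤ (1 / 6) ^ M * (1 + (6 * (x * (1 - x)) - 1)) ^ M := by gcongr
    _ = x ^ M * (1 - x) ^ M := by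
      rw [← mul_pow, ← mul_pow]
      congr 1
      ring
    _ ≤ x ^ p * (1 - x) ^ q := by
      have h3 : x ^ M ≤ x ^ p := pow_le_pow_of_le_one hx0.le hx.1.2.le (le_max_left _ _)
      have h4 : (1 - x) ^ M ≤ (1 - x) ^ q :=
        pow_le_pow_of_le_one hx1.le (by linarith) (le_max_right _ _)
      gcongr

/-- For `t > 2` the angular integral is at least a constant times `θ t`, which is of order
`t^{-(n+m+3)}`, while the radial weight has exponent at least `m + n + 2`. The integrand thus
dominates a multiple of `1/t`. -/
theorem lintegral_monomial_eq_top (h : IsProfile n m c a b lam θ) (α : Fin (n + 2) → ℕ)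
    (hα : m < ∑ i, α i) : ∫⁻ z in h.domain.set, ‖∏ j, z j ^ α j‖ₑ ^ 2 = ⊤ := by
  rw [h.lintegral_monomial]
  set N := ∑ i, Fin.tail α i + n
  set K := ∑ i, α i
  have hc := h.c_pos
  have hprod : 0 < (∏ i, ((Fin.tail α i)! : ℝ)) := Finset.prod_pos fun i _ => by positivity
  refine ENNReal.mul_eq_top.2 (Or.inl ⟨?_, ?_⟩)
  · rw [ne_eq, ENNReal.ofReal_eq_zero, not_le]
    positivity
  · rw [← top_le_iff]
    set κ : ℝ := c / 2 ^ (n + 1 + m + 2) * (1 / 6) ^ (max (α 0) N) with hκ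
    have hκ0 : 0 < κ := by positivity
    calc (⊤ : ℝ≥0∞) = ENNReal.ofReal κ * ∫⁻ t in Ioi (2 : ℝ), ENNReal.ofReal t⁻¹ := by
          rw [lintegral_inv_Ioi_two, ENNReal.mul_top]
          simpa using hκ0
      _ = ∫⁻ t in Ioi (2 : ℝ), ENNReal.ofReal κ * ENNReal.ofReal t⁻¹ :=
          (lintegral_const_mul _ (by fun_prop)).symm
      _ ≤ ∫⁻ t in Ioi (2 : ℝ), ENNReal.ofReal (t ^ (K + (n + 1))) *
          ∫⁻ x in Ioo (0 : ℝ) 1, ENNReal.ofReal (x ^ α 0 * (1 - x) ^ N) *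
            regionIndicator a b lam θ t x := by
          refine setLIntegral_mono' measurableSet_Ioi fun t ht => ?_
          have ht2 : (2 : ℝ) < t := ht
          have hb := h.lt_one
          have hab := h.lt
          have ht0 : 0 < t := by linarith
          have hθ := h.profile_mem t ht0
          rw [lintegral_regionIndicator_of_not_lt h.isOpen_label _ _ (by linarith)
            (not_lt.2 (by linarith)), ← ENNReal.ofReal_mul hκ0.le,
            ← ENNReal.ofReal_mul (by positivity)]
          refine ENNReal.ofReal_le_ofReal ?_
          have h1 := h.le_setIntegral_betaPoly (α 0) N ⟨hθ.1.le, hθ.2⟩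
          refine le_trans ?_ (mul_le_mul_of_nonneg_left h1 (by positivity))
          rw [h.profile_tail t ht2.le, hκ]
          have h2 : t ^ (m + n + 2) ≤ t ^ (K + (n + 1)) :=
            pow_le_pow_right₀ (by linarith) (by omega)
          have h3 : (1 + t) ^ (n + 1 + m + 2) ≤ (2 * t) ^ (n + 1 + m + 2) := by
            gcongr
            linarith
          have h4 : c / 2 ^ (n + 1 + m + 2) * t⁻¹ ≤
              t ^ (K + (n + 1)) * (c / (1 + t) ^ (n + 1 + m + 2)) := by
            calc c / 2 ^ (n + 1 + m + 2) * t⁻¹ =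
                t ^ (m + n + 2) * (c / (2 * t) ^ (n + 1 + m + 2)) := by
                  rw [mul_pow, show n + 1 + m + 2 = m + n + 2 + 1 by ring, pow_succ t]
                  field_simp
                  ring
              _ ≤ t ^ (K + (n + 1)) * (c / (1 + t) ^ (n + 1 + m + 2)) := by gcongr
          calc _ = c / 2 ^ (n + 1 + m + 2) * t⁻¹ * (1 / 6) ^ (max (α 0) N) := by ring
            _ ≤ t ^ (K + (n + 1)) * (c / (1 + t) ^ (n + 1 + m + 2)) *
                (1 / 6) ^ (max (α 0) N) := by gcongr
            _ = _ := by ring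
      _ ≤ _ := lintegral_mono_set (Ioi_subset_Ioi (by norm_num))

/-- The low-degree moment identity of the label replaces the angular integral by `θ t` times the
full beta integral. What remains is the radial moment prescribed for the profile. -/
theorem lintegral_monomial_eq (h : IsProfile n m c a b lam θ) (α : Fin (n + 2) → ℕ)
    (hα : ∑ i, α i ≤ m) : ∫⁻ z in h.domain.set, ‖∏ j, z j ^ α j‖ₑ ^ 2 =
      ENNReal.ofReal (Real.pi ^ (n + 2) * c * ((∏ i, ((α i)! : ℝ)) * (m - ∑ i, α i)!) /
        (n + 2 + m)!) := by
  rw [h.lintegral_monomial]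
  have hs : α 0 + (∑ i, Fin.tail α i + n) + 1 = ∑ i, α i + (n + 1) := by
    rw [Fin.sum_univ_succ α]; simp only [Fin.tail]; ring
  have hprod : (∏ i, ((α i)! : ℝ)) = (α 0)! * ∏ i, ((Fin.tail α i)! : ℝ) := by
    rw [Fin.prod_univ_succ]; simp [Fin.tail]
  set N := ∑ i, Fin.tail α i + n
  set K := ∑ i, α i
  set B : ℝ := ((α 0)! * N ! : ℝ) / (K + (n + 1))! with hB
  have hB0 : 0 ≤ B := by positivity
  have ha := h.a_pos
  have hab := h.lt
  have hb0 : 0 < b := ha.trans hab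
  have hbeta : ∫ x in (0 : ℝ)..1, (betaPoly (α 0) N).eval x = B := by
    simp only [eval_betaPoly]
    rw [integral_pow_mul_one_sub_pow, hs]
  have hin : ∀ t ∈ Ioi (0 : ℝ), ENNReal.ofReal (t ^ (K + (n + 1))) *
      ∫⁻ x in Ioo (0 : ℝ) 1, ENNReal.ofReal (x ^ α 0 * (1 - x) ^ N) *
        regionIndicator a b lam θ t x = ENNReal.ofReal B *
      ((Ioo a b).indicator (fun t => ENNReal.ofReal (t ^ (K + (n + 1)))) t +
        (Ici b).indicator (fun t => ENNReal.ofReal (t ^ (K + (n + 1)) * θ t)) t) := by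
    intro t ht
    have ht0 : (0 : ℝ) < t := ht
    rcases le_or_gt t a with hta | hta
    · rw [indicator_of_notMem (fun h' => not_lt.2 hta h'.1),
        indicator_of_notMem (fun h' : t ∈ Ici b => absurd (mem_Ici.1 h') (by linarith))]
      have h1 : ∀ x, regionIndicator a b lam θ t x = 0 := fun x =>
        if_neg fun h' => not_lt.2 hta h'.1
      simp [h1]
    rcases lt_or_ge t b with htb | htb
    · rw [indicator_of_mem (show t ∈ Ioo a b from ⟨hta, htb⟩),
        indicator_of_notMem (fun h' : t ∈ Ici b => absurd (mem_Ici.1 h') (by linarith)), add_zero,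
        mul_comm (ENNReal.ofReal B)]
      have h1 : ∀ x, regionIndicator a b lam θ t x = 1 := fun x => if_pos ⟨hta, Or.inl htb⟩
      simp only [h1, mul_one]
      rw [lintegral_pow_mul_one_sub_pow, hs]
    · have hθ := h.profile_mem t ht0
      rw [indicator_of_notMem (fun h' => not_lt.2 htb h'.2),
        indicator_of_mem (show t ∈ Ici b from htb), zero_add,
        lintegral_regionIndicator_of_not_lt h.isOpen_label _ _ hta (not_lt.2 htb),
        h.label_moment _ ⟨hθ.1.le, hθ.2⟩ _ ((natDegree_betaPoly_le _ _).trans (by omega)), hbeta,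
        ← ENNReal.ofReal_mul (by positivity), ← ENNReal.ofReal_mul hB0]
      congr 1
      ring
  have hθm := h.continuous_profile.measurable
  obtain ⟨hint, hmom⟩ := h.profile_moment K hα
  have hsub1 : Ioo a b ⊆ Ioi (0 : ℝ) := fun t ht => mem_Ioi.2 (ha.trans ht.1)
  have hsub2 : Ici b ⊆ Ioi (0 : ℝ) := fun t ht => mem_Ioi.2 (hb0.trans_le ht)
  have hI1 : ∫⁻ t in Ioi (0 : ℝ), (Ioo a b).indicator (fun t => ENNReal.ofReal (t ^ (K + (n + 1)))) t =
      ENNReal.ofReal (∫ t in a..b, t ^ (K + (n + 1))) := by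
    rw [lintegral_indicator measurableSet_Ioo, Measure.restrict_restrict measurableSet_Ioo,
      inter_eq_left.2 hsub1, intervalIntegral.integral_of_le hab.le,
      integral_Ioc_eq_integral_Ioo, ofReal_integral_eq_lintegral_ofReal]
    · exact (ContinuousOn.integrableOn_Icc (by fun_prop)).mono_set Ioo_subset_Icc_self
    · refine (ae_restrict_iff' measurableSet_Ioo).2 (Filter.Eventually.of_forall fun t ht => ?_)
      have : 0 < t := ha.trans ht.1
      simp only [Pi.zero_apply]
      positivity
  have hI2 : ∫⁻ t in Ioi (0 : ℝ),
      (Ici b).indicator (fun t => ENNReal.ofReal (t ^ (K + (n + 1)) * θ t)) t =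
      ENNReal.ofReal (∫ t in Ioi b, t ^ (K + (n + 1)) * θ t) := by
    rw [lintegral_indicator measurableSet_Ici, Measure.restrict_restrict measurableSet_Ici,
      inter_eq_left.2 hsub2, (restrict_Ioi_eq_restrict_Ici (a := b)).symm,
      ofReal_integral_eq_lintegral_ofReal hint]
    refine (ae_restrict_iff' measurableSet_Ioi).2 (Filter.Eventually.of_forall fun t ht => ?_)
    have ht0 : 0 < t := hb0.trans ht
    have := (h.profile_mem t ht0).1
    simp only [Pi.zero_apply]
    positivity
  have hI3 : 0 ≤ ∫ t in a..b, t ^ (K + (n + 1)) :=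
    intervalIntegral.integral_nonneg hab.le fun t ht => by
      have : 0 < t := ha.trans_le ht.1
      positivity
  have hI4 : 0 ≤ ∫ t in Ioi b, t ^ (K + (n + 1)) * θ t :=
    setIntegral_nonneg measurableSet_Ioi fun t ht => by
      have ht0 : 0 < t := hb0.trans ht
      have := (h.profile_mem t ht0).1
      positivity
  rw [setLIntegral_congr_fun measurableSet_Ioi hin, lintegral_const_mul _ (by
    refine Measurable.add (Measurable.indicator (by fun_prop) measurableSet_Ioo)
      (Measurable.indicator (by fun_prop) measurableSet_Ici)),
    lintegral_add_left (Measurable.indicator (by fun_prop) measurableSet_Ioo), hI1, hI2,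
    ← ENNReal.ofReal_add hI3 hI4, hmom, ← ENNReal.ofReal_mul hB0,
    ← ENNReal.ofReal_mul (by positivity), hprod, hB]
  congr 1
  have h1 : (N ! : ℝ) ≠ 0 := by positivity
  have h2 : ((K + (n + 1))! : ℝ) ≠ 0 := by positivity
  have h3 : n + 1 + m + 1 = n + 2 + m := by ring
  rw [h3]
  field_simp

theorem hasMonomialNorms (h : IsProfile n m c a b lam θ) {C : ℝ} (hC : 0 < C)
    (hc : c = (n + 2 + m)! / (m ! * Real.pi ^ (n + 2) * C)) :
    h.domain.HasMonomialNorms m C where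
  isReinhardt := h.isReinhardt_domain
  exists_ne_zero := h.exists_ne_zero
  exists_eq_zero := h.exists_eq_zero
  lintegral_eq := fun α hα => by
    rw [h.lintegral_monomial_eq α hα, monomialWeight, hc]
    congr 1
    have h1 : (∏ i, ((α i)! : ℝ)) ≠ 0 := Finset.prod_ne_zero_iff.2 fun i _ => by positivity
    have h2 : ((n + 2 + m)! : ℝ) ≠ 0 := by positivity
    have h3 : ((m - ∑ i, α i)! : ℝ) ≠ 0 := by positivity
    field_simp
  lintegral_eq_top := fun α hα => h.lintegral_monomial_eq_top α hα

end IsProfile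

end ProfileMoments

/-! ### Families of inequivalent domains -/

section Families

open scoped Nat

/-- The lower bound for the constants `C` for which profile domains are constructed. -/
def profileBound (n m : ℕ) : ℝ := 2 * (n + 2 + m)! / (m ! * Real.pi ^ (n + 2))

theorem profileBound_pos (n m : ℕ) : 0 < profileBound n m := by
  unfold profileBound
  positivity

instance nonempty_cDomain (n : ℕ) : Nonempty (CDomain n) :=
  ⟨{ carrier := ⊤, connected := isConnected_univ }⟩

/-- `Ω` is a profile domain with label `lam`, inner radius `√a` and kernel constant `C`. -/
def IsProfileDomain (n m : ℕ) (lam : ℝ → ℝ) (C a : ℝ) (Ω : CDomain (n + 2)) : Prop :=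
  ∃ b θ, ∃ h : IsProfile n m ((n + 2 + m)! / (m ! * Real.pi ^ (n + 2) * C)) a b lam θ,
    Ω = h.domain

theorem exists_isProfileDomain (n m : ℕ) : ∃ lam : ℝ → ℝ, ∀ C, profileBound n m < C →
    ∃ a₀ : ℝ, ∀ μ ∈ Ioo (0 : ℝ) 1, ∃ Ω, IsProfileDomain n m lam C (a₀ * μ) Ω := by
  -- The label is fixed before `C`, so that domains for different constants share it.
  obtain ⟨lam, hlam, hmom⟩ := exists_label (m + n + 2)
  refine ⟨lam, fun C hC => ?_⟩
  have hC0 : 0 < C := (profileBound_pos n m).trans hC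
  have hD : (0 : ℝ) < m ! * Real.pi ^ (n + 2) := by positivity
  have hc : (0 : ℝ) < (n + 2 + m)! / (m ! * Real.pi ^ (n + 2) * C) := by positivity
  have hc2 : ((n + 2 + m)! / (m ! * Real.pi ^ (n + 2) * C) : ℝ) < 1 / 2 := by
    rw [profileBound, div_lt_iff₀ hD] at hC
    rw [div_lt_iff₀ (by positivity)]
    linarith
  obtain ⟨a₀, ha₀, h⟩ := exists_profile m (n + 1) hc hc2
  refine ⟨a₀, fun μ hμ => ?_⟩
  obtain ⟨b, θ, hab, hb, hθ, hanti, hmem, htail, hint⟩ := h μ hμ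
  exact ⟨_, b, θ, ⟨hc, mul_pos ha₀ hμ.1, hab, hb, hlam, hmom, hθ, hanti, hmem, htail, hint⟩, rfl⟩

namespace IsProfileDomain

variable {n m : ℕ} {lam : ℝ → ℝ} {C C' a a' : ℝ} {Ω Ω' : CDomain (n + 2)}

theorem hasMonomialNorms (h : IsProfileDomain n m lam C a Ω) (hC : 0 < C) :
    Ω.HasMonomialNorms m C := by
  obtain ⟨b, θ, h, rfl⟩ := h
  exact h.hasMonomialNorms hC rfl

theorem isUnbounded (h : IsProfileDomain n m lam C a Ω) : Ω.IsUnbounded := by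
  obtain ⟨b, θ, h, rfl⟩ := h
  exact h.isUnbounded_domain

theorem inter_nonempty (h : IsProfileDomain n m lam C a Ω)
    (h' : IsProfileDomain n m lam C' a' Ω') : (Ω.set ∩ Ω'.set).Nonempty := by
  obtain ⟨b, θ, h, rfl⟩ := h
  obtain ⟨b', θ', h', rfl⟩ := h'
  exact h.domain_inter_nonempty h'

/-- The domain with the smaller hole contains points whose squared norm lies strictly between `a`
and `a'`. -/
theorem not_bergmanEquiv_of_lt (h : IsProfileDomain n m lam C a Ω)
    (h' : IsProfileDomain n m lam C' a' Ω') (hm : m ≠ 0) (hC : 0 < C) (hC' : 0 < C')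
    (haa' : a < a') : ¬ BergmanEquiv Ω.toManifold Ω'.toManifold := by
  have hF := (h.hasMonomialNorms hC).mem_FS hC
  have hF' := (h'.hasMonomialNorms hC').mem_FS hC'
  obtain ⟨b, θ, h, rfl⟩ := h
  obtain ⟨b', θ', h', rfl⟩ := h'
  obtain ⟨t, hat, hta'⟩ := exists_between haa'
  obtain ⟨z, hz, hzt⟩ := h.exists_mem_profileSet hat
  exact not_bergmanEquiv_of_normSq_lt hm hC hC' hF hF' (a := a') (fun w hw => hw.1) hz
    (hzt.trans_lt hta')

theorem not_bergmanEquiv_of_ne (h : IsProfileDomain n m lam C a Ω)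
    (h' : IsProfileDomain n m lam C' a' Ω') (hm : m ≠ 0) (hC : 0 < C) (hC' : 0 < C')
    (haa' : a ≠ a') : ¬ BergmanEquiv Ω.toManifold Ω'.toManifold := by
  rcases lt_or_gt_of_ne haa' with hlt | hlt
  · exact h.not_bergmanEquiv_of_lt h' hm hC hC' hlt
  · exact fun he => h'.not_bergmanEquiv_of_lt h hm hC' hC hlt (Relation.EqvGen.symm _ _ he)

theorem pos (h : IsProfileDomain n m lam C a Ω) : 0 < a := by
  obtain ⟨b, θ, h, rfl⟩ := h
  exact h.a_pos

end IsProfileDomain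

theorem exists_family_isProfileDomain (n m : ℕ) : ∃ (lam a₀ : ℝ → ℝ) (Ω : ℝ → ℝ → CDomain (n + 2)),
    ∀ C, profileBound n m < C → ∀ μ ∈ Ioo (0 : ℝ) 1,
      IsProfileDomain n m lam C (a₀ C * μ) (Ω C μ) := by
  obtain ⟨lam, h⟩ := exists_isProfileDomain n m
  choose! a₀ h using h
  choose! Ω h using h
  exact ⟨lam, a₀, Ω, h⟩

end Families

end Bergman

end

theorem theorem2 (m n : ℕ) (hm : 1 ≤ m) (hn : 2 ≤ n) :
    -- (1) different constants: Bergman inequivalent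
    (∀ C C' : ℝ, 0 < C → 0 < C' → ∀ Ω ∈ Bergman.FS m n C, ∀ Ω' ∈ Bergman.FS m n C', C ≠ C' →
      ¬ Bergman.BergmanEquiv Ω.toManifold Ω'.toManifold) ∧
    -- (2) the constant `Cmn` and the families
    ∃ Cmn : ℝ, 0 < Cmn ∧
      (∀ C : ℝ, Cmn < C → ∃ Ω : Bergman.CDomain n, Ω.IsUnbounded ∧ Ω.IsReinhardt ∧
        Ω.A2SpannedByMonomials m ∧ Ω ∈ Bergman.FS m n C) ∧
      ∃ Ω : ℝ → ℝ → Bergman.CDomain n,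
        (∀ C : ℝ, Cmn < C →
          (∀ μ ∈ Set.Ioo (0 : ℝ) 1,
            Ω C μ ∈ Bergman.FS m n C ∧ (Ω C μ).IsUnbounded ∧ (Ω C μ).IsReinhardt) ∧
          (∀ μ ∈ Set.Ioo (0 : ℝ) 1, ∀ μ' ∈ Set.Ioo (0 : ℝ) 1, μ ≠ μ' →
            ¬ Bergman.BergmanEquiv (Ω C μ).toManifold (Ω C μ').toManifold)) ∧
        ∀ C C' : ℝ, Cmn < C → Cmn < C' →
          ∀ μ ∈ Set.Ioo (0 : ℝ) 1, ∀ μ' ∈ Set.Ioo (0 : ℝ) 1,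
            ((Ω C μ).set ∩ (Ω C' μ').set).Nonempty := by
  obtain ⟨n, rfl⟩ := Nat.exists_eq_add_of_le' hn
  have hm0 : m ≠ 0 := by omega
  have hpos := Bergman.profileBound_pos n m
  obtain ⟨lam, a₀, Ω, hΩ⟩ := Bergman.exists_family_isProfileDomain n m
  refine ⟨fun C C' hC hC' Ω hΩ Ω' hΩ' hne h => hne (h.exists_normSq_eq hm0 hC hC' hΩ hΩ').1,
    Bergman.profileBound n m, hpos, fun C hC => ?_, Ω, fun C hC => ⟨fun μ hμ => ?_, ?_⟩, ?_⟩
  · have h := hΩ C hC (1 / 2) ⟨by norm_num, by norm_num⟩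
    have hM := h.hasMonomialNorms (hpos.trans hC)
    exact ⟨Ω C (1 / 2), h.isUnbounded, hM.isReinhardt, hM.a2SpannedByMonomials (hpos.trans hC),
      hM.mem_FS (hpos.trans hC)⟩
  · have h := hΩ C hC μ hμ
    have hM := h.hasMonomialNorms (hpos.trans hC)
    exact ⟨hM.mem_FS (hpos.trans hC), h.isUnbounded, hM.isReinhardt⟩
  · intro μ hμ μ' hμ' hne
    have h := hΩ C hC μ hμ
    -- The family does not record the sign of `a₀ C`, but the hole size `a₀ C * μ` is positive;
    -- hence distinct `μ` give distinct holes.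
    have ha₀ : a₀ C ≠ 0 := left_ne_zero_of_mul h.pos.ne'
    exact h.not_bergmanEquiv_of_ne (hΩ C hC μ' hμ') hm0 (hpos.trans hC) (hpos.trans hC)
      fun he => hne (mul_left_cancel₀ ha₀ he)
  · exact fun C C' hC hC' μ hμ μ' hμ' => (hΩ C hC μ hμ).inter_nonempty (hΩ C' hC' μ' hμ')
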